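/- All rings are associative, and subrings need not contain an identity. A cover of a ring $R$ is a collection of proper subrings of $R$ whose union is $R$; $\sigma(R)$ is the least cardinality of a cover of $R$ ($\sigma(R)=\infty$ if $R$ has no cover); $R$ is $\sigma$-elementary if $\sigma(R)<\sigma(R/I)$ for every nonzero two-sided ideal $I$ of $R$. Let $q_1,q_2$ be powers (with positive exponents) of the same prime $p$, let $q=q_1\otimes q_2$ be the order of the compositum of $\mathbb{F}_{q_1}$ and $\mathbb{F}_{q_2}$, and write $q=q_1^d$. For $n\ge 1$ let $$A(n,q_1,q_2)=\begin{pmatrix} M_n(\mathbb{F}_{q_1}) & M_{n\times 1}(\mathbb{F}_q)\\ 0 & \mathbb{F}_{q_2}\end{pmatrix}\subseteq M_{n+1}(\mathbb{F}_q).$$ For $n\ge 2$ let $a$ be the smallest prime divisor of $n$. Let $\binom{n}{k}_{q}=\prod_{i=0}^{k-1}\frac{q^{n-i}-1}{q^{i+1}-1}$ be the $q$-binomial coefficient and $\omega(d)$ the number of distinct prime divisors of $d$. Put $R=A(n,q_1,q_2)$. (1) Suppose $n\ge 3$ and $d<n-n/a$. Then $R$ has a cover of size $q^n+\binom{n}{d}_{q_1}+\omega(d)$,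 and if $R$ is $\sigma$-elementary, then $\sigma(R)=q^n+\binom{n}{d}_{q_1}+\omega(d)$. Moreover $\sigma(R)\le\sigma(M_n(\mathbb{F}_{q_1}))$, with equality only if $(n,q_1)=(3,2)$, and $R$ is $\sigma$-elementary whenever $(n,q_1)\ne(3,2)$. (2) Suppose $n\ge 2$ and $d\ge n-n/a$. Then $R$ is not $\sigma$-elementary and $\sigma(R)=\sigma(M_n(\mathbb{F}_{q_1}))$. In particular, $R$ is not $\sigma$-elementary when $n=2$. (3) Suppose $n=1$. Then $R$ is $\sigma$-elementary if and only if $(q_1,q_2)$ is neither $(2,2)$ nor $(4,4)$. If $(q_1,q_2)=(2,2)$, then $\sigma(R)=3$; if $(q_1,q_2)=(4,4)$, then $\sigma(R)=4$; otherwise $\sigma(R)=q+1$. -/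

import Mathlib

/-- A cover of a ring `R` (associative, not necessarily unital): a collection of proper subrings
(additive subgroups closed under multiplication, not required to contain an identity) whose union
is `R`. -/
def IsRingCover {R : Type*} [NonUnitalRing R] (C : Set (NonUnitalSubring R)) : Prop :=
  (∀ S ∈ C, S ≠ ⊤) ∧ ∀ x : R, ∃ S ∈ C, x ∈ S

/-- The covering number: the least cardinality of a cover, and `⊤` if there is no (finite)
cover. -/
noncomputable def coveringNumber (R : Type*) [NonUnitalRing R] : ℕ∞ :=
  ⨅ (C : Set (NonUnitalSubring R)) (_ : IsRingCover C), C.encard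

/-- `R` is `σ`-elementary if `σ(R) < σ(R/I)` for every nonzero two-sided ideal `I`
(including `I = R`). -/
def IsSigmaElementary (R : Type*) [NonUnitalRing R] : Prop :=
  ∀ I : TwoSidedIdeal R, I ≠ ⊥ → coveringNumber R < coveringNumber I.ringCon.Quotient

/-- For subfields `F₁, F₂` of `K`, the ring of all block matrices with upper left block in
`M_n(F₁)`, upper right block in `M_{n × 1}(K)`, lower left block `0` and lower right entry
in `F₂`, as a subring of the `(n + 1) × (n + 1)` matrices over `K`. -/
def affineMatrixRing {K : Type*} [Field K] (n : ℕ) (F₁ F₂ : Subfield K) :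
    Subring (Matrix (Fin n ⊕ Unit) (Fin n ⊕ Unit) K) where
  carrier := {M | (∀ i j, M (Sum.inl i) (Sum.inl j) ∈ F₁) ∧
    (∀ j, M (Sum.inr ()) (Sum.inl j) = 0) ∧ M (Sum.inr ()) (Sum.inr ()) ∈ F₂}
  mul_mem' := by
    rintro A B ⟨hA₁, hA₀, hA₂⟩ ⟨hB₁, hB₀, hB₂⟩
    refine ⟨fun i j => ?_, fun j => ?_, ?_⟩
    · simp only [Matrix.mul_apply, Fintype.sum_sum_type, hB₀, mul_zero, Finset.sum_const_zero,
        add_zero]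
      exact F₁.sum_mem fun k _ => F₁.mul_mem (hA₁ i k) (hB₁ k j)
    · simp [Matrix.mul_apply, Fintype.sum_sum_type, hA₀, hB₀]
    · simpa [Matrix.mul_apply, Fintype.sum_sum_type, hA₀] using F₂.mul_mem hA₂ hB₂
  one_mem' := by
    refine ⟨fun i j => ?_, fun j => ?_, ?_⟩
    · rw [Matrix.one_apply]
      split_ifs
      exacts [F₁.one_mem, F₁.zero_mem]
    · simp
    · simp [F₂.one_mem]
  add_mem' := by
    rintro A B ⟨hA₁, hA₀, hA₂⟩ ⟨hB₁, hB₀, hB₂⟩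
    exact ⟨fun i j => F₁.add_mem (hA₁ i j) (hB₁ i j), fun j => by simp [hA₀, hB₀],
      F₂.add_mem hA₂ hB₂⟩
  zero_mem' := ⟨fun _ _ => F₁.zero_mem, fun _ => rfl, F₂.zero_mem⟩
  neg_mem' := by
    rintro A ⟨hA₁, hA₀, hA₂⟩
    exact ⟨fun i j => F₁.neg_mem (hA₁ i j), fun j => by simp [hA₀], F₂.neg_mem hA₂⟩

/-- The `q`-binomial coefficient
`(q^n - 1)(q^(n-1) - 1)⋯(q^(n-k+1) - 1) / ((q^k - 1)⋯(q - 1))`;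
the division is exact for `k ≤ n` and `2 ≤ q`. -/
def qBinomial (n k q : ℕ) : ℕ :=
  (∏ i ∈ Finset.range k, (q ^ (n - i) - 1)) / ∏ i ∈ Finset.range k, (q ^ (i + 1) - 1)

/-!
Write `F = F₁`, `V = F ^ n`, and let `R` be the ring of the triples `(A, w, b)` with `A ∈ M_n(F)`,
`w ∈ K ^ n`, `b ∈ F₂`. The triples `(0, w, 0)` form an ideal `J`, contained in every nonzero
two-sided ideal, with `R / J = M_n(F) × F₂`.

*Reduction to the complements.* A proper subring that projects onto `M_n(F) × F₂` is one of the
`|K| ^ n` complements of `J`, namely `{w = b v - A v}` for some `v ∈ K ^ n`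
(`eq_top_or_eq_complement`). Let `C` be a cover. If the complement of `v` is missing from `C`, then
intersecting the members of `C` with it gives subrings that do not project onto `M_n(F) × F₂`, and
looking at the triples with `b` a generator of `F₂` turns these into a cover of `M_n(F)`, so
`|C| ≥ σ(M_n(F))` (`coveringNumber_matrix_le_of_notMem`). The same argument gives
`σ(R / I) ≥ σ(M_n(F))` for nonzero `I`. So everything is about covers that contain all complements,
and about the size of `σ(M_n(F))`.

*Covers containing all complements.* Such a cover still has to deal with the triples for which
`b - A` is not surjective on `K ^ n`, that is, for which `A` acts like `b` on a quotient of `V` that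
embeds in `K`. The stabilizers of the subspaces of codimension `d` and the subrings
`{b ^ (q₁ ^ (d / ℓ)) = b}`, for the primes `ℓ ∣ d`, do this (`exists_isRingCover`). No smaller
number of subrings does (`le_encard_of_complement_mem`). For `b` of degree `e` over `F`, consider the
linear maps that act like `b` on `F(b)` and like a generator of the field on a second space, of
dimension `n - e`. They form one conjugacy class, and a map of the class has only two proper nonzero
invariant subspaces. By Burnside's theorem on irreducible subrings, a proper subring of `End V` that
meets the class preserves a subspace of dimension `e` or `n - e`, or is linear over a larger field
and hence small (`stable_or_ncard_le`). By homogeneity, the subrings of the first kind contain at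
most the fraction `1 / N_e` of the class, `N_e` being the number of `e`-dimensional subspaces, and
those of the second kind even less. So covering the class for `e = d` takes `N_d` subrings, all of
which project onto `F₂`. If for some `ℓ` no other subring has a generator of the subfield of index
`ℓ` of `F₂` in its projection, then the same subrings also cover a class with `e < d`, which takes
`N_e > ω(d)` more of them; otherwise there is a further subring for each `ℓ`.

*The covering number of `M_n(F)`.* With `a` the least prime factor of `n`, the stabilizers of the
subspaces of dimension at most `n / 2` and the commutants of the extension fields of degree `a` form
a cover of size at most `|V| ^ (n - n / a)` (`coveringNumber_end_le`), which is at most `|K| ^ n` if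
`d ≥ n - n / a`. Conversely, counting the multiplications by a generator of a field of order `|V|`
shows that for `d < n - n / a` the covering number exceeds the size of the cover above, unless
`(n, q₁) = (3, 2)` (`add_one_le_coveringNumber_end`): a proper subring containing such a
multiplication commutes with a larger field and so contains few of them.

*The case `n = 1`.* Here `M_1(F) × F₂ = F₁ × F₂` is generated by one element unless the orders are
`(2, 2)` or `(4, 4)`. If it is, every cover contains all complements and one more subring
(`coveringNumber_of_isRingGenerator`). In the two exceptional cases, three or four elements of which
any two generate `F₁ × F₂` give the lower bound, and covers of `F₁ × F₂` the upper bound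
(`coveringNumber_one`).
-/

/-! ### Generalities on covers -/

theorem coveringNumber_le_of_isRingCover {R : Type*} [NonUnitalRing R]
    {C : Set (NonUnitalSubring R)} (hC : IsRingCover C) : coveringNumber R ≤ C.encard :=
  iInf₂_le C hC

/-- A cover of a homomorphic image pulls back to a cover. -/
theorem IsRingCover.comap {R S : Type*} [NonUnitalRing R] [NonUnitalRing S] (f : R →ₙ+* S)
    (hf : Function.Surjective f) {C : Set (NonUnitalSubring S)} (hC : IsRingCover C) :
    IsRingCover ((fun T => NonUnitalSubring.comap f T) '' C) := by
  refine ⟨?_, fun x => ?_⟩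
  · rintro _ ⟨T, hT, rfl⟩ h
    refine hC.1 T hT (eq_top_iff.2 fun y _ => ?_)
    obtain ⟨x, rfl⟩ := hf y
    have : x ∈ NonUnitalSubring.comap f T := by
      simp only at h
      rw [h]; trivial
    simpa using this
  · obtain ⟨T, hT, hx⟩ := hC.2 (f x)
    exact ⟨_, ⟨T, hT, rfl⟩, by simpa using hx⟩

theorem coveringNumber_le_of_surjective {R S : Type*} [NonUnitalRing R] [NonUnitalRing S]
    (f : R →ₙ+* S) (hf : Function.Surjective f) : coveringNumber R ≤ coveringNumber S :=
  le_iInf₂ fun _ hC =>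
    (coveringNumber_le_of_isRingCover (hC.comap f hf)).trans (Set.encard_image_le _ _)

theorem coveringNumber_eq_of_ringEquiv {R S : Type*} [NonUnitalRing R] [NonUnitalRing S]
    (e : R ≃+* S) : coveringNumber R = coveringNumber S :=
  le_antisymm (coveringNumber_le_of_surjective (e : R →ₙ+* S) e.surjective)
    (coveringNumber_le_of_surjective (e.symm : S →ₙ+* R) e.symm.surjective)

/-- The quotient of the source of a surjective homomorphism by its kernel has covering number at
most that of the target. -/
theorem coveringNumber_ker_quotient_le {R S : Type*} [NonUnitalRing R] [NonUnitalRing S]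
    (f : R →ₙ+* S) (hf : Function.Surjective f) :
    coveringNumber (TwoSidedIdeal.ker f).ringCon.Quotient ≤ coveringNumber S := by
  have hk : ∀ x y, (TwoSidedIdeal.ker f).ringCon x y → f x = f y := by
    intro x y h
    have h' := (TwoSidedIdeal.rel_iff _ _ _).1 h
    rw [TwoSidedIdeal.mem_ker, map_sub, sub_eq_zero] at h'
    exact h'
  let g : (TwoSidedIdeal.ker f).ringCon.Quotient →ₙ+* S :=
    { toFun := fun z => Quotient.lift f hk z
      map_mul' := by rintro ⟨x⟩ ⟨y⟩; exact map_mul f x y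
      map_zero' := map_zero f
      map_add' := by rintro ⟨x⟩ ⟨y⟩; exact map_add f x y }
  refine coveringNumber_le_of_surjective g fun y => ?_
  obtain ⟨x, rfl⟩ := hf y
  exact ⟨(x : (TwoSidedIdeal.ker f).ringCon.Quotient), rfl⟩

theorem IsSigmaElementary.lt_of_surjective {R S : Type*} [NonUnitalRing R] [NonUnitalRing S]
    (h : IsSigmaElementary R) (f : R →ₙ+* S) (hf : Function.Surjective f) {x : R} (hx : x ≠ 0)
    (hfx : f x = 0) : coveringNumber R < coveringNumber S := by
  refine (h (TwoSidedIdeal.ker f) fun hb => hx ?_).trans_le (coveringNumber_ker_quotient_le f hf)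
  rw [← TwoSidedIdeal.mem_bot R, ← hb, TwoSidedIdeal.mem_ker, hfx]

/-- A cover of a quotient by a two-sided ideal pulls back to a cover by subrings that contain the
ideal. -/
theorem le_coveringNumber_quotient {R : Type*} [NonUnitalRing R] (I : TwoSidedIdeal R) (m : ℕ∞)
    (h : ∀ C : Set (NonUnitalSubring R), IsRingCover C → (∀ T ∈ C, ∀ x ∈ I, x ∈ T) →
      m ≤ C.encard) : m ≤ coveringNumber I.ringCon.Quotient := by
  refine le_iInf₂ fun C hC => ?_
  let f : R →ₙ+* I.ringCon.Quotient :=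
    { toFun := fun x => (x : I.ringCon.Quotient)
      map_mul' := fun x y => rfl
      map_zero' := rfl
      map_add' := fun x y => rfl }
  have hf : Function.Surjective f := by rintro ⟨x⟩; exact ⟨x, rfl⟩
  refine (h _ (hC.comap f hf) ?_).trans (Set.encard_image_le _ _)
  rintro _ ⟨T, hT, rfl⟩ x hx
  have : f x = 0 := by
    change (x : I.ringCon.Quotient) = ((0 : R) : I.ringCon.Quotient)
    rw [RingCon.eq]
    exact (TwoSidedIdeal.mem_iff _ _).1 hx
  rw [NonUnitalSubring.mem_comap, this]
  exact T.zero_mem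

/-- Every cover has at least as many members as there are elements in a set any two of whose
elements lie in no common proper subring. -/
theorem encard_le_of_pairwise {R : Type*} [NonUnitalRing R] {C : Set (NonUnitalSubring R)}
    {G : Set R} (hC : ∀ x ∈ G, ∃ T ∈ C, x ∈ T)
    (hG : ∀ x ∈ G, ∀ y ∈ G, ∀ T ∈ C, x ∈ T → y ∈ T → x = y) :
    G.encard ≤ C.encard := by
  choose! f hf hxf using hC
  refine Set.encard_le_encard_of_injOn (f := f) hf fun x hx y hy hxy => ?_
  exact hG x hx y hy (f x) (hf x hx) (hxf x hx) (hxy ▸ hxf y hy)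

/-! ### The ring of block matrices as a ring of triples -/

namespace AffineMatrixRing

variable {K : Type*} [Field K] {n : ℕ} {F₁ F₂ : Subfield K}

/-- The upper left block. -/
def toA : affineMatrixRing n F₁ F₂ →+* Matrix (Fin n) (Fin n) F₁ where
  toFun r := Matrix.of fun i j => ⟨r.1 (Sum.inl i) (Sum.inl j), r.2.1 i j⟩
  map_one' := by
    ext i j
    simp [Matrix.one_apply]
    split_ifs <;> simp_all
  map_mul' r s := by
    ext i j
    simp [Matrix.mul_apply, Fintype.sum_sum_type, s.2.2.1]
  map_zero' := by ext i j; simp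
  map_add' r s := by ext i j; simp

/-- The lower right entry. -/
def toB : affineMatrixRing n F₁ F₂ →+* F₂ where
  toFun r := ⟨r.1 (Sum.inr ()) (Sum.inr ()), r.2.2.2⟩
  map_one' := by ext; simp
  map_mul' r s := by
    ext
    simp [Matrix.mul_apply, Fintype.sum_sum_type, r.2.2.1]
  map_zero' := by ext; simp
  map_add' r s := by ext; simp

/-- The upper right column. -/
def toW : affineMatrixRing n F₁ F₂ →+ (Fin n → K) where
  toFun r i := r.1 (Sum.inl i) (Sum.inr ())
  map_zero' := by ext; simp
  map_add' r s := by ext; simp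

/-- The action of `M_n(F₁)` on `K^n`. -/
def act (A : Matrix (Fin n) (Fin n) F₁) (v : Fin n → K) : Fin n → K :=
  (A.map (fun x : F₁ => (x : K))).mulVec v

theorem act_apply (A : Matrix (Fin n) (Fin n) F₁) (v : Fin n → K) (i : Fin n) :
    act A v i = ∑ j, (A i j : K) * v j := rfl

@[simp] theorem act_zero (A : Matrix (Fin n) (Fin n) F₁) : act A (0 : Fin n → K) = 0 := by
  simp [act]

@[simp] theorem zero_act (v : Fin n → K) : act (0 : Matrix (Fin n) (Fin n) F₁) v = 0 := by
  ext i; simp [act_apply]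

theorem add_act (A B : Matrix (Fin n) (Fin n) F₁) (v : Fin n → K) :
    act (A + B) v = act A v + act B v := by
  ext i; simp [act_apply, add_mul, Finset.sum_add_distrib]

theorem neg_act (A : Matrix (Fin n) (Fin n) F₁) (v : Fin n → K) :
    act (-A) v = - act A v := by
  ext i; simp [act_apply]

theorem act_sub (A : Matrix (Fin n) (Fin n) F₁) (v w : Fin n → K) :
    act A (v - w) = act A v - act A w := Matrix.mulVec_sub _ _ _

theorem act_smul (A : Matrix (Fin n) (Fin n) F₁) (c : K) (v : Fin n → K) :
    act A (c • v) = c • act A v := Matrix.mulVec_smul _ _ _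

theorem mul_act (A B : Matrix (Fin n) (Fin n) F₁) (v : Fin n → K) :
    act (A * B) v = act A (act B v) := by
  unfold act
  rw [Matrix.mulVec_mulVec]
  congr 1
  ext i j
  simp [Matrix.mul_apply]

theorem toW_mul (r s : affineMatrixRing n F₁ F₂) :
    toW (r * s) = act (toA r) (toW s) + (toB s : K) • toW r := by
  ext i
  simp [toW, toA, toB, act_apply, Matrix.mul_apply, Fintype.sum_sum_type, mul_comm]

/-- The matrix with blocks `A`, `w`, `b`. -/
def mk (A : Matrix (Fin n) (Fin n) F₁) (w : Fin n → K) (b : F₂) : affineMatrixRing n F₁ F₂ :=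
  ⟨Matrix.fromBlocks (A.map (fun x : F₁ => (x : K))) (Matrix.of fun i _ => w i) 0
    (Matrix.of fun _ _ => (b : K)), by
      refine ⟨fun i j => ?_, fun j => ?_, ?_⟩ <;> simp⟩

@[simp] theorem toA_mk (A : Matrix (Fin n) (Fin n) F₁) (w : Fin n → K) (b : F₂) :
    toA (mk A w b) = A := by ext; simp [toA, mk]

@[simp] theorem toW_mk (A : Matrix (Fin n) (Fin n) F₁) (w : Fin n → K) (b : F₂) :
    toW (mk A w b) = w := by ext; simp [toW, mk]

@[simp] theorem toB_mk (A : Matrix (Fin n) (Fin n) F₁) (w : Fin n → K) (b : F₂) :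
    toB (mk A w b) = b := by ext; simp [toB, mk]

theorem ext_iff' {r s : affineMatrixRing n F₁ F₂} :
    r = s ↔ toA r = toA s ∧ toW r = toW s ∧ toB r = toB s := by
  refine ⟨by rintro rfl; simp, ?_⟩
  rintro ⟨hA, hW, hB⟩
  apply Subtype.ext
  ext (i | i) (j | j)
  · exact congrArg Subtype.val (congrFun (congrFun hA i) j)
  · exact congrFun hW i
  · rw [show i = () from rfl, r.2.2.1, s.2.2.1]
  · exact congrArg Subtype.val hB

/-- The conjugate of the block diagonal subring `M_n(F₁) × F₂` by the unipotent matrix with upper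
right block `v`. -/
def complement (F₁ F₂ : Subfield K) (v : Fin n → K) :
    NonUnitalSubring (affineMatrixRing n F₁ F₂) where
  carrier := {r | toW r = (toB r : K) • v - act (toA r) v}
  mul_mem' := by
    intro r s hr hs
    simp only [Set.mem_ofPred_eq] at hr hs ⊢
    rw [toW_mul, hr, hs, map_mul, map_mul, mul_act, act_sub, act_smul, smul_sub, smul_smul,
      Subfield.coe_mul, mul_comm (toB r : K)]
    abel
  add_mem' := by
    intro r s hr hs
    simp only [Set.mem_ofPred_eq] at hr hs ⊢
    rw [map_add, hr, hs, map_add, map_add, add_act, Subfield.coe_add, add_smul]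
    abel
  zero_mem' := by simp
  neg_mem' := by
    intro r hr
    simp only [Set.mem_ofPred_eq] at hr ⊢
    rw [map_neg, hr, map_neg, map_neg, neg_act, Subfield.coe_neg, neg_smul]
    abel

theorem mem_complement {v : Fin n → K} {r : affineMatrixRing n F₁ F₂} :
    r ∈ complement F₁ F₂ v ↔ toW r = (toB r : K) • v - act (toA r) v := Iff.rfl

theorem complement_injective :
    Function.Injective (complement (n := n) F₁ F₂) := by
  intro v v' h
  have : mk (0 : Matrix (Fin n) (Fin n) F₁) v (1 : F₂) ∈ complement F₁ F₂ v := by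
    simp [mem_complement]
  rw [h] at this
  simpa [mem_complement] using this

/-- The subring `T` projects onto `M_n(F₁) × F₂`. -/
def ProjectsOnto (T : NonUnitalSubring (affineMatrixRing n F₁ F₂)) : Prop :=
  ∀ A b, ∃ w, mk A w b ∈ T

theorem projectsOnto_complement (v : Fin n → K) : ProjectsOnto (complement F₁ F₂ v) :=
  fun A b => ⟨(b : K) • v - act A v, by simp [mem_complement]⟩

theorem mk_eta (r : affineMatrixRing n F₁ F₂) : mk (toA r) (toW r) (toB r) = r := by
  simp [ext_iff']

theorem mk_mul_mk (A A' : Matrix (Fin n) (Fin n) F₁) (w w' : Fin n → K) (b b' : F₂) :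
    mk A w b * mk A' w' b' = mk (A * A') (act A w' + (b' : K) • w) (b * b') := by
  simp [ext_iff', toW_mul]

theorem mk_add_mk (A A' : Matrix (Fin n) (Fin n) F₁) (w w' : Fin n → K) (b b' : F₂) :
    mk A w b + mk A' w' b' = mk (A + A') (w + w') (b + b') := by
  simp [ext_iff']

theorem mk_sub_mk (A A' : Matrix (Fin n) (Fin n) F₁) (w w' : Fin n → K) (b b' : F₂) :
    mk A w b - mk A' w' b' = mk (A - A') (w - w') (b - b') := by
  simp [ext_iff']

theorem act_single (i j : Fin n) (c : F₁) (w : Fin n → K) :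
    act (Matrix.single i j c) w = Pi.single i ((c : K) * w j) := by
  ext k
  rw [act_apply, Finset.sum_eq_single j]
  · by_cases h : i = k
    · subst h; simp
    · simp [h, Ne.symm h]
  · intro l _ hl
    simp [hl.symm]
  · simp

/-- The radical, the set of matrices whose only nonzero block is the upper right one, is a minimal
ideal: here in the form that a subring projecting onto `M_n(F₁) × F₂` which contains one nonzero
element of the radical is the whole ring. -/
theorem eq_top_of_projectsOnto [Finite K] (hK : F₁ ⊔ F₂ = ⊤)
    {T : NonUnitalSubring (affineMatrixRing n F₁ F₂)} (hT : ProjectsOnto T)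
    {w : Fin n → K} (hw : w ≠ 0) (hwT : mk 0 w 0 ∈ T) : T = ⊤ := by
  have hleft : ∀ (A : Matrix (Fin n) (Fin n) F₁) (u : Fin n → K), mk 0 u 0 ∈ T →
      mk 0 (act A u) 0 ∈ T := by
    intro A u hu
    obtain ⟨w', hw'⟩ := hT A 0
    have := T.mul_mem hw' hu
    rw [mk_mul_mk] at this
    simpa using this
  have hright : ∀ (b : F₂) (u : Fin n → K), mk 0 u 0 ∈ T → mk 0 ((b : K) • u) 0 ∈ T := by
    intro b u hu
    obtain ⟨w', hw'⟩ := hT 0 b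
    have := T.mul_mem hu hw'
    rw [mk_mul_mk] at this
    simpa using this
  obtain ⟨i, hi⟩ := Function.ne_iff.1 hw
  -- scalars of `K` preserving `T ∩ J`; it contains `F₁` only via `K^n` being an `M_n(F₁)`-module
  let P : Subring K :=
    { carrier := {c | ∀ u, mk 0 u 0 ∈ T → mk 0 (c • u) 0 ∈ T}
      mul_mem' := by
        intro c d hc hd u hu
        rw [mul_smul]
        exact hc _ (hd _ hu)
      one_mem' := by intro u hu; simpa using hu
      add_mem' := by
        intro c d hc hd u hu
        have := T.add_mem (hc u hu) (hd u hu)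
        rw [mk_add_mk] at this
        simpa [add_smul] using this
      zero_mem' := by
        intro u hu
        have : mk (0 : Matrix (Fin n) (Fin n) F₁) ((0 : K) • u) (0 : F₂) = 0 := by
          simp [ext_iff']
        rw [this]; exact T.zero_mem
      neg_mem' := by
        intro c hc u hu
        have := T.neg_mem (hc u hu)
        have h2 : -mk (0 : Matrix (Fin n) (Fin n) F₁) (c • u) (0 : F₂) = mk 0 ((-c) • u) 0 := by
          simp [ext_iff']
        rwa [h2] at this }
  let P' : Subfield K :=
    { P with
      inv_mem' := by
        intro x hx
        have hx' : x ∈ P := hx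
        change x⁻¹ ∈ P
        rcases eq_or_ne x 0 with rfl | h0
        · simp [P.zero_mem]
        · have := Fintype.ofFinite K
          have h1 : x ^ (Fintype.card K - 1) = 1 := FiniteField.pow_card_sub_one_eq_one x h0
          have h2 : 2 ≤ Fintype.card K := Fintype.one_lt_card
          have : x⁻¹ = x ^ (Fintype.card K - 2) := by
            apply inv_eq_of_mul_eq_one_left
            rw [← pow_succ, ← h1]
            congr 1; omega
          rw [this]
          exact P.pow_mem hx' _ }
  have hP : P' = ⊤ := by
    rw [← top_le_iff, ← hK, sup_le_iff]
    refine ⟨fun c hc => ?_, fun c hc => ?_⟩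
    · intro u hu
      have := hleft (Matrix.diagonal fun _ => ⟨c, hc⟩) u hu
      convert this using 2
      ext k
      rw [act_apply, Finset.sum_eq_single k] <;>
        simp +contextual [eq_comm]
    · intro u hu
      exact hright ⟨c, hc⟩ u hu
  have hPall : ∀ (c : K) (u : Fin n → K), mk 0 u 0 ∈ T → mk 0 (c • u) 0 ∈ T := by
    intro c
    have : c ∈ P' := by rw [hP]; trivial
    exact this
  have hJ : ∀ u : Fin n → K, mk 0 u 0 ∈ T := by
    have hs : ∀ j (c : K), mk 0 (Pi.single j c) 0 ∈ T := by
      intro j c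
      have h1 := hPall (c / w i) _ (hleft (Matrix.single j i 1) w hwT)
      rw [act_single] at h1
      convert h1 using 2
      rw [← Pi.single_smul]
      congr 1
      have : w i ≠ 0 := hi
      simp; field_simp
    intro u
    rw [← Finset.univ_sum_single u]
    induction (Finset.univ : Finset (Fin n)) using Finset.induction_on with
    | empty =>
      have : mk (0 : Matrix (Fin n) (Fin n) F₁) (0 : Fin n → K) (0 : F₂) = 0 := by
        simp [ext_iff']
      simp [this, T.zero_mem]
    | insert a s ha ih =>
      rw [Finset.sum_insert ha]
      have := T.add_mem (hs a (u a)) ih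
      rw [mk_add_mk] at this
      simpa using this
  rw [eq_top_iff]
  intro r _
  obtain ⟨u, hu⟩ := hT (toA r) (toB r)
  have := T.add_mem hu (hJ (toW r - u))
  rw [mk_add_mk] at this
  simpa [mk_eta] using this

/-- A subring that projects onto `M_n(F₁) × F₂` is everything or one of the complements of the
radical. If it meets the radical trivially, the column `v` is read off from its element with
diagonal blocks `0` and `1`. -/
theorem eq_top_or_eq_complement [Finite K] (hK : F₁ ⊔ F₂ = ⊤)
    {T : NonUnitalSubring (affineMatrixRing n F₁ F₂)} (hT : ProjectsOnto T) :
    T = ⊤ ∨ ∃ v, T = complement F₁ F₂ v := by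
  by_cases h : ∃ w : Fin n → K, w ≠ 0 ∧ mk 0 w 0 ∈ T
  · obtain ⟨w, hw, hwT⟩ := h
    exact Or.inl (eq_top_of_projectsOnto hK hT hw hwT)
  right
  push Not at h
  have huniq : ∀ A b w w', mk A w b ∈ T → mk A w' b ∈ T → w = w' := by
    intro A b w w' h1 h2
    by_contra hne
    refine h (w - w') (sub_ne_zero.2 hne) ?_
    have := T.sub_mem h1 h2
    rw [mk_sub_mk] at this
    simpa using this
  obtain ⟨v, hv⟩ := hT 0 1
  have hle : ∀ r ∈ T, r ∈ complement F₁ F₂ v := by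
    intro r hr
    rw [← mk_eta r] at hr
    have h1 := T.mul_mem hv hr
    have h2 := T.mul_mem hr hv
    rw [mk_mul_mk] at h1 h2
    have := huniq 0 (toB r) (act (0 : Matrix (Fin n) (Fin n) F₁) (toW r) + (toB r : K) • v)
      (act (toA r) v + ((1 : F₂) : K) • toW r) (by simpa using h1) (by simpa using h2)
    rw [mem_complement]
    simp at this
    rw [this]; simp
  refine ⟨v, le_antisymm hle fun r hr => ?_⟩
  obtain ⟨w, hw⟩ := hT (toA r) (toB r)
  have h1 := hle _ hw
  rw [mem_complement] at h1 hr
  simp at h1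
  rw [← mk_eta r, hr, ← h1]
  exact hw

theorem complement_ne_top (hn : 0 < n) (v : Fin n → K) : complement F₁ F₂ v ≠ ⊤ := by
  intro h
  have : mk (0 : Matrix (Fin n) (Fin n) F₁) (Pi.single ⟨0, hn⟩ 1) (0 : F₂) ∈
    complement F₁ F₂ v := by rw [h]; trivial
  simp [mem_complement] at this

/-- The complements are maximal subrings. -/
theorem eq_complement_of_le [Finite K] (hK : F₁ ⊔ F₂ = ⊤)
    {T : NonUnitalSubring (affineMatrixRing n F₁ F₂)} (hT : T ≠ ⊤) {v : Fin n → K}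
    (h : complement F₁ F₂ v ≤ T) : T = complement F₁ F₂ v := by
  have hp : ProjectsOnto T := fun A b =>
    (projectsOnto_complement v A b).imp fun w hw => h hw
  rcases eq_top_or_eq_complement hK hp with h1 | ⟨v', rfl⟩
  · exact absurd h1 hT
  · have : mk (0 : Matrix (Fin n) (Fin n) F₁) v (1 : F₂) ∈ complement F₁ F₂ v := by
      simp [mem_complement]
    have := h this
    rw [mem_complement] at this
    simp at this
    rw [this]

/-- The radical is contained in every nonzero ideal. -/
theorem mk_mem_of_ne_bot [Finite K] (hK : F₁ ⊔ F₂ = ⊤) (hn : 0 < n)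
    {I : TwoSidedIdeal (affineMatrixRing n F₁ F₂)} (hI : I ≠ ⊥) (w : Fin n → K) :
    mk 0 w 0 ∈ I := by
  obtain ⟨r, hr, hr0⟩ : ∃ r ∈ I, r ≠ 0 := by
    by_contra! h
    exact hI (eq_bot_iff.2 fun r hr => (TwoSidedIdeal.mem_bot _).2 (h r hr))
  have key : ∃ u : Fin n → K, u ≠ 0 ∧ mk 0 u 0 ∈ I := by
    by_cases hA : toA r = 0
    · by_cases hB : toB r = 0
      · refine ⟨toW r, fun h => hr0 (by simp [ext_iff', hA, hB, h]), ?_⟩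
        rw [← hA, ← hB, mk_eta]; exact hr
      · refine ⟨(toB r : K) • Pi.single ⟨0, hn⟩ 1, by simpa using hB, ?_⟩
        have := I.mul_mem_left (mk 0 (Pi.single ⟨0, hn⟩ 1) 0) r hr
        rw [← mk_eta r, mk_mul_mk] at this
        simpa using this
    · obtain ⟨i, j, hij⟩ : ∃ i j, toA r i j ≠ 0 := by
        by_contra! h
        exact hA (Matrix.ext h)
      refine ⟨act (toA r) (Pi.single j 1), ?_, ?_⟩
      · refine Function.ne_iff.2 ⟨i, ?_⟩
        rw [act_apply, Finset.sum_eq_single j] <;> simp +contextual [hij]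
      · have := I.mul_mem_right r (mk 0 (Pi.single j 1) 0) hr
        rw [← mk_eta r, mk_mul_mk] at this
        simpa using this
  obtain ⟨u, hu, huI⟩ := key
  -- the block diagonal matrices together with the part of `I` in the radical
  let T : NonUnitalSubring (affineMatrixRing n F₁ F₂) :=
    { carrier := {x | mk 0 (toW x) 0 ∈ I}
      mul_mem' := by
        intro x y hx hy
        have h1 := I.add_mem (I.mul_mem_left (mk (toA x) 0 0) _ hy)
          (I.mul_mem_right _ (mk 0 0 (toB y)) hx)
        rw [mk_mul_mk, mk_mul_mk, mk_add_mk] at h1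
        change mk 0 (toW (x * y)) 0 ∈ I
        rw [toW_mul]
        simpa using h1
      add_mem' := by
        intro x y hx hy
        have h1 := I.add_mem hx hy
        rw [mk_add_mk] at h1
        change mk 0 (toW (x + y)) 0 ∈ I
        simpa using h1
      zero_mem' := by
        have : mk (0 : Matrix (Fin n) (Fin n) F₁) (toW (0 : affineMatrixRing n F₁ F₂))
            (0 : F₂) = 0 := by simp [ext_iff']
        change mk 0 _ 0 ∈ I
        rw [this]
        exact I.zero_mem
      neg_mem' := by
        intro x hx
        have h1 := I.neg_mem hx
        have h2 : -mk (0 : Matrix (Fin n) (Fin n) F₁) (toW x) (0 : F₂) = mk 0 (toW (-x)) 0 := by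
          simp [ext_iff']
        rwa [h2] at h1 }
  have hTt : T = ⊤ := by
    refine eq_top_of_projectsOnto hK (fun A b => ⟨0, ?_⟩) hu ?_
    · have : mk (0 : Matrix (Fin n) (Fin n) F₁) (0 : Fin n → K) (0 : F₂) = 0 := by
        simp [ext_iff']
      change mk 0 (toW (mk A 0 b)) 0 ∈ I
      rw [toW_mk, this]
      exact I.zero_mem
    · change mk 0 (toW (mk 0 u 0)) 0 ∈ I
      rwa [toW_mk]
  have : mk 0 w 0 ∈ T := by rw [hTt]; trivial
  have h1 : mk 0 (toW (mk 0 w 0)) 0 ∈ I := this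
  rwa [toW_mk] at h1

/-- For `n ≥ 2` the rings `M_n(F₁)` and `F₂` have no common nonzero quotient, so that a subring
projecting onto both of them projects onto their product (Goursat). -/
theorem projectsOnto_of_surjective (hn : 2 ≤ n)
    {T : NonUnitalSubring (affineMatrixRing n F₁ F₂)} (hA : ∀ A, ∃ r ∈ T, toA r = A)
    (hB : ∀ b, ∃ r ∈ T, toB r = b) : ProjectsOnto T := by
  have : NeZero n := ⟨by omega⟩
  let I : TwoSidedIdeal (Matrix (Fin n) (Fin n) F₁) := .mk'
    {A | ∃ r ∈ T, toA r = A ∧ toB r = 0}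
    ⟨0, T.zero_mem, by simp, by simp⟩
    (by
      rintro _ _ ⟨r, hr, rfl, hr0⟩ ⟨s, hs, rfl, hs0⟩
      exact ⟨r + s, T.add_mem hr hs, by simp, by simp [hr0, hs0]⟩)
    (by
      rintro _ ⟨r, hr, rfl, hr0⟩
      exact ⟨-r, T.neg_mem hr, by simp, by simp [hr0]⟩)
    (by
      rintro A _ ⟨r, hr, rfl, hr0⟩
      obtain ⟨s, hs, rfl⟩ := hA A
      exact ⟨s * r, T.mul_mem hs hr, by simp, by simp [hr0]⟩)
    (by
      rintro _ A ⟨r, hr, rfl, hr0⟩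
      obtain ⟨s, hs, rfl⟩ := hA A
      exact ⟨r * s, T.mul_mem hr hs, by simp, by simp [hr0]⟩)
  have hmem : ∀ A, A ∈ I ↔ ∃ r ∈ T, toA r = A ∧ toB r = 0 := fun A => by
    simp only [I, TwoSidedIdeal.mem_mk']
    rfl
  have hI : I = ⊤ := by
    refine (IsSimpleRing.simple.eq_bot_or_eq_top I).resolve_left fun h => ?_
    let i : Fin n := ⟨0, by omega⟩
    let j : Fin n := ⟨1, by omega⟩
    have hij : i ≠ j := by simp [i, j]
    obtain ⟨r, hr, hr1⟩ := hA (Matrix.single i i 1)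
    obtain ⟨s, hs, hs1⟩ := hA (Matrix.single i j 1)
    have : Matrix.single i j (1 : F₁) ∈ I := by
      refine (hmem _).2 ⟨r * s - s * r, T.sub_mem (T.mul_mem hr hs) (T.mul_mem hs hr), ?_, ?_⟩
      · simp [hr1, hs1, hij.symm]
      · simp [mul_comm]
    rw [h, TwoSidedIdeal.mem_bot] at this
    simpa using congrFun (congrFun this i) j
  intro A b
  obtain ⟨s, hs, hsb⟩ := hB b
  have : A - toA s ∈ I := by rw [hI]; trivial
  obtain ⟨r, hr, hrA, hr0⟩ := (hmem _).1 this
  refine ⟨toW (r + s), ?_⟩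
  have : mk A (toW (r + s)) b = r + s := by simp [ext_iff', hrA, hr0, hsb]
  rw [this]
  exact T.add_mem hr hs

end AffineMatrixRing

theorem exists_pow_eq_of_finite (E : Type*) [Field E] [Finite E] :
    ∃ g : E, g ≠ 0 ∧ ∀ x : E, x ≠ 0 → ∃ k : ℕ, x = g ^ (k + 1) := by
  obtain ⟨u, hu⟩ := IsCyclic.exists_generator (α := Eˣ)
  refine ⟨u, u.ne_zero, fun x hx => ?_⟩
  obtain ⟨k, hk⟩ := mem_powers_iff_mem_zpowers.2 (hu (Units.mk0 x hx))
  have ho : 0 < orderOf u := orderOf_pos u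
  refine ⟨k + orderOf u - 1, ?_⟩
  rw [show k + orderOf u - 1 + 1 = k + orderOf u by omega, pow_add,
    ← Units.val_pow_eq_pow_val u (orderOf u), pow_orderOf_eq_one, Units.val_one, mul_one]
  have := congrArg Units.val hk
  simpa using this.symm

theorem NonUnitalSubring.pow_succ_mem {R : Type*} [Ring R] (T : NonUnitalSubring R) {x : R}
    (hx : x ∈ T) (k : ℕ) : x ^ (k + 1) ∈ T := by
  induction k with
  | zero => simpa using hx
  | succ k ih => rw [pow_succ]; exact T.mul_mem ih hx

namespace AffineMatrixRing

variable {K : Type*} [Field K] {n : ℕ} {F₁ F₂ : Subfield K}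

/-- The projection of a subring to `M_n(F₁)`. -/
def mapA (T : NonUnitalSubring (affineMatrixRing n F₁ F₂)) :
    NonUnitalSubring (Matrix (Fin n) (Fin n) F₁) :=
  T.map (toA : affineMatrixRing n F₁ F₂ →+* Matrix (Fin n) (Fin n) F₁)

theorem mem_mapA {T : NonUnitalSubring (affineMatrixRing n F₁ F₂)}
    {A : Matrix (Fin n) (Fin n) F₁} : A ∈ mapA T ↔ ∃ r ∈ T, toA r = A := Iff.rfl

theorem surjective_toB_of_generator {g : F₂} (hg : ∀ x : F₂, x ≠ 0 → ∃ k : ℕ, x = g ^ (k + 1))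
    {T : NonUnitalSubring (affineMatrixRing n F₁ F₂)} (hT : ∃ r ∈ T, toB r = g) (b : F₂) :
    ∃ r ∈ T, toB r = b := by
  rcases eq_or_ne b 0 with rfl | hb
  · exact ⟨0, T.zero_mem, map_zero _⟩
  · obtain ⟨k, rfl⟩ := hg b hb
    obtain ⟨r, hr, rfl⟩ := hT
    exact ⟨_, T.pow_succ_mem hr k, map_pow _ _ _⟩

theorem mapA_ne_top [Finite K] (hn : 2 ≤ n) {g : F₂}
    (hg : ∀ x : F₂, x ≠ 0 → ∃ k : ℕ, x = g ^ (k + 1))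
    {T : NonUnitalSubring (affineMatrixRing n F₁ F₂)} (hT : ∃ r ∈ T, toB r = g)
    (hp : ¬ ProjectsOnto T) : mapA T ≠ ⊤ := by
  intro h
  refine hp (projectsOnto_of_surjective hn (fun A => ?_) (surjective_toB_of_generator hg hT))
  have : A ∈ mapA T := by rw [h]; trivial
  exact mem_mapA.1 this

/-- Since `F₂` is generated by one element `g`, subrings that do not project onto
`M_n(F₁) × F₂` but hit all pairs `(A, g)` give a cover of `M_n(F₁)`. -/
theorem coveringNumber_matrix_le_encard [Finite K] (hn : 2 ≤ n) {g : F₂}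
    (hg : ∀ x : F₂, x ≠ 0 → ∃ k : ℕ, x = g ^ (k + 1))
    (C : Set (NonUnitalSubring (affineMatrixRing n F₁ F₂))) (hC : ∀ T ∈ C, ¬ ProjectsOnto T)
    (h : ∀ A, ∃ T ∈ C, ∃ w, mk A w g ∈ T) :
    coveringNumber (Matrix (Fin n) (Fin n) F₁) ≤ C.encard := by
  refine (coveringNumber_le_of_isRingCover
    (C := mapA '' {T ∈ C | ∃ r ∈ T, toB r = g}) ⟨?_, fun A => ?_⟩).trans
    ((Set.encard_image_le _ _).trans (Set.encard_le_encard (Set.sep_subset _ _)))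
  · rintro _ ⟨T, ⟨hT, hr⟩, rfl⟩
    exact mapA_ne_top hn hg hr (hC T hT)
  · obtain ⟨T, hT, w, hw⟩ := h A
    exact ⟨_, ⟨T, ⟨hT, _, hw, toB_mk _ _ _⟩, rfl⟩, _, hw, toA_mk _ _ _⟩

theorem coveringNumber_le_matrix :
    coveringNumber (affineMatrixRing n F₁ F₂) ≤ coveringNumber (Matrix (Fin n) (Fin n) F₁) :=
  coveringNumber_le_of_surjective
    ((toA : affineMatrixRing n F₁ F₂ →+* _) : affineMatrixRing n F₁ F₂ →ₙ+* _)
    fun A => ⟨mk A 0 0, toA_mk _ _ _⟩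

theorem coveringNumber_matrix_le_quotient [Finite K] (hK : F₁ ⊔ F₂ = ⊤) (hn : 2 ≤ n)
    {I : TwoSidedIdeal (affineMatrixRing n F₁ F₂)} (hI : I ≠ ⊥) :
    coveringNumber (Matrix (Fin n) (Fin n) F₁) ≤ coveringNumber I.ringCon.Quotient := by
  obtain ⟨g, -, hg⟩ := exists_pow_eq_of_finite F₂
  refine le_coveringNumber_quotient I _ fun C hC hCI => ?_
  refine coveringNumber_matrix_le_encard hn hg C (fun T hT hp => ?_) fun A => ?_
  · refine hC.1 T hT (eq_top_of_projectsOnto hK hp (w := Pi.single ⟨0, by omega⟩ 1) (by simp) ?_)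
    exact hCI T hT _ (mk_mem_of_ne_bot hK (by omega) hI _)
  · obtain ⟨T, hT, h⟩ := hC.2 (mk A 0 g)
    exact ⟨T, hT, 0, h⟩

theorem coveringNumber_lt_matrix_of_isSigmaElementary
    (h : IsSigmaElementary (affineMatrixRing n F₁ F₂)) :
    coveringNumber (affineMatrixRing n F₁ F₂) <
      coveringNumber (Matrix (Fin n) (Fin n) F₁) := by
  refine h.lt_of_surjective ((toA : affineMatrixRing n F₁ F₂ →+* _) :
    affineMatrixRing n F₁ F₂ →ₙ+* _) (fun A => ⟨mk A 0 0, toA_mk _ _ _⟩) (x := mk 0 0 1)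
    (fun h0 => ?_) (toA_mk _ _ _)
  rw [ext_iff'] at h0
  simp at h0

/-- A cover that omits a complement restricts to a cover of it, and hence has at least
`σ(M_n(F₁))` members. -/
theorem coveringNumber_matrix_le_of_notMem [Finite K] (hK : F₁ ⊔ F₂ = ⊤) (hn : 2 ≤ n)
    {C : Set (NonUnitalSubring (affineMatrixRing n F₁ F₂))} (hC : IsRingCover C)
    {v : Fin n → K} (hv : complement F₁ F₂ v ∉ C) :
    coveringNumber (Matrix (Fin n) (Fin n) F₁) ≤ C.encard := by
  obtain ⟨g, -, hg⟩ := exists_pow_eq_of_finite F₂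
  refine (coveringNumber_matrix_le_encard hn hg
    ((fun T => T ⊓ complement F₁ F₂ v) '' C) ?_ fun A => ?_).trans (Set.encard_image_le _ _)
  · rintro _ ⟨T, hT, rfl⟩ hp
    have hle : complement F₁ F₂ v ≤ T := by
      intro r hr
      obtain ⟨w, hw⟩ := hp (toA r) (toB r)
      have h1 := hw.2
      have h3 : w = toW r := by
        rw [mem_complement.1 hr]
        simpa using mem_complement.1 h1
      rw [← mk_eta r, ← h3]
      exact hw.1
    exact hv (eq_complement_of_le hK (hC.1 T hT) hle ▸ hT)
  · obtain ⟨w, hw⟩ := projectsOnto_complement (F₁ := F₁) (F₂ := F₂) v A g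
    obtain ⟨T, hT, h⟩ := hC.2 (mk A w g)
    exact ⟨_, ⟨T, hT, rfl⟩, w, h, hw⟩

theorem encard_range_complement [Finite K] :
    (Set.range (complement (n := n) F₁ F₂)).encard = ((Nat.card K ^ n : ℕ) : ℕ∞) := by
  rw [← Set.image_univ, complement_injective.encard_image, Set.encard_univ,
    ENat.card_eq_coe_natCard, Nat.card_fun]
  simp

end AffineMatrixRing

/-! ### Finite fields and their generators -/

theorem card_le_of_forall_pow_eq {E : Type*} [Field E] [Finite E] {m : ℕ} (hm : 1 < m)
    (h : ∀ x : E, x ^ m = x) : Nat.card E ≤ m := by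
  classical
  have := Fintype.ofFinite E
  have hne := FiniteField.X_pow_card_sub_X_ne_zero E hm
  have h1 : (Finset.univ : Finset E) ⊆
      (Polynomial.X ^ m - Polynomial.X : Polynomial E).roots.toFinset := by
    intro x _
    rw [Multiset.mem_toFinset, Polynomial.mem_roots hne]
    simp [h x]
  rw [Nat.card_eq_fintype_card, ← Finset.card_univ]
  refine (Finset.card_le_card h1).trans ((Multiset.toFinset_card_le _).trans ?_)
  refine (Polynomial.card_roots' _).trans ?_
  rw [FiniteField.X_pow_card_sub_X_natDegree_eq E hm]

theorem Subfield.mem_iff_pow_card_eq {K : Type*} [Field K] [Finite K] (F : Subfield K) (x : K) :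
    x ∈ F ↔ x ^ Nat.card F = x := by
  classical
  have hF : 1 < Nat.card F := Finite.one_lt_card
  have := Fintype.ofFinite F
  have hfwd : ∀ x ∈ F, x ^ Nat.card F = x := by
    intro x hx
    have := FiniteField.pow_card (⟨x, hx⟩ : F)
    rw [Nat.card_eq_fintype_card]
    exact congrArg Subtype.val this
  refine ⟨hfwd x, fun hx => ?_⟩
  have hne := FiniteField.X_pow_card_sub_X_ne_zero K hF
  let S := (Polynomial.X ^ Nat.card F - Polynomial.X : Polynomial K).roots.toFinset
  have hS : ∀ y, y ∈ S ↔ y ^ Nat.card F = y := by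
    intro y
    simp only [S]
    rw [Multiset.mem_toFinset, Polynomial.mem_roots hne]
    simp [sub_eq_zero]
  have hle : S.card ≤ Nat.card F := by
    refine (Multiset.toFinset_card_le _).trans ((Polynomial.card_roots' _).trans ?_)
    rw [FiniteField.X_pow_card_sub_X_natDegree_eq K hF]
  let T : Finset K := Finset.univ.map ⟨((↑) : F → K), Subtype.val_injective⟩
  have hT : T.card = Nat.card F := by simp [T]
  have hTS : T ⊆ S := by
    intro y hy
    simp only [T, Finset.mem_map, Finset.mem_univ, true_and, Function.Embedding.coeFn_mk] at hy
    obtain ⟨z, rfl⟩ := hy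
    exact (hS _).2 (hfwd _ z.2)
  have := Finset.eq_of_subset_of_card_le hTS (by omega)
  have hx' : x ∈ T := by rw [this]; exact (hS x).2 hx
  simp only [T, Finset.mem_map, Finset.mem_univ, true_and, Function.Embedding.coeFn_mk] at hx'
  obtain ⟨z, rfl⟩ := hx'
  exact z.2

/-- Like `exists_pow_eq_of_finite`, with the multiplicative order of the generator. -/
theorem exists_generator_of_finite (E : Type*) [Field E] [Finite E] :
    ∃ g : E, g ≠ 0 ∧ (∀ x : E, x ≠ 0 → ∃ k : ℕ, x = g ^ (k + 1)) ∧
      ∀ m : ℕ, g ^ m = 1 → Nat.card E - 1 ∣ m := by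
  obtain ⟨g, hg, h⟩ := exists_pow_eq_of_finite E
  refine ⟨g, hg, h, fun m hm => ?_⟩
  have h1 : orderOf (Units.mk0 g hg) = Nat.card Eˣ := by
    refine orderOf_eq_card_of_forall_mem_zpowers fun u => ?_
    obtain ⟨k, hk⟩ := h u u.ne_zero
    exact ⟨k + 1, by ext; push_cast; rw [hk]; norm_cast⟩
  rw [← Nat.card_units, ← h1, orderOf_dvd_iff_pow_eq_one]
  ext
  simpa using hm

/-- `g` lies in no proper nonunital subring. -/
def IsRingGenerator {E : Type*} [NonUnitalRing E] (g : E) : Prop :=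
  ∀ Q : NonUnitalSubring E, g ∈ Q → Q = ⊤

theorem isRingGenerator_of_pow {E : Type*} [Field E] {g : E}
    (h : ∀ x : E, x ≠ 0 → ∃ k : ℕ, x = g ^ (k + 1)) : IsRingGenerator g := by
  intro Q hg
  refine eq_top_iff.2 fun x _ => ?_
  rcases eq_or_ne x 0 with rfl | hx
  · exact Q.zero_mem
  · obtain ⟨k, rfl⟩ := h x hx
    exact Q.pow_succ_mem hg k

/-- A subring of a product of two fields which projects onto both and contains an element with
exactly one nonzero coordinate is the whole product. -/
theorem eq_top_of_mem_prod {E₁ E₂ : Type*} [Field E₁] [Field E₂] {g₁ : E₁} {g₂ : E₂}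
    (h₁ : IsRingGenerator g₁) (h₂ : IsRingGenerator g₂) {P : NonUnitalSubring (E₁ × E₂)}
    (hP₁ : ∃ y, (g₁, y) ∈ P) (hP₂ : ∃ x, (x, g₂) ∈ P)
    (h : (∃ x, x ≠ 0 ∧ (x, (0 : E₂)) ∈ P) ∨ ∃ y, y ≠ 0 ∧ ((0 : E₁), y) ∈ P) : P = ⊤ := by
  have hs₁ : ∀ x, ∃ y, (x, y) ∈ P := by
    obtain ⟨y, hy⟩ := hP₁
    have : P.map (RingHom.fst E₁ E₂) = ⊤ := h₁ _ ⟨_, hy, rfl⟩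
    intro x
    have hx : x ∈ P.map (RingHom.fst E₁ E₂) := by rw [this]; trivial
    obtain ⟨z, hz, rfl⟩ := hx
    exact ⟨z.2, hz⟩
  have hs₂ : ∀ y, ∃ x, (x, y) ∈ P := by
    obtain ⟨y, hy⟩ := hP₂
    have : P.map (RingHom.snd E₁ E₂) = ⊤ := h₂ _ ⟨_, hy, rfl⟩
    intro x
    have hx : x ∈ P.map (RingHom.snd E₁ E₂) := by rw [this]; trivial
    obtain ⟨z, hz, rfl⟩ := hx
    exact ⟨z.1, hz⟩
  rw [eq_top_iff]
  rintro ⟨u, v⟩ -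
  rcases h with ⟨x, hx, hxP⟩ | ⟨y, hy, hyP⟩
  · obtain ⟨u', hu'⟩ := hs₂ v
    obtain ⟨y, hy⟩ := hs₁ ((u - u') / x)
    have := P.add_mem hu' (P.mul_mem hxP hy)
    have h2 : (u', v) + (x, (0 : E₂)) * ((u - u') / x, y) = (u, v) := by
      ext
      · simp; field_simp; ring
      · simp
    rwa [h2] at this
  · obtain ⟨v', hv'⟩ := hs₁ u
    obtain ⟨x, hx⟩ := hs₂ ((v - v') / y)
    have := P.add_mem hv' (P.mul_mem hyP hx)
    have h2 : (u, v') + ((0 : E₁), y) * (x, (v - v') / y) = (u, v) := by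
      ext
      · simp
      · simp; field_simp; ring
    rwa [h2] at this

theorem NonUnitalSubring.aeval_mul_mem {p : ℕ} {S : Type*} [Ring S] [Algebra (ZMod p) S]
    (T : NonUnitalSubring S) {x : S} (hx : x ∈ T) (f : Polynomial (ZMod p)) :
    Polynomial.aeval x f * x ∈ T := by
  induction f using Polynomial.induction_on' with
  | add f g hf hg => rw [map_add, add_mul]; exact T.add_mem hf hg
  | monomial k c =>
    rw [Polynomial.aeval_monomial, mul_assoc, ← pow_succ, ← Algebra.smul_def]
    obtain ⟨m, rfl⟩ := ZMod.intCast_surjective c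
    rw [Int.cast_smul_eq_zsmul]
    exact T.zsmul_mem (T.pow_succ_mem hx k) m

/-- A subring of `E × E` containing `(a, b)`, where `a` and `b` are generators of the finite field
`E` that are not conjugate under the Frobenius automorphism, is everything. -/
theorem eq_top_of_not_conj {E : Type*} [Field E] [Finite E] {p k : ℕ} [Fact p.Prime] [CharP E p]
    (hcard : Nat.card E = p ^ k) {a b : E} (ha : IsRingGenerator a) (hb : IsRingGenerator b)
    (hb0 : b ≠ 0) (hab : ∀ i < k, b ≠ a ^ p ^ i) {P : NonUnitalSubring (E × E)}
    (hP : (a, b) ∈ P) : P = ⊤ := by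
  have := ZMod.algebra E p
  refine eq_top_of_mem_prod ha hb ⟨b, hP⟩ ⟨a, hP⟩ (Or.inr ?_)
  refine ⟨Polynomial.aeval b (minpoly (ZMod p) a) * b, fun h0 => ?_, ?_⟩
  · have h1 := (mul_eq_zero.1 h0).resolve_right hb0
    have hconj : IsConjRoot (ZMod p) a b :=
      (isConjRoot_iff_aeval_eq_zero (Algebra.IsIntegral.isIntegral a)).2 h1
    obtain ⟨σ, hσ⟩ := isConjRoot_iff_exists_algEquiv.1 hconj
    obtain ⟨i, hi⟩ := FiniteField.exists_forall_apply_eq_pow (ZMod p) p E σ⁻¹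
    have hba : b = a ^ p ^ i := by
      have := hi a
      rw [Nat.card_zmod] at this
      rw [← this, ← hσ]
      exact (σ.symm_apply_apply b).symm
    have hk : 0 < k := by
      rcases Nat.eq_zero_or_pos k with rfl | h
      · have : 1 < Nat.card E := Finite.one_lt_card
        simp_all
      · exact h
    refine hab (i % k) (Nat.mod_lt _ hk) ?_
    have hper : ∀ m, a ^ p ^ (k * m) = a := by
      intro m
      have := Fintype.ofFinite E
      rw [pow_mul, ← hcard, Nat.card_eq_fintype_card]
      exact FiniteField.pow_card_pow m a
    rw [hba]
    conv_lhs => rw [← Nat.div_add_mod i k, pow_add, pow_mul, hper]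
  · have := P.aeval_mul_mem (p := p) hP (minpoly (ZMod p) a)
    have h2 : Polynomial.aeval (a, b) (minpoly (ZMod p) a) * (a, b) =
        (0, Polynomial.aeval b (minpoly (ZMod p) a) * b) := by
      rw [Polynomial.aeval_prod_apply, minpoly.aeval]
      simp
    rwa [h2] at this

/-- A product of two finite fields is generated by one element, except for `𝔽₂ × 𝔽₂` and
`𝔽₄ × 𝔽₄`, the case of two fields of the same order. -/
theorem exists_isRingGenerator_prod_self {E : Type*} [Field E] [Finite E]
    (h2 : Nat.card E ≠ 2) (h4 : Nat.card E ≠ 4) : ∃ g : E × E, IsRingGenerator g := by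
  have := Fintype.ofFinite E
  obtain ⟨p, hchar, k, hp, hcard⟩ := FiniteField.card' E
  have : Fact p.Prime := ⟨hp⟩
  obtain ⟨k, hk⟩ := k
  simp only [PNat.mk_coe] at hcard
  rw [← Nat.card_eq_fintype_card] at hcard
  obtain ⟨a, ha0, ha, hord⟩ := exists_generator_of_finite E
  rw [hcard] at hord h2 h4
  have hag := isRingGenerator_of_pow ha
  have hp2 := hp.two_le
  rcases hp.eq_two_or_odd' with rfl | hodd
  · refine ⟨(a, a⁻¹), fun P hP => ?_⟩
    refine eq_top_of_not_conj hcard hag (isRingGenerator_of_pow fun x hx => ?_)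
      (inv_ne_zero ha0) (fun i hi h => ?_) hP
    · obtain ⟨m, hm⟩ := ha x⁻¹ (inv_ne_zero hx)
      exact ⟨m, by rw [inv_pow, ← hm, inv_inv]⟩
    · have h1 : a ^ (2 ^ i + 1) = 1 := by rw [pow_succ, ← h, inv_mul_cancel₀ ha0]
      have h3 := Nat.le_of_dvd (Nat.succ_pos _) (hord _ h1)
      have h5 : 2 ^ i ≤ 2 ^ (k - 1) := Nat.pow_le_pow_right (by norm_num) (by omega)
      have h6 : 2 ^ k = 2 * 2 ^ (k - 1) := by rw [← pow_succ']; congr 1; omega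
      have h7 : 2 ^ (k - 1) ≤ 2 ^ 1 := by omega
      have h8 : k - 1 ≤ 1 := (Nat.pow_le_pow_iff_right (by norm_num)).1 h7
      have : k = 1 ∨ k = 2 := by omega
      rcases this with rfl | rfl <;> simp at h2 h4
  · refine ⟨(a, -a), fun P hP => ?_⟩
    have h2ne : (2 : E) ≠ 0 := by
      intro h
      have : (p : ℕ) ∣ 2 := (CharP.cast_eq_zero_iff E p 2).1 (by exact_mod_cast h)
      have := Nat.le_of_dvd (by norm_num) this
      have : p = 2 := by omega
      subst this
      exact absurd hodd (by decide)
    refine eq_top_of_not_conj hcard hag (fun Q hQ => hag Q ?_) (neg_ne_zero.2 ha0)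
      (fun i hi h => ?_) hP
    · simpa using Q.neg_mem hQ
    · have hpos : 1 ≤ p ^ i := Nat.one_le_pow _ _ (by omega)
      have h1 : a ^ (2 * (p ^ i - 1)) = 1 := by
        have h3 : a ^ (2 * p ^ i) = a ^ 2 := by rw [mul_comm, pow_mul, ← h]; ring
        have h4 : a ^ (2 * (p ^ i - 1)) * a ^ 2 = a ^ 2 := by
          rw [← pow_add, ← h3]; congr 1; omega
        exact mul_right_cancel₀ (pow_ne_zero 2 ha0) (by rw [h4, one_mul])
      have h3 := hord _ h1
      have h5 : p ^ i ≤ p ^ (k - 1) := Nat.pow_le_pow_right (by omega) (by omega)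
      have h6 : p ^ k = p * p ^ (k - 1) := by rw [← pow_succ']; congr 1; omega
      have h7 : 3 ≤ p := by
        rcases hp2.lt_or_eq with h | h
        · omega
        · subst h; exact absurd hodd (by decide)
      have h8 : 3 * p ^ (k - 1) ≤ p ^ k := by rw [h6]; gcongr
      have h9 : 2 * (p ^ i - 1) = 0 := by
        by_contra hne
        have := Nat.le_of_dvd (Nat.pos_of_ne_zero hne) h3
        omega
      have h10 : p ^ i = 1 := by omega
      rw [h10, pow_one] at h
      have : (2 : E) * a = 0 := by linear_combination -h
      exact (mul_ne_zero h2ne ha0) this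

theorem pow_natCard_sub_self {E : Type*} [Field E] [Finite E] (x : E) :
    x ^ Nat.card E - x = 0 := by
  have := Fintype.ofFinite E
  rw [Nat.card_eq_fintype_card, FiniteField.pow_card, sub_self]

theorem card_le_of_pow_sub_eq_zero {E : Type*} [Field E] [Finite E] {g : E}
    (hg : ∀ x : E, x ≠ 0 → ∃ k : ℕ, x = g ^ (k + 1)) {m : ℕ} (hm : 1 < m)
    (h0 : g ^ m - g = 0) : Nat.card E ≤ m := by
  refine card_le_of_forall_pow_eq hm fun x => ?_
  rcases eq_or_ne x 0 with rfl | hx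
  · exact zero_pow (by omega)
  · obtain ⟨k, rfl⟩ := hg x hx
    rw [← pow_mul, mul_comm, pow_mul, sub_eq_zero.1 h0]

theorem exists_isRingGenerator_prod {E₁ E₂ : Type*} [Field E₁] [Finite E₁] [Field E₂] [Finite E₂]
    (h : Nat.card E₁ ≠ Nat.card E₂) : ∃ g : E₁ × E₂, IsRingGenerator g := by
  obtain ⟨a, -, ha⟩ := exists_pow_eq_of_finite E₁
  obtain ⟨b, -, hb⟩ := exists_pow_eq_of_finite E₂
  refine ⟨(a, b), fun P hP => eq_top_of_mem_prod (isRingGenerator_of_pow ha)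
    (isRingGenerator_of_pow hb) ⟨b, hP⟩ ⟨a, hP⟩ ?_⟩
  have key : ∀ m : ℕ, 1 < m → (a ^ m - a, b ^ m - b) ∈ P := by
    intro m hm
    have h1 := P.pow_succ_mem hP (m - 1)
    rw [show m - 1 + 1 = m by omega] at h1
    exact P.sub_mem h1 hP
  rcases lt_or_gt_of_ne h with h | h
  · refine Or.inr ⟨b ^ Nat.card E₁ - b, fun h0 => ?_, ?_⟩
    · exact absurd (card_le_of_pow_sub_eq_zero hb Finite.one_lt_card h0) (by omega)
    · have := key (Nat.card E₁) Finite.one_lt_card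
      rwa [pow_natCard_sub_self] at this
  · refine Or.inl ⟨a ^ Nat.card E₂ - a, fun h0 => ?_, ?_⟩
    · exact absurd (card_le_of_pow_sub_eq_zero ha Finite.one_lt_card h0) (by omega)
    · have := key (Nat.card E₂) Finite.one_lt_card
      rwa [pow_natCard_sub_self] at this

/-! ### The case `n = 1` -/

namespace AffineMatrixRing

variable {K : Type*} [Field K] {F₁ F₂ : Subfield K}

/-- The two diagonal entries, in the case `n = 1`. -/
def diag : affineMatrixRing 1 F₁ F₂ →+* F₁ × F₂ where
  toFun r := (toA r 0 0, toB r)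
  map_one' := by simp
  map_mul' r s := by simp [Matrix.mul_apply]
  map_zero' := by simp
  map_add' r s := by simp

/-- The `1 × 1` matrix with entry `a`. -/
def scalarOne (a : F₁) : Matrix (Fin 1) (Fin 1) F₁ := Matrix.of fun _ _ => a

theorem scalarOne_eta (A : Matrix (Fin 1) (Fin 1) F₁) : scalarOne (A 0 0) = A := by
  ext i j
  rw [Subsingleton.elim i 0, Subsingleton.elim j 0]
  rfl

theorem diag_mk (a : F₁) (w : Fin 1 → K) (b : F₂) : diag (mk (scalarOne a) w b) = (a, b) := by
  simp [diag, scalarOne]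

theorem scalarOne_act (a : F₁) (v : Fin 1 → K) : act (scalarOne a) v = (a : K) • v := by
  ext i
  rw [act_apply]
  simp [scalarOne, Subsingleton.elim i 0]

theorem projectsOnto_of_map_diag {T : NonUnitalSubring (affineMatrixRing 1 F₁ F₂)}
    (h : T.map (diag : affineMatrixRing 1 F₁ F₂ →+* F₁ × F₂) = ⊤) : ProjectsOnto T := by
  intro A b
  have : (A 0 0, b) ∈ T.map (diag : affineMatrixRing 1 F₁ F₂ →+* F₁ × F₂) := by rw [h]; trivial
  obtain ⟨r, hr, hrd⟩ := this
  refine ⟨toW r, ?_⟩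
  have h1 : toA r 0 0 = A 0 0 := congrArg Prod.fst hrd
  have h2 : toB r = b := congrArg Prod.snd hrd
  rw [← scalarOne_eta A, ← h1, ← h2, scalarOne_eta, mk_eta]
  exact hr

theorem surjective_diag : Function.Surjective (diag : affineMatrixRing 1 F₁ F₂ →+* F₁ × F₂) :=
  fun x => ⟨mk (scalarOne x.1) 0 x.2, diag_mk _ _ _⟩

theorem coveringNumber_le_prod :
    coveringNumber (affineMatrixRing 1 F₁ F₂) ≤ coveringNumber (F₁ × F₂) :=
  coveringNumber_le_of_surjective ((diag : affineMatrixRing 1 F₁ F₂ →+* _) :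
    affineMatrixRing 1 F₁ F₂ →ₙ+* _) surjective_diag

theorem coveringNumber_lt_prod_of_isSigmaElementary
    (h : IsSigmaElementary (affineMatrixRing 1 F₁ F₂)) :
    coveringNumber (affineMatrixRing 1 F₁ F₂) < coveringNumber (F₁ × F₂) := by
  refine h.lt_of_surjective ((diag : affineMatrixRing 1 F₁ F₂ →+* _) :
    affineMatrixRing 1 F₁ F₂ →ₙ+* _) surjective_diag (x := mk (scalarOne 0) 1 0)
    (fun h0 => ?_) (diag_mk _ _ _)
  rw [ext_iff'] at h0
  simp at h0

theorem mem_complement_diag {v : Fin 1 → K} {r : affineMatrixRing 1 F₁ F₂} :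
    r ∈ complement F₁ F₂ v ↔ toW r = ((toB r : K) - toA r 0 0) • v := by
  rw [mem_complement, ← scalarOne_eta (toA r), scalarOne_act, sub_smul]
  rfl

/-- For `n = 1`, the complements of the radical together with one more subring, that of the
matrices with equal diagonal entries, form a cover. -/
theorem coveringNumber_le_card_add_one [Finite K] :
    coveringNumber (affineMatrixRing 1 F₁ F₂) ≤ ((Nat.card K + 1 : ℕ) : ℕ∞) := by
  let D : NonUnitalSubring (affineMatrixRing 1 F₁ F₂) :=
    { carrier := {r | (toA r 0 0 : K) = toB r}
      mul_mem' := by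
        intro r s hr hs
        change (toA (r * s) 0 0 : K) = toB (r * s)
        have hr : (toA r 0 0 : K) = toB r := hr
        have hs : (toA s 0 0 : K) = toB s := hs
        simp [Matrix.mul_apply, hr, hs]
      add_mem' := by
        intro r s hr hs
        change (toA (r + s) 0 0 : K) = toB (r + s)
        have hr : (toA r 0 0 : K) = toB r := hr
        have hs : (toA s 0 0 : K) = toB s := hs
        simp [hr, hs]
      zero_mem' := by
        change (toA (0 : affineMatrixRing 1 F₁ F₂) 0 0 : K) = toB (0 : affineMatrixRing 1 F₁ F₂)
        simp
      neg_mem' := by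
        intro r hr
        change (toA (-r) 0 0 : K) = toB (-r)
        have hr : (toA r 0 0 : K) = toB r := hr
        simp [hr] }
  refine (coveringNumber_le_of_isRingCover
    (C := insert D (Set.range (complement (n := 1) F₁ F₂))) ⟨?_, fun r => ?_⟩).trans ?_
  · rintro T (rfl | ⟨v, rfl⟩) h
    · have : mk (scalarOne 0) 0 1 ∈ D := by rw [h]; trivial
      have h1 : (toA (mk (scalarOne 0) 0 1 : affineMatrixRing 1 F₁ F₂) 0 0 : K) =
        toB (mk (scalarOne 0) 0 1 : affineMatrixRing 1 F₁ F₂) := this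
      simp [scalarOne] at h1
    · exact complement_ne_top one_pos v h
  · by_cases h : (toA r 0 0 : K) = toB r
    · exact ⟨D, Set.mem_insert _ _, h⟩
    · refine ⟨_, Set.mem_insert_of_mem _
        ⟨((toB r : K) - toA r 0 0)⁻¹ • toW r, rfl⟩, mem_complement_diag.2 ?_⟩
      rw [smul_smul, mul_inv_cancel₀ (sub_ne_zero.2 (Ne.symm h)), one_smul]
  · refine (Set.encard_insert_le _ _).trans ?_
    rw [encard_range_complement]
    simp

/-- The complements of the radical do not form a cover, so a cover that contains all of them has
at least `|K| + 1` members. -/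
theorem card_add_one_le_encard [Finite K] {C : Set (NonUnitalSubring (affineMatrixRing 1 F₁ F₂))}
    (hC : IsRingCover C) (h : ∀ v, complement F₁ F₂ v ∈ C) :
    ((Nat.card K + 1 : ℕ) : ℕ∞) ≤ C.encard := by
  obtain ⟨T, hT, hx⟩ := hC.2 (mk (scalarOne 0) 1 0)
  have hnot : T ∉ Set.range (complement (n := 1) F₁ F₂) := by
    rintro ⟨v, rfl⟩
    rw [mem_complement_diag] at hx
    have := congrFun hx 0
    simp [scalarOne] at this
  have hsub : insert T (Set.range (complement (n := 1) F₁ F₂)) ⊆ C := by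
    rintro S (rfl | ⟨v, rfl⟩)
    exacts [hT, h v]
  refine le_trans ?_ (Set.encard_le_encard hsub)
  rw [Set.encard_insert_of_notMem hnot, encard_range_complement]
  simp

/-- If `F₁ × F₂` has a subset any two elements of which generate `F₁ × F₂`, then a cover omitting
a complement has at least as many members as that subset. -/
theorem encard_le_of_complement_notMem [Finite K] (hK : F₁ ⊔ F₂ = ⊤)
    {C : Set (NonUnitalSubring (affineMatrixRing 1 F₁ F₂))} (hC : IsRingCover C) {v : Fin 1 → K}
    (hv : complement F₁ F₂ v ∉ C) {G : Set (F₁ × F₂)}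
    (hG : ∀ x ∈ G, ∀ y ∈ G, x ≠ y → ∀ P : NonUnitalSubring (F₁ × F₂), x ∈ P → y ∈ P → P = ⊤) :
    G.encard ≤ C.encard := by
  let s : F₁ × F₂ → affineMatrixRing 1 F₁ F₂ := fun x =>
    mk (scalarOne x.1) (((x.2 : K) - x.1) • v) x.2
  have hsd : ∀ x, diag (s x) = x := fun x => diag_mk _ _ _
  have hs : Function.Injective s := Function.LeftInverse.injective hsd
  have hsc : ∀ x, s x ∈ complement F₁ F₂ v := by
    intro x
    rw [mem_complement_diag]
    simp [s, scalarOne]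
  rw [← hs.encard_image]
  refine encard_le_of_pairwise (fun x _ => hC.2 x) ?_
  rintro _ ⟨x, hx, rfl⟩ _ ⟨y, hy, rfl⟩ T hT hxT hyT
  by_contra hne
  have hp : ProjectsOnto (T ⊓ complement F₁ F₂ v) := by
    refine projectsOnto_of_map_diag (hG x hx y hy (fun h => hne (by rw [h])) _ ?_ ?_)
    · exact ⟨s x, ⟨hxT, hsc x⟩, hsd x⟩
    · exact ⟨s y, ⟨hyT, hsc y⟩, hsd y⟩
  have hle : complement F₁ F₂ v ≤ T := by
    intro r hr
    obtain ⟨w, hw⟩ := hp (toA r) (toB r)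
    have h1 := hw.2
    have h3 : w = toW r := by
      rw [mem_complement.1 hr]
      simpa using mem_complement.1 h1
    rw [← mk_eta r, ← h3]
    exact hw.1
  exact hv (eq_complement_of_le hK (hC.1 T hT) hle ▸ hT)

theorem coveringNumber_of_isRingGenerator [Finite K] (hK : F₁ ⊔ F₂ = ⊤) {g : F₁ × F₂}
    (hg : IsRingGenerator g) :
    coveringNumber (affineMatrixRing 1 F₁ F₂) = ((Nat.card K + 1 : ℕ) : ℕ∞) := by
  refine le_antisymm coveringNumber_le_card_add_one (le_iInf₂ fun C hC => ?_)
  refine card_add_one_le_encard hC fun v => ?_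
  by_contra hv
  obtain ⟨T, hT, hx⟩ := hC.2 (mk (scalarOne g.1) (((g.2 : K) - g.1) • v) g.2)
  have hp : ProjectsOnto T := projectsOnto_of_map_diag (hg _ ⟨_, hx, diag_mk _ _ _⟩)
  rcases eq_top_or_eq_complement hK hp with h | ⟨v', rfl⟩
  · exact hC.1 T hT h
  · rw [mem_complement_diag] at hx
    simp only [toW_mk, toB_mk, toA_mk, scalarOne, Matrix.of_apply] at hx
    rcases eq_or_ne ((g.2 : K) - g.1) 0 with h0 | h0
    · -- a generator cannot have equal coordinates, since they would lie in a proper subring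
      let Q : NonUnitalSubring (F₁ × F₂) :=
        { carrier := {x | (x.1 : K) = x.2}
          mul_mem' := by
            intro x y hx hy
            change ((x * y).1 : K) = (x * y).2
            have hx : (x.1 : K) = x.2 := hx
            have hy : (y.1 : K) = y.2 := hy
            simp [hx, hy]
          add_mem' := by
            intro x y hx hy
            change ((x + y).1 : K) = (x + y).2
            have hx : (x.1 : K) = x.2 := hx
            have hy : (y.1 : K) = y.2 := hy
            simp [hx, hy]
          zero_mem' := rfl
          neg_mem' := by
            intro x hx
            change ((-x).1 : K) = (-x).2
            have hx : (x.1 : K) = x.2 := hx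
            simp [hx] }
      have hQ : Q = ⊤ := hg Q (sub_eq_zero.1 h0).symm
      have : ((1 : F₁), (0 : F₂)) ∈ Q := by rw [hQ]; trivial
      have h1 : ((1 : F₁) : K) = (0 : F₂) := this
      simp at h1
    · exact hv ((smul_right_injective _ h0 hx) ▸ hT)

theorem isSigmaElementary_of_isRingGenerator [Finite K] (hK : F₁ ⊔ F₂ = ⊤) {g : F₁ × F₂}
    (hg : IsRingGenerator g) : IsSigmaElementary (affineMatrixRing 1 F₁ F₂) := by
  intro I hI
  rw [coveringNumber_of_isRingGenerator hK hg]
  refine (ENat.natCast_lt_top _).trans_le (le_coveringNumber_quotient I ⊤ fun C hC hCI => ?_)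
  exfalso
  obtain ⟨T, hT, hx⟩ := hC.2 (mk (scalarOne g.1) 0 g.2)
  have hp : ProjectsOnto T := projectsOnto_of_map_diag (hg _ ⟨_, hx, diag_mk _ _ _⟩)
  exact hC.1 T hT (eq_top_of_projectsOnto hK hp one_ne_zero
    (hCI T hT _ (mk_mem_of_ne_bot hK one_pos hI 1)))

end AffineMatrixRing

/-! ### Products of two fields of order two or four -/

/-- `𝔽₂ × 𝔽₂` is the union of three proper subrings. -/
theorem coveringNumber_prod_le_three {E : Type*} [Field E] (hE : Nat.card E = 2) :
    coveringNumber (E × E) ≤ 3 := by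
  have hfin : Finite E := Nat.finite_of_card_ne_zero (by omega)
  have h01 : ∀ x : E, x = 0 ∨ x = 1 := by
    intro x
    have := Fintype.ofFinite E
    rcases eq_or_ne x 0 with h | h
    · exact Or.inl h
    · right
      have := FiniteField.pow_card_sub_one_eq_one x h
      rw [← Nat.card_eq_fintype_card, hE] at this
      simpa using this
  let S₁ : NonUnitalSubring (E × E) := (⊥ : NonUnitalSubring E).comap (RingHom.fst E E)
  let S₂ : NonUnitalSubring (E × E) := (⊥ : NonUnitalSubring E).comap (RingHom.snd E E)
  let S₃ : NonUnitalSubring (E × E) :=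
    (⊤ : NonUnitalSubring E).map ((RingHom.id E).prod (RingHom.id E))
  have m₁ : ∀ x, x ∈ S₁ ↔ x.1 = 0 := fun x => by
    simp [S₁, NonUnitalSubring.mem_comap, NonUnitalSubring.mem_bot]
  have m₂ : ∀ x, x ∈ S₂ ↔ x.2 = 0 := fun x => by
    simp [S₂, NonUnitalSubring.mem_comap, NonUnitalSubring.mem_bot]
  have m₃ : ∀ x, x ∈ S₃ ↔ x.1 = x.2 := fun x => by
    simp only [S₃, NonUnitalSubring.mem_map, NonUnitalSubring.mem_top, true_and]
    constructor
    · rintro ⟨y, rfl⟩; rfl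
    · intro h; exact ⟨x.1, Prod.ext rfl h⟩
  refine (coveringNumber_le_of_isRingCover (C := {S₁, S₂, S₃}) ⟨?_, fun x => ?_⟩).trans ?_
  · rintro T (rfl | rfl | rfl) h
    · exact one_ne_zero ((m₁ (1, 0)).1 (h ▸ NonUnitalSubring.mem_top _))
    · exact one_ne_zero ((m₂ (0, 1)).1 (h ▸ NonUnitalSubring.mem_top _))
    · exact one_ne_zero ((m₃ (1, 0)).1 (h ▸ NonUnitalSubring.mem_top _))
  · rcases h01 x.1 with h | h
    · exact ⟨S₁, by simp, (m₁ x).2 h⟩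
    · rcases h01 x.2 with h' | h'
      · exact ⟨S₂, by simp, (m₂ x).2 h'⟩
      · exact ⟨S₃, by simp, (m₃ x).2 (by rw [h, h'])⟩
  · refine (Set.encard_insert_le _ _).trans
      ((add_le_add_left (Set.encard_insert_le _ _) 1).trans ?_)
    rw [Set.encard_singleton]
    norm_num

theorem two_eq_zero_of_card_four {E : Type*} [Field E] (hE : Nat.card E = 4) : (2 : E) = 0 := by
  have hfin : Finite E := Nat.finite_of_card_ne_zero (by omega)
  have := Fintype.ofFinite E
  have h := FiniteField.cast_card_eq_zero E
  rw [← Nat.card_eq_fintype_card, hE] at h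
  have h4 : (2 : E) * 2 = 0 := by rw [← h]; norm_num
  simpa using h4

/-- `𝔽₄ × 𝔽₄` is the union of four proper subrings: the two with one coordinate in `𝔽₂`, and the
graphs of the two automorphisms of `𝔽₄`. -/
theorem coveringNumber_prod_le_four {E : Type*} [Field E] (hE : Nat.card E = 4) :
    coveringNumber (E × E) ≤ 4 := by
  have hfin : Finite E := Nat.finite_of_card_ne_zero (by omega)
  have h2 : (2 : E) = 0 := two_eq_zero_of_card_four hE
  have : CharP E 2 := CharTwo.of_one_ne_zero_of_two_eq_zero one_ne_zero h2
  have hfrob : ∀ x : E, frobenius E 2 x = x ^ 2 := fun x => rfl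
  have hx4 : ∀ x : E, x ^ 4 = x := by
    intro x
    have := Fintype.ofFinite E
    have := FiniteField.pow_card x
    rwa [← Nat.card_eq_fintype_card, hE] at this
  have hnot : ∃ x : E, x ^ 2 ≠ x := by
    by_contra! h
    have := card_le_of_forall_pow_eq (by norm_num) h
    omega
  obtain ⟨t, ht⟩ := hnot
  -- the elements outside `𝔽₂` are the roots of `x² + x + 1`
  have hroot : ∀ x : E, x ^ 2 ≠ x → x ^ 2 + x + 1 = 0 := by
    intro x hx
    have h : (x ^ 2 - x) * (x ^ 2 + x + 1) = 0 := by linear_combination hx4 x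
    exact (mul_eq_zero.1 h).resolve_left (sub_ne_zero.2 hx)
  let S₁ : NonUnitalSubring (E × E) :=
    (RingHom.eqLocus ((frobenius E 2).comp (RingHom.fst E E)) (RingHom.fst E E)).toNonUnitalSubring
  let S₂ : NonUnitalSubring (E × E) :=
    (RingHom.eqLocus ((frobenius E 2).comp (RingHom.snd E E)) (RingHom.snd E E)).toNonUnitalSubring
  let S₃ : NonUnitalSubring (E × E) :=
    (RingHom.eqLocus (RingHom.snd E E) (RingHom.fst E E)).toNonUnitalSubring
  let S₄ : NonUnitalSubring (E × E) :=
    (RingHom.eqLocus ((frobenius E 2).comp (RingHom.fst E E)) (RingHom.snd E E)).toNonUnitalSubring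
  have m₁ : ∀ x, x ∈ S₁ ↔ x.1 ^ 2 = x.1 := fun x => Iff.rfl
  have m₂ : ∀ x, x ∈ S₂ ↔ x.2 ^ 2 = x.2 := fun x => Iff.rfl
  have m₃ : ∀ x, x ∈ S₃ ↔ x.2 = x.1 := fun x => Iff.rfl
  have m₄ : ∀ x, x ∈ S₄ ↔ x.1 ^ 2 = x.2 := fun x => Iff.rfl
  refine (coveringNumber_le_of_isRingCover (C := {S₁, S₂, S₃, S₄}) ⟨?_, fun x => ?_⟩).trans ?_
  · rintro T (rfl | rfl | rfl | rfl) h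
    · exact ht ((m₁ (t, 0)).1 (h ▸ NonUnitalSubring.mem_top _))
    · exact ht ((m₂ (0, t)).1 (h ▸ NonUnitalSubring.mem_top _))
    · exact zero_ne_one ((m₃ (1, 0)).1 (h ▸ NonUnitalSubring.mem_top _))
    · have := (m₄ (1, 0)).1 (h ▸ NonUnitalSubring.mem_top _)
      simp at this
  · by_cases hx : x.1 ^ 2 = x.1
    · exact ⟨S₁, by simp, (m₁ x).2 hx⟩
    by_cases hy : x.2 ^ 2 = x.2
    · exact ⟨S₂, by simp, (m₂ x).2 hy⟩
    have h : (x.2 - x.1) * (x.2 - x.1 ^ 2) = 0 := by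
      linear_combination hroot _ hy + (x.1 - 1 - x.2) * hroot _ hx
    rcases mul_eq_zero.1 h with h | h
    · exact ⟨S₃, by simp, (m₃ x).2 (sub_eq_zero.1 h)⟩
    · exact ⟨S₄, by simp, (m₄ x).2 (sub_eq_zero.1 h).symm⟩
  · refine (Set.encard_insert_le _ _).trans
      ((add_le_add_left ((Set.encard_insert_le _ _).trans
      (add_le_add_left (Set.encard_insert_le _ _) 1)) 1).trans ?_)
    rw [Set.encard_singleton]
    norm_num

theorem exists_pairwise_generating_three {E : Type*} [Field E] (hE : Nat.card E = 2) :
    ∃ G : Set (E × E), G.encard = 3 ∧ ∀ x ∈ G, ∀ y ∈ G, x ≠ y →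
      ∀ P : NonUnitalSubring (E × E), x ∈ P → y ∈ P → P = ⊤ := by
  have hfin : Finite E := Nat.finite_of_card_ne_zero (by omega)
  have hgen : IsRingGenerator (1 : E) := isRingGenerator_of_pow fun x hx => ⟨0, by
    have := Fintype.ofFinite E
    have := FiniteField.pow_card_sub_one_eq_one x hx
    rw [← Nat.card_eq_fintype_card, hE] at this
    simpa using this⟩
  refine ⟨{(1, 0), (0, 1), (1, 1)}, ?_, ?_⟩
  · rw [Set.encard_insert_of_notMem (by simp), Set.encard_pair (by simp)]
    norm_num
  -- any two of the three elements generate `(1, 1)`, and an element with one coordinate zero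
  have key : ∀ P : NonUnitalSubring (E × E), ((1 : E), (1 : E)) ∈ P →
      (((1 : E), (0 : E)) ∈ P ∨ ((0 : E), (1 : E)) ∈ P) → P = ⊤ := fun P h h' =>
    eq_top_of_mem_prod hgen hgen ⟨1, h⟩ ⟨1, h⟩
      (h'.imp (fun h => ⟨1, one_ne_zero, h⟩) fun h => ⟨1, one_ne_zero, h⟩)
  rintro x (rfl | rfl | rfl) y (rfl | rfl | rfl) hne P hx hy
  all_goals first
    | exact absurd rfl hne
    | exact key P hx (Or.inl hy)
    | exact key P hx (Or.inr hy)
    | exact key P hy (Or.inl hx)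
    | exact key P hy (Or.inr hx)
    | exact key P (by simpa using P.add_mem hx hy) (Or.inl hx)
    | exact key P (by simpa using P.add_mem hx hy) (Or.inl hy)

theorem exists_pairwise_generating_four {E : Type*} [Field E] (hE : Nat.card E = 4) :
    ∃ G : Set (E × E), G.encard = 4 ∧ ∀ x ∈ G, ∀ y ∈ G, x ≠ y →
      ∀ P : NonUnitalSubring (E × E), x ∈ P → y ∈ P → P = ⊤ := by
  have hfin : Finite E := Nat.finite_of_card_ne_zero (by omega)
  obtain ⟨g, hg0, hg, hord⟩ := exists_generator_of_finite E
  have hg2 : g ^ 2 ≠ g := by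
    intro h
    have : g ^ 1 = 1 := by
      have : g * (g - 1) = 0 := by linear_combination h
      rw [pow_one]
      exact sub_eq_zero.1 ((mul_eq_zero.1 this).resolve_left hg0)
    have := Nat.le_of_dvd one_pos (hord 1 this)
    omega
  have hgen : IsRingGenerator g := isRingGenerator_of_pow hg
  have hx4 : ∀ x : E, x ^ 4 = x := by
    intro x
    have := Fintype.ofFinite E
    have := FiniteField.pow_card x
    rwa [← Nat.card_eq_fintype_card, hE] at this
  have hgen2 : IsRingGenerator (g ^ 2) := fun Q hQ => hgen Q (by
    have := Q.mul_mem hQ hQ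
    rwa [← pow_add, hx4] at this)
  have hsub : g ^ 2 - g ≠ 0 := sub_ne_zero.2 hg2
  have hsq0 : g ^ 2 ≠ 0 := pow_ne_zero 2 hg0
  have key : ∀ P : NonUnitalSubring (E × E), (∃ y, (g, y) ∈ P) → ((∃ x, (x, g) ∈ P) ∨
      ∃ x, (x, g ^ 2) ∈ P) → ((∃ x, x ≠ 0 ∧ (x, (0 : E)) ∈ P) ∨ ∃ y, y ≠ 0 ∧ ((0 : E), y) ∈ P) →
      P = ⊤ := by
    intro P h1 h2 h3
    rcases h2 with h2 | h2
    · exact eq_top_of_mem_prod hgen hgen h1 h2 h3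
    · exact eq_top_of_mem_prod hgen hgen2 h1 h2 h3
  refine ⟨{(g, g), (g, g ^ 2), (g, 0), (0, g)}, ?_, ?_⟩
  · rw [Set.encard_insert_of_notMem (by simp [hg0, hg2.symm]),
      Set.encard_insert_of_notMem (by simp [hg0]), Set.encard_pair (by simp [hg0])]
    norm_num
  have main : ∀ P : NonUnitalSubring (E × E),
      ((g, g) ∈ P → (g, g ^ 2) ∈ P → P = ⊤) ∧ ((g, g) ∈ P → (g, (0 : E)) ∈ P → P = ⊤) ∧
      ((g, g) ∈ P → ((0 : E), g) ∈ P → P = ⊤) ∧ ((g, g ^ 2) ∈ P → (g, (0 : E)) ∈ P → P = ⊤) ∧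
      ((g, g ^ 2) ∈ P → ((0 : E), g) ∈ P → P = ⊤) ∧
      ((g, (0 : E)) ∈ P → ((0 : E), g) ∈ P → P = ⊤) := by
    refine fun P => ⟨fun h h' => ?_, fun h h' => ?_, fun h h' => ?_, fun h h' => ?_,
      fun h h' => ?_, fun h h' => ?_⟩
    · exact key P ⟨_, h⟩ (Or.inl ⟨_, h⟩) (Or.inr ⟨_, hsub, by simpa using P.sub_mem h' h⟩)
    · exact key P ⟨_, h⟩ (Or.inl ⟨_, h⟩) (Or.inl ⟨_, hg0, h'⟩)
    · exact key P ⟨_, h⟩ (Or.inl ⟨_, h⟩) (Or.inr ⟨_, hg0, h'⟩)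
    · exact key P ⟨_, h⟩ (Or.inr ⟨_, h⟩) (Or.inl ⟨_, hg0, h'⟩)
    · exact key P ⟨_, h⟩ (Or.inr ⟨_, h⟩) (Or.inr ⟨_, hg0, h'⟩)
    · exact key P ⟨_, h⟩ (Or.inl ⟨_, h'⟩) (Or.inl ⟨_, hg0, h⟩)
  rintro x (rfl | rfl | rfl | rfl) y (rfl | rfl | rfl | rfl) hne P hx hy
  all_goals obtain ⟨k1, k2, k3, k4, k5, k6⟩ := main P
  all_goals first
    | exact absurd rfl hne
    | exact k1 hx hy
    | exact k1 hy hx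
    | exact k2 hx hy
    | exact k2 hy hx
    | exact k3 hx hy
    | exact k3 hy hx
    | exact k4 hx hy
    | exact k4 hy hx
    | exact k5 hx hy
    | exact k5 hy hx
    | exact k6 hx hy
    | exact k6 hy hx

namespace AffineMatrixRing

variable {K : Type*} [Field K] [Finite K] {F₁ F₂ : Subfield K}

theorem coveringNumber_eq_of_pairwise {F : Subfield K} (hK : F ⊔ F = ⊤) {m : ℕ}
    (hm : m ≤ Nat.card K + 1) (hle : coveringNumber (F × F) ≤ m)
    (hG : ∃ G : Set (F × F), G.encard = m ∧ ∀ x ∈ G, ∀ y ∈ G, x ≠ y →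
      ∀ P : NonUnitalSubring (F × F), x ∈ P → y ∈ P → P = ⊤) :
    coveringNumber (affineMatrixRing 1 F F) = m ∧
      ¬ IsSigmaElementary (affineMatrixRing 1 F F) := by
  obtain ⟨G, hcard, hG⟩ := hG
  have h : (m : ℕ∞) ≤ coveringNumber (affineMatrixRing 1 F F) := by
    refine le_iInf₂ fun C hC => ?_
    by_cases hall : ∀ v, complement F F v ∈ C
    · exact le_trans (by exact_mod_cast hm) (card_add_one_le_encard hC hall)
    · push Not at hall
      obtain ⟨v, hv⟩ := hall
      rw [← hcard]
      exact encard_le_of_complement_notMem hK hC hv hG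
  exact ⟨le_antisymm (coveringNumber_le_prod.trans hle) h, fun hs =>
    absurd ((coveringNumber_lt_prod_of_isSigmaElementary hs).trans_le hle) (not_lt.2 h)⟩

theorem card_le_card_of_subfield (F : Subfield K) : Nat.card F ≤ Nat.card K :=
  Nat.card_le_card_of_injective _ Subtype.val_injective

theorem exists_isRingGenerator (h2 : ¬ (Nat.card F₁ = 2 ∧ Nat.card F₂ = 2))
    (h4 : ¬ (Nat.card F₁ = 4 ∧ Nat.card F₂ = 4)) : ∃ g : F₁ × F₂, IsRingGenerator g := by
  by_cases h : Nat.card F₁ = Nat.card F₂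
  · obtain rfl : F₁ = F₂ := by
      ext x
      rw [F₁.mem_iff_pow_card_eq, F₂.mem_iff_pow_card_eq, h]
    exact exists_isRingGenerator_prod_self (by tauto) (by tauto)
  · exact exists_isRingGenerator_prod h

/-- The case `n = 1`. -/
theorem coveringNumber_one (hK : F₁ ⊔ F₂ = ⊤) :
    (IsSigmaElementary (affineMatrixRing 1 F₁ F₂) ↔
      ¬ (Nat.card F₁ = 2 ∧ Nat.card F₂ = 2) ∧ ¬ (Nat.card F₁ = 4 ∧ Nat.card F₂ = 4)) ∧
    (Nat.card F₁ = 2 ∧ Nat.card F₂ = 2 → coveringNumber (affineMatrixRing 1 F₁ F₂) = 3) ∧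
    (Nat.card F₁ = 4 ∧ Nat.card F₂ = 4 → coveringNumber (affineMatrixRing 1 F₁ F₂) = 4) ∧
    (¬ (Nat.card F₁ = 2 ∧ Nat.card F₂ = 2) → ¬ (Nat.card F₁ = 4 ∧ Nat.card F₂ = 4) →
      coveringNumber (affineMatrixRing 1 F₁ F₂) = ((Nat.card K + 1 : ℕ) : ℕ∞)) := by
  have heq : Nat.card F₁ = Nat.card F₂ → F₁ = F₂ := by
    intro h
    ext x
    rw [F₁.mem_iff_pow_card_eq, F₂.mem_iff_pow_card_eq, h]
  have hle := card_le_card_of_subfield F₁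
  have two : Nat.card F₁ = 2 ∧ Nat.card F₂ = 2 →
      coveringNumber (affineMatrixRing 1 F₁ F₂) = (3 : ℕ) ∧
        ¬ IsSigmaElementary (affineMatrixRing 1 F₁ F₂) := by
    rintro ⟨h1, h2⟩
    obtain rfl := heq (h1.trans h2.symm)
    exact coveringNumber_eq_of_pairwise hK (by omega) (coveringNumber_prod_le_three h1)
      (exists_pairwise_generating_three h1)
  have four : Nat.card F₁ = 4 ∧ Nat.card F₂ = 4 →
      coveringNumber (affineMatrixRing 1 F₁ F₂) = (4 : ℕ) ∧
        ¬ IsSigmaElementary (affineMatrixRing 1 F₁ F₂) := by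
    rintro ⟨h1, h2⟩
    obtain rfl := heq (h1.trans h2.symm)
    exact coveringNumber_eq_of_pairwise hK (by omega) (coveringNumber_prod_le_four h1)
      (exists_pairwise_generating_four h1)
  refine ⟨⟨fun h => ⟨fun h2 => (two h2).2 h, fun h4 => (four h4).2 h⟩, fun h => ?_⟩,
    fun h => (two h).1, fun h => (four h).1, fun h2 h4 => ?_⟩
  · obtain ⟨g, hg⟩ := exists_isRingGenerator h.1 h.2
    exact isSigmaElementary_of_isRingGenerator hK hg
  · obtain ⟨g, hg⟩ := exists_isRingGenerator h2 h4
    exact coveringNumber_of_isRingGenerator hK hg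

end AffineMatrixRing

/-! ### Irreducible subrings of a matrix ring over a finite field -/

open Module in
/-- A nonzero additive subgroup of `End F V` which absorbs multiplication on both sides is
everything. -/
theorem Module.End.eq_top_of_absorbing {F V : Type*} [Field F] [AddCommGroup V] [Module F V]
    [FiniteDimensional F V] (I : AddSubgroup (Module.End F V))
    (hl : ∀ x, ∀ t ∈ I, x * t ∈ I) (hr : ∀ x, ∀ t ∈ I, t * x ∈ I)
    {z : Module.End F V} (hz : z ∈ I) (hz0 : z ≠ 0) : I = ⊤ := by
  obtain ⟨v, hv⟩ : ∃ v, z v ≠ 0 := by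
    by_contra! h
    exact hz0 (LinearMap.ext h)
  obtain ⟨ψ, hψ⟩ := LinearMap.exists_extend (p := F ∙ z v)
    (LinearEquiv.toSpanNonzeroSingleton F V (z v) hv).symm.toLinearMap
  have hψ1 : ψ (z v) = 1 := by
    have h1 := LinearMap.congr_fun hψ ⟨z v, Submodule.mem_span_singleton_self _⟩
    simp only [LinearMap.comp_apply, Submodule.subtype_apply] at h1
    rw [h1]
    exact LinearEquiv.coord_self F V (z v) hv
  rw [eq_top_iff]
  intro f _
  let b := Module.finBasis F V
  have hf : f = ∑ i, (LinearMap.toSpanSingleton F V (f (b i)) ∘ₗ ψ) * z *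
      (LinearMap.toSpanSingleton F V v ∘ₗ b.coord i) := by
    ext x
    simp only [LinearMap.sum_apply, Module.End.mul_apply, LinearMap.comp_apply,
      LinearMap.toSpanSingleton_apply, map_smul, hψ1, Basis.coord_apply]
    conv_lhs => rw [← b.sum_repr x, map_sum]
    simp
  rw [hf]
  exact I.sum_mem fun i _ => hr _ _ (hl _ _ hz)

/-- A form of Burnside's theorem: an irreducible ring of linear maps over a finite field which
contains a nonzero scalar multiple-closed line is either everything or commutes with an extension
field of the scalars. If the commutant consists of scalars only, the linear span of the ring is
everything by density, and the elements of the ring all of whose scalar multiples lie in the ring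
form an ideal of it. -/
theorem exists_field_of_irreducible {F : Type*} {V : Type*} [Field F] [Finite F]
    [AddCommGroup V] [Module F V] [FiniteDimensional F V] [Nontrivial V]
    {P : NonUnitalSubring (Module.End F V)}
    (hirr : ∀ U : Submodule F V, (∀ t ∈ P, ∀ u ∈ U, t u ∈ U) → U = ⊥ ∨ U = ⊤)
    {z : Module.End F V} (hz0 : z ≠ 0) (hz : ∀ c : F, c • z ∈ P) (hP : P ≠ ⊤) :
    ∃ (D : Subalgebra F (Module.End F V)) (_ : IsField D), 2 ≤ Module.finrank F D ∧
      ∀ t ∈ P, ∀ δ ∈ D, t * δ = δ * t := by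
  have : Finite V := Module.finite_of_finite F
  have : Finite (Module.End F V) :=
    Finite.of_injective (fun f => (f : V → V)) DFunLike.coe_injective
  let D := Subalgebra.centralizer F (P : Set (Module.End F V))
  have hD : ∀ t ∈ P, ∀ δ ∈ D, t * δ = δ * t := fun t ht δ hδ =>
    Subalgebra.mem_centralizer_iff F |>.1 hδ t ht
  have hinj : ∀ δ ∈ D, δ ≠ 0 → Function.Injective δ := by
    intro δ hδ h0
    rw [← LinearMap.ker_eq_bot]
    refine (hirr (LinearMap.ker δ) fun t ht u hu => ?_).resolve_right fun h => h0 ?_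
    · rw [LinearMap.mem_ker] at hu ⊢
      rw [← Module.End.mul_apply, ← hD t ht δ hδ, Module.End.mul_apply, hu, map_zero]
    · exact LinearMap.ker_eq_top.1 h
  have : NoZeroDivisors D := ⟨by
    rintro ⟨a, ha⟩ ⟨b, hb⟩ hab
    by_contra! h
    have hab' : a * b = 0 := congrArg Subtype.val hab
    have hb0 : b ≠ 0 := fun h0 => h.2 (Subtype.ext h0)
    have ha0 : a ≠ 0 := fun h0 => h.1 (Subtype.ext h0)
    refine hb0 (LinearMap.ext fun v => hinj a ha ha0 ?_)
    have := LinearMap.congr_fun hab' v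
    simpa using this⟩
  have : IsDomain D := NoZeroDivisors.to_isDomain D
  refine ⟨D, Finite.isDomain_to_isField D, ?_, hD⟩
  by_contra hlt
  have h1 : Module.finrank F D = 1 := by
    have : 0 < Module.finrank F D := Module.finrank_pos
    omega
  have hscal : ∀ δ ∈ D, ∃ c : F, δ = algebraMap F _ c := by
    intro δ hδ
    have hb := Subalgebra.bot_eq_top_of_finrank_eq_one h1
    have : (⟨δ, hδ⟩ : D) ∈ (⊥ : Subalgebra F D) := by rw [hb]; trivial
    obtain ⟨c, hc⟩ := Algebra.mem_bot.1 this
    exact ⟨c, (congrArg Subtype.val hc).symm⟩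
  let R := Algebra.adjoin F (P : Set (Module.End F V))
  have hPR : ∀ t ∈ P, t ∈ R := fun t ht => Algebra.subset_adjoin ht
  have hsimple : IsSimpleModule R V := by
    refine isSimpleModule_iff_toSpanSingleton_surjective.2 ⟨inferInstance, fun v hv w => ?_⟩
    let U : Submodule F V :=
      { carrier := {x | ∃ r : R, r • v = x}
        add_mem' := by
          rintro _ _ ⟨r, rfl⟩ ⟨s, rfl⟩
          exact ⟨r + s, add_smul _ _ _⟩
        zero_mem' := ⟨0, zero_smul _ _⟩
        smul_mem' := by
          rintro c _ ⟨r, rfl⟩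
          exact ⟨c • r, smul_assoc _ _ _⟩ }
    have hU : U = ⊤ := by
      refine (hirr U ?_).resolve_left fun h => hv ?_
      · rintro t ht _ ⟨r, rfl⟩
        exact ⟨⟨t, hPR t ht⟩ * r, mul_smul _ _ _⟩
      · have : v ∈ U := ⟨1, one_smul _ _⟩
        rwa [h, Submodule.mem_bot] at this
    have : w ∈ U := by rw [hU]; trivial
    obtain ⟨r, hr⟩ := this
    exact ⟨r, hr⟩
  have hRtop : ∀ f : Module.End F V, f ∈ R := by
    intro f
    have hcomm : ∀ g : Module.End R V, ∃ c : F, ∀ v, g v = c • v := by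
      intro g
      let g' : Module.End F V :=
        { toFun := g
          map_add' := map_add g
          map_smul' := fun c v => by simp }
      have hg' : g' ∈ D := by
        refine (Subalgebra.mem_centralizer_iff F).2 fun t ht => LinearMap.ext fun v => ?_
        exact (g.map_smul (⟨t, hPR t ht⟩ : R) v).symm
      obtain ⟨c, hc⟩ := hscal g' hg'
      exact ⟨c, fun v => LinearMap.congr_fun hc v⟩
    let f' : Module.End (Module.End R V) V :=
      { toFun := f
        map_add' := map_add f
        map_smul' := fun g v => by
          obtain ⟨c, hc⟩ := hcomm g
          simp [hc] }
    have := Fintype.ofFinite V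
    obtain ⟨r, hr⟩ := jacobson_density f' Finset.univ
    have : f = r.1 := LinearMap.ext fun v => hr v (Finset.mem_univ v)
    rw [this]
    exact r.2
  let I : AddSubgroup (Module.End F V) :=
    { carrier := {t | ∀ c : F, c • t ∈ P}
      add_mem' := fun {a b} ha hb c => by rw [smul_add]; exact P.add_mem (ha c) (hb c)
      zero_mem' := fun c => by rw [smul_zero]; exact P.zero_mem
      neg_mem' := fun {a} ha c => by rw [smul_neg]; exact P.neg_mem (ha c) }
  have hl : ∀ x ∈ R, ∀ t ∈ I, x * t ∈ I := by
    intro x hx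
    induction hx using Algebra.adjoin_induction with
    | mem x hx =>
      intro t ht c
      rw [← mul_smul_comm]
      exact P.mul_mem hx (ht c)
    | algebraMap r =>
      intro t ht c
      rw [← Algebra.smul_def, smul_smul]
      exact ht _
    | add x y _ _ hx hy =>
      intro t ht
      rw [add_mul]
      exact I.add_mem (hx t ht) (hy t ht)
    | mul x y _ _ hx hy =>
      intro t ht
      rw [mul_assoc]
      exact hx _ (hy t ht)
  have hr : ∀ x ∈ R, ∀ t ∈ I, t * x ∈ I := by
    intro x hx
    induction hx using Algebra.adjoin_induction with
    | mem x hx =>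
      intro t ht c
      rw [← smul_mul_assoc]
      exact P.mul_mem (ht c) hx
    | algebraMap r =>
      intro t ht c
      rw [← Algebra.commutes, ← Algebra.smul_def, smul_smul]
      exact ht _
    | add x y _ _ hx hy =>
      intro t ht
      rw [mul_add]
      exact I.add_mem (hx t ht) (hy t ht)
    | mul x y _ _ hx hy =>
      intro t ht
      rw [← mul_assoc]
      exact hy _ (hx t ht)
  have hI := Module.End.eq_top_of_absorbing I (fun x => hl x (hRtop x)) (fun x => hr x (hRtop x))
    (z := z) hz hz0
  refine hP (eq_top_iff.2 fun f _ => ?_)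
  have : f ∈ I := by rw [hI]; trivial
  simpa using this 1

/-! ### Counting bases and subspaces over a finite field -/

/-- The number of linearly independent `k`-tuples in an `n`-dimensional space over a field of `q`
elements. -/
def frameCard (q n k : ℕ) : ℕ := ∏ i ∈ Finset.range k, (q ^ n - q ^ i)

theorem frameCard_pos {q n k : ℕ} (hq : 2 ≤ q) (hk : k ≤ n) : 0 < frameCard q n k := by
  refine Finset.prod_pos fun i hi => ?_
  have : q ^ i < q ^ n := Nat.pow_lt_pow_right (by omega) (by have := Finset.mem_range.1 hi; omega)
  omega

theorem natCard_linearIndependent {F V : Type*} [Field F] [Finite F] [AddCommGroup V] [Module F V]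
    [FiniteDimensional F V] {k : ℕ} (hk : k ≤ Module.finrank F V) :
    Nat.card {s : Fin k → V // LinearIndependent F s} =
      frameCard (Nat.card F) (Module.finrank F V) k := by
  have := Fintype.ofFinite F
  have : Finite V := Module.finite_of_finite F
  rw [card_linearIndependent hk, frameCard, Finset.prod_range, Nat.card_eq_fintype_card]

/-- The number of `k`-dimensional subspaces. -/
noncomputable def subspaceCard (F V : Type*) [Field F] [AddCommGroup V] [Module F V] (k : ℕ) : ℕ :=
  Nat.card {U : Submodule F V // Module.finrank F U = k}

theorem subspaceCard_mul_frameCard (F V : Type*) [Field F] [Finite F] [AddCommGroup V] [Module F V]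
    [FiniteDimensional F V] {k : ℕ} (hk : k ≤ Module.finrank F V) :
    subspaceCard F V k * frameCard (Nat.card F) k k =
      frameCard (Nat.card F) (Module.finrank F V) k := by
  classical
  have : Finite V := Module.finite_of_finite F
  have : Finite (Submodule F V) := inferInstance
  have hspan : ∀ s : {s : Fin k → V // LinearIndependent F s},
      Module.finrank F (Submodule.span F (Set.range s.1)) = k := fun s => by
    rw [finrank_span_eq_card s.2, Fintype.card_fin]
  have hext : ∀ x y : Σ U : {U : Submodule F V // Module.finrank F U = k},
      {s : Fin k → U.1 // LinearIndependent F s}, x.1.1 = y.1.1 →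
      (∀ i, (x.2.1 i : V) = y.2.1 i) → x = y := by
    rintro ⟨⟨U, hU⟩, ⟨s, hs⟩⟩ ⟨⟨U', hU'⟩, ⟨s', hs'⟩⟩ h1 h2
    simp only at h1
    subst h1
    have : s = s' := funext fun i => Subtype.ext (h2 i)
    subst this
    rfl
  let e : {s : Fin k → V // LinearIndependent F s} ≃
      Σ U : {U : Submodule F V // Module.finrank F U = k},
        {s : Fin k → U.1 // LinearIndependent F s} :=
    { toFun := fun s => ⟨⟨Submodule.span F (Set.range s.1), hspan s⟩,
        ⟨fun i => ⟨s.1 i, Submodule.subset_span ⟨i, rfl⟩⟩,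
          LinearIndependent.of_comp (Submodule.subtype _) s.2⟩⟩
      invFun := fun x => ⟨fun i => x.2.1 i,
        x.2.2.map' (Submodule.subtype _) (Submodule.ker_subtype _)⟩
      left_inv := fun s => rfl
      right_inv := by
        rintro ⟨⟨U, hU⟩, ⟨s, hs⟩⟩
        have h1 : Submodule.span F (Set.range fun i => (s i : V)) = U := by
          refine Submodule.eq_of_le_of_finrank_eq (Submodule.span_le.2 ?_) ?_
          · rintro _ ⟨i, rfl⟩; exact (s i).2
          · rw [hspan ⟨fun i => (s i : V), hs.map' _ (Submodule.ker_subtype _)⟩, hU]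
        exact hext _ _ h1 fun i => rfl }
  have := Fintype.ofFinite {U : Submodule F V // Module.finrank F U = k}
  rw [← natCard_linearIndependent hk, Nat.card_congr e, Nat.card_sigma]
  have hfib : ∀ U : {U : Submodule F V // Module.finrank F U = k},
      Nat.card {s : Fin k → U.1 // LinearIndependent F s} = frameCard (Nat.card F) k k := by
    intro U
    have := natCard_linearIndependent (F := F) (V := U.1) (k := k) U.2.ge
    rw [this, U.2]
  rw [Finset.sum_congr rfl fun U _ => hfib U, Finset.sum_const, smul_eq_mul, subspaceCard,
    Nat.card_eq_fintype_card, Finset.card_univ]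

theorem frameCard_eq_prod_mul {q n k : ℕ} (hk : k ≤ n) :
    frameCard q n k = (∏ i ∈ Finset.range k, q ^ i) * ∏ i ∈ Finset.range k, (q ^ (n - i) - 1) := by
  rw [frameCard, ← Finset.prod_mul_distrib]
  refine Finset.prod_congr rfl fun i hi => ?_
  have := Finset.mem_range.1 hi
  rw [Nat.mul_sub, ← pow_add, mul_one, show i + (n - i) = n by omega]

theorem subspaceCard_eq_qBinomial (F V : Type*) [Field F] [Finite F] [AddCommGroup V] [Module F V]
    [FiniteDimensional F V] {k : ℕ} (hk : k ≤ Module.finrank F V) :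
    subspaceCard F V k = qBinomial (Module.finrank F V) k (Nat.card F) := by
  have hq : 2 ≤ Nat.card F :=
  Finite.one_lt_card (α := F)
  have h := subspaceCard_mul_frameCard F V hk
  rw [frameCard_eq_prod_mul hk, frameCard_eq_prod_mul le_rfl] at h
  have hpos : 0 < ∏ i ∈ Finset.range k, Nat.card F ^ i :=
    Finset.prod_pos fun i _ => pow_pos (by omega) i
  have h2 : subspaceCard F V k * ∏ i ∈ Finset.range k, (Nat.card F ^ (k - i) - 1) =
      ∏ i ∈ Finset.range k, (Nat.card F ^ (Module.finrank F V - i) - 1) :=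
    Nat.eq_of_mul_eq_mul_left hpos (by rw [← h]; ring)
  have hrefl : ∏ i ∈ Finset.range k, (Nat.card F ^ (k - i) - 1) =
      ∏ i ∈ Finset.range k, (Nat.card F ^ (i + 1) - 1) := by
    rw [← Finset.prod_range_reflect]
    refine Finset.prod_congr rfl fun i hi => ?_
    have := Finset.mem_range.1 hi
    rw [show k - (k - 1 - i) = i + 1 by omega]
  rw [qBinomial, ← h2, hrefl, Nat.mul_div_cancel]
  refine Finset.prod_pos fun i _ => ?_
  have : 1 < Nat.card F ^ (i + 1) := Nat.one_lt_pow (by omega) (by omega)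
  omega

theorem subspaceCard_symm (F V : Type*) [Field F] [Finite F] [AddCommGroup V] [Module F V]
    [FiniteDimensional F V] {k : ℕ} (hk : k ≤ Module.finrank F V) :
    subspaceCard F V (Module.finrank F V - k) = subspaceCard F V k := by
  have h1 : subspaceCard F V (Module.finrank F V - k) =
      subspaceCard F (Module.Dual F V) k := by
    refine Nat.card_congr ((Subspace.orderIsoFiniteDimensional (K := F) (V := V)).toEquiv.trans
      OrderDual.ofDual |>.subtypeEquiv fun U => ?_)
    have := Subspace.finrank_add_finrank_dualAnnihilator_eq U
    have h2 : (((Subspace.orderIsoFiniteDimensional (K := F) (V := V)).toEquiv.trans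
      OrderDual.ofDual) U) = U.dualAnnihilator := rfl
    rw [h2]
    omega
  rw [h1, subspaceCard_eq_qBinomial F V hk, subspaceCard_eq_qBinomial F _
    (by rwa [Subspace.dual_finrank_eq]), Subspace.dual_finrank_eq]

/-- The product `∏ (1 - q ^ (k - n))` over any set of exponents `k < n` is at least `1 / 4`. -/
theorem pow_le_four_mul_prod {q n : ℕ} (hq : 2 ≤ q) {S : Finset ℕ} (hS : S ⊆ Finset.range n) :
    q ^ (n * S.card) ≤ 4 * ∏ k ∈ S, (q ^ n - q ^ k) := by
  have hq0 : (0 : ℚ) < q := by exact_mod_cast (by omega : 0 < q)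
  have hq2 : (2 : ℚ) ≤ q := by exact_mod_cast hq
  -- the extra term `(1 / 2) ^ (m + 2)` makes the bound `1 / 4` inductive
  have aux : ∀ m : ℕ, (1 / 4 : ℚ) + (1 / 2) ^ (m + 2) ≤
      ∏ j ∈ Finset.range (m + 1), (1 - (1 / 2) ^ (j + 1)) := by
    intro m
    induction m with
    | zero => norm_num
    | succ m ih =>
      rw [Finset.prod_range_succ]
      have h0 : (0 : ℚ) < (1 / 2) ^ m := by positivity
      have h1 : ((1 : ℚ) / 2) ^ m ≤ 1 := pow_le_one₀ (by norm_num) (by norm_num)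
      have e1 : ((1 : ℚ) / 2) ^ (m + 2) = (1 / 2) ^ m / 4 := by rw [pow_add]; ring
      have e2 : ((1 : ℚ) / 2) ^ (m + 1 + 2) = (1 / 2) ^ m / 8 := by rw [pow_add, pow_add]; ring
      have e3 : ((1 : ℚ) / 2) ^ (m + 1 + 1) = (1 / 2) ^ m / 4 := by rw [pow_add, pow_add]; ring
      rw [e1] at ih
      rw [e2, e3]
      have h2 : (0 : ℚ) ≤ 1 - (1 / 2) ^ m / 4 := by linarith
      refine le_trans ?_ (mul_le_mul_of_nonneg_right ih h2)
      nlinarith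
  have aux2 : (1 / 4 : ℚ) ≤ ∏ j ∈ Finset.range n, (1 - (1 / 2) ^ (j + 1)) := by
    rcases n with _ | m
    · norm_num
    · refine le_trans ?_ (aux m)
      have : (0 : ℚ) < (1 / 2) ^ (m + 2) := by positivity
      linarith
  have h1 : (1 / 4 : ℚ) ≤ ∏ k ∈ S, (1 - (1 / 2) ^ (n - k)) := by
    refine aux2.trans ?_
    rw [← Finset.prod_range_reflect]
    have : ∏ j ∈ Finset.range n, (1 - (1 / 2 : ℚ) ^ (n - 1 - j + 1)) =
        ∏ j ∈ Finset.range n, (1 - (1 / 2 : ℚ) ^ (n - j)) := by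
      refine Finset.prod_congr rfl fun j hj => ?_
      have := Finset.mem_range.1 hj
      rw [show n - 1 - j + 1 = n - j by omega]
    rw [this]
    refine Finset.prod_le_prod_of_subset_of_le_one hS (fun i _ => ?_) fun i _ _ => ?_
    · have : ((1 : ℚ) / 2) ^ (n - i) ≤ 1 := pow_le_one₀ (by norm_num) (by norm_num)
      linarith
    · have : (0 : ℚ) ≤ ((1 : ℚ) / 2) ^ (n - i) := by positivity
      linarith
  have h2 : ∏ k ∈ S, ((q : ℚ) ^ n * (1 - (1 / 2) ^ (n - k))) ≤
      ∏ k ∈ S, ((q ^ n - q ^ k : ℕ) : ℚ) := by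
    refine Finset.prod_le_prod (fun k _ => ?_) fun k hk => ?_
    · have : ((1 : ℚ) / 2) ^ (n - k) ≤ 1 := pow_le_one₀ (by norm_num) (by norm_num)
      exact mul_nonneg (by positivity) (by linarith)
    · have hkn := Finset.mem_range.1 (hS hk)
      rw [Nat.cast_sub (Nat.pow_le_pow_right (by omega) hkn.le)]
      push_cast
      have : (q : ℚ) ^ k ≤ q ^ n * (1 / 2) ^ (n - k) := by
        have e : (q : ℚ) ^ n = q ^ k * q ^ (n - k) := by rw [← pow_add]; congr 1; omega
        rw [e, mul_assoc, ← mul_pow]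
        have : (1 : ℚ) ≤ (q * (1 / 2)) ^ (n - k) := one_le_pow₀ (by linarith)
        have := mul_le_mul_of_nonneg_left this (by positivity : (0 : ℚ) ≤ q ^ k)
        linarith
      linarith
  rw [Finset.prod_mul_distrib, Finset.prod_const] at h2
  have h3 : ((q ^ (n * S.card) : ℕ) : ℚ) ≤ ((4 * ∏ k ∈ S, (q ^ n - q ^ k) : ℕ) : ℚ) := by
    push_cast [pow_mul] at h2 ⊢
    have := mul_le_mul_of_nonneg_left h1 (by positivity : (0 : ℚ) ≤ ((q : ℚ) ^ n) ^ S.card)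
    linarith
  exact_mod_cast h3

theorem pow_le_four_mul_frameCard {q n k : ℕ} (hq : 2 ≤ q) (hk : k ≤ n) :
    q ^ (n * k) ≤ 4 * frameCard q n k := by
  have := pow_le_four_mul_prod hq (S := Finset.range k) (n := n)
    (Finset.range_subset_range.2 hk)
  rwa [Finset.card_range] at this

theorem frameCard_le_pow (q n k : ℕ) : frameCard q n k ≤ q ^ (n * k) := by
  rw [frameCard, pow_mul]
  refine (Finset.prod_le_pow_card _ _ (q ^ n) fun i _ => Nat.sub_le _ _).trans ?_
  rw [Finset.card_range]

theorem frameCard_le_sub_one_pow {q n k : ℕ} (hq : 2 ≤ q) : frameCard q n k ≤ (q ^ n - 1) ^ k := by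
  rw [frameCard]
  refine (Finset.prod_le_pow_card _ _ (q ^ n - 1) fun i _ => ?_).trans ?_
  · have := Nat.one_le_pow i q (by omega)
    omega
  · rw [Finset.card_range]

theorem two_le_natCard (F : Type*) [Field F] [Finite F] : 2 ≤ Nat.card F :=
  Finite.one_lt_card (α := F)

section

variable (F V : Type*) [Field F] [Finite F] [AddCommGroup V] [Module F V] [FiniteDimensional F V]

theorem subspaceCard_le_sub_one_pow {k : ℕ} (hk : k ≤ Module.finrank F V) :
    subspaceCard F V k ≤ (Nat.card F ^ Module.finrank F V - 1) ^ k := by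
  refine le_trans ?_ (frameCard_le_sub_one_pow (two_le_natCard F))
  rw [← subspaceCard_mul_frameCard F V hk]
  exact Nat.le_mul_of_pos_right _ (frameCard_pos (two_le_natCard F) le_rfl)

theorem three_mul_subspaceCard_le {k : ℕ} (hk2 : 2 ≤ k) (hk : k ≤ Module.finrank F V) :
    3 * subspaceCard F V k ≤ (Nat.card F ^ Module.finrank F V - 1) ^ k := by
  refine le_trans ?_ (frameCard_le_sub_one_pow (two_le_natCard F))
  rw [← subspaceCard_mul_frameCard F V hk, mul_comm]
  refine Nat.mul_le_mul_left _ ?_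
  have hq := two_le_natCard F
  have h4 : 2 ^ 2 ≤ Nat.card F ^ k :=
    (Nat.pow_le_pow_left hq 2).trans (Nat.pow_le_pow_right (by omega) hk2)
  obtain ⟨m, rfl⟩ : ∃ m, k = m + 1 := ⟨k - 1, by omega⟩
  rw [frameCard, Finset.prod_range_succ']
  have : 1 ≤ ∏ i ∈ Finset.range m, (Nat.card F ^ (m + 1) - Nat.card F ^ (i + 1)) := by
    refine Nat.succ_le_of_lt (Finset.prod_pos fun i hi => ?_)
    have : Nat.card F ^ (i + 1) < Nat.card F ^ (m + 1) :=
      Nat.pow_lt_pow_right (by omega) (by have := Finset.mem_range.1 hi; omega)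
    omega
  have h3 : 3 ≤ Nat.card F ^ (m + 1) - Nat.card F ^ 0 := by rw [pow_zero]; omega
  calc 3 = 1 * 3 := rfl
    _ ≤ _ := Nat.mul_le_mul this h3

theorem subspaceCard_le_four_mul_pow {k : ℕ} (hk : k ≤ Module.finrank F V) :
    subspaceCard F V k ≤ 4 * Nat.card F ^ (k * (Module.finrank F V - k)) := by
  have hq := two_le_natCard F
  have h1 := subspaceCard_mul_frameCard F V hk
  have h2 := frameCard_le_pow (Nat.card F) (Module.finrank F V) k
  have h3 := pow_le_four_mul_frameCard hq (le_refl k)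
  have hpos : 0 < Nat.card F ^ (k * k) := pow_pos (by omega) _
  refine Nat.le_of_mul_le_mul_right ?_ hpos
  calc subspaceCard F V k * Nat.card F ^ (k * k)
      ≤ subspaceCard F V k * (4 * frameCard (Nat.card F) k k) := Nat.mul_le_mul_left _ h3
    _ = 4 * frameCard (Nat.card F) (Module.finrank F V) k := by rw [← h1]; ring
    _ ≤ 4 * Nat.card F ^ (Module.finrank F V * k) := Nat.mul_le_mul_left _ h2
    _ = 4 * Nat.card F ^ (k * (Module.finrank F V - k)) * Nat.card F ^ (k * k) := by
      rw [mul_assoc, ← pow_add, ← Nat.mul_add, show Module.finrank F V - k + k =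
        Module.finrank F V by omega, mul_comm k]

theorem pow_le_subspaceCard {k : ℕ} (hk : k ≤ Module.finrank F V) :
    Nat.card F ^ (k * (Module.finrank F V - k)) ≤ subspaceCard F V k := by
  have hq := two_le_natCard F
  have h1 := subspaceCard_mul_frameCard F V hk
  refine Nat.le_of_mul_le_mul_right ?_ (frameCard_pos hq (le_refl k))
  rw [h1, frameCard, frameCard]
  calc Nat.card F ^ (k * (Module.finrank F V - k)) *
        ∏ i ∈ Finset.range k, (Nat.card F ^ k - Nat.card F ^ i)
      = ∏ i ∈ Finset.range k, Nat.card F ^ (Module.finrank F V - k) *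
          (Nat.card F ^ k - Nat.card F ^ i) := by
        rw [Finset.prod_mul_distrib, Finset.prod_const, Finset.card_range, ← pow_mul, mul_comm k]
    _ ≤ _ := by
        refine Finset.prod_le_prod' fun i hi => ?_
        rw [Nat.mul_sub, ← pow_add, ← pow_add, show Module.finrank F V - k + k =
          Module.finrank F V by omega]
        exact Nat.sub_le_sub_left (Nat.pow_le_pow_right (by omega) (by omega)) _

end

open Module

/-! ### Conjugacy classes of linear maps and their sizes -/

/-- The linear maps on `V` that are conjugate to `a` under some isomorphism `M ≃ V`. -/
def conjSet {F M : Type*} (V : Type*) [Field F] [AddCommGroup M] [Module F M] [AddCommGroup V]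
    [Module F V] (a : Module.End F M) : Set (Module.End F V) :=
  {B | ∃ φ : M ≃ₗ[F] V, ∀ x, B (φ x) = φ (a x)}

theorem finite_end (F V : Type*) [Field F] [Finite F] [AddCommGroup V] [Module F V]
    [FiniteDimensional F V] : Finite (Module.End F V) := by
  have : Finite V := Module.finite_of_finite F
  exact Finite.of_injective (fun f => (f : V → V)) DFunLike.coe_injective

theorem finite_linearEquiv (F M V : Type*) [Field F] [Finite F] [AddCommGroup V] [Module F V]
    [FiniteDimensional F V] [AddCommGroup M] [Module F M] [FiniteDimensional F M] :
    Finite (M ≃ₗ[F] V) := by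
  have : Finite V := Module.finite_of_finite F
  have : Finite M := Module.finite_of_finite F
  exact Finite.of_injective (fun f => (f : M → V)) DFunLike.coe_injective

theorem frameCard_le_natCard_linearEquiv (F M V : Type*) [Field F] [Finite F] [AddCommGroup V]
    [Module F V] [FiniteDimensional F V] [AddCommGroup M] [Module F M] [FiniteDimensional F M]
    (h : finrank F M = finrank F V) :
    frameCard (Nat.card F) (finrank F V) (finrank F V) ≤ Nat.card (M ≃ₗ[F] V) := by
  have := finite_linearEquiv F M V
  rw [← natCard_linearIndependent (F := F) (V := V) le_rfl]
  let b := finBasisOfFinrankEq F M h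
  refine Nat.card_le_card_of_injective
    (fun s => b.equiv (basisOfLinearIndependentOfCardEqFinrank' s.1 s.2 (by simp))
      (Equiv.refl _)) fun s s' hss => Subtype.ext (funext fun i => ?_)
  have := LinearEquiv.congr_fun hss (b i)
  simpa using this

/-- The size of a conjugacy class of a linear map with a cyclic vector. -/
theorem frameCard_le_ncard_conjSet_mul {F M V : Type*} [Field F] [Finite F] [AddCommGroup V]
    [Module F V] [FiniteDimensional F V] [AddCommGroup M] [Module F M] [FiniteDimensional F M]
    (h : finrank F M = finrank F V) (a : Module.End F M) {x₀ : M} (hx₀ : x₀ ≠ 0)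
    (hcyc : ∀ x, ∃ f : Polynomial F, x = Polynomial.aeval a f x₀) :
    frameCard (Nat.card F) (finrank F V) (finrank F V) ≤
      (conjSet V a).ncard * (Nat.card F ^ finrank F V - 1) := by
  have : Finite V := Module.finite_of_finite F
  have := finite_end F V
  refine (frameCard_le_natCard_linearEquiv F M V h).trans ?_
  have hV : Nat.card {v : V // v ≠ 0} = Nat.card F ^ finrank F V - 1 := by
    have h1 := Set.ncard_add_ncard_compl {(0 : V)}
    rw [Set.ncard_singleton, Module.natCard_eq_pow_finrank (K := F) (V := V)] at h1
    have h2 : Nat.card {v : V // v ≠ 0} = ({(0 : V)}ᶜ : Set V).ncard := rfl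
    omega
  rw [← hV, ← Nat.card_coe_set_eq, ← Nat.card_prod]
  let B : (M ≃ₗ[F] V) → Module.End F V := fun φ => (φ : M →ₗ[F] V) ∘ₗ a ∘ₗ φ.symm
  have hB : ∀ φ x, B φ (φ x) = φ (a x) := fun φ x => by simp [B]
  have hpow : ∀ φ (f : Polynomial F) x, Polynomial.aeval (B φ) f (φ x) =
      φ (Polynomial.aeval a f x) := by
    intro φ f
    induction f using Polynomial.induction_on' with
    | add f g hf hg => intro x; simp [hf, hg]
    | monomial k c =>
      intro x
      rw [Polynomial.aeval_monomial, Polynomial.aeval_monomial]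
      simp only [Module.End.mul_apply, Module.algebraMap_end_apply, map_smul]
      congr 1
      induction k generalizing x with
      | zero => simp
      | succ k ih => rw [pow_succ, pow_succ, Module.End.mul_apply, hB, ih, Module.End.mul_apply]
  refine Nat.card_le_card_of_injective
    (fun φ => (⟨⟨B φ, φ, hB φ⟩, ⟨φ x₀, by simpa using hx₀⟩⟩ :
      conjSet V a × {v : V // v ≠ 0})) fun φ ψ hφψ => ?_
  have h1 : B φ = B ψ := congrArg (fun z => z.1.1) hφψ
  have h2 : φ x₀ = ψ x₀ := congrArg (fun z => z.2.1) hφψ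
  ext x
  obtain ⟨f, rfl⟩ := hcyc x
  rw [← hpow, ← hpow, h1, h2]

/-- Multiplication by an element of an algebra. -/
abbrev mulEnd (F : Type*) {L : Type*} [Field F] [Ring L] [Algebra F L] (θ : L) : Module.End F L :=
  LinearMap.mulLeft F θ

theorem exists_eq_aeval_mulEnd {F L : Type*} [Field F] [Ring L] [Algebra F L] {θ : L}
    (hθ : Algebra.adjoin F {θ} = ⊤) (x : L) :
    ∃ f : Polynomial F, x = Polynomial.aeval (mulEnd F θ) f 1 := by
  have : x ∈ Algebra.adjoin F {θ} := by rw [hθ]; trivial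
  rw [Algebra.adjoin_singleton_eq_range_aeval] at this
  obtain ⟨f, rfl⟩ := this
  refine ⟨f, ?_⟩
  have h1 := Polynomial.aeval_algHom_apply (Algebra.lmul F L) θ f
  have h2 : (Algebra.lmul F L θ) = mulEnd F θ := rfl
  rw [h2] at h1
  change _ = (Polynomial.aeval (mulEnd F θ) f) 1
  rw [h1]
  simp

theorem adjoin_eq_top_of_pow {F L : Type*} [Field F] [Field L] [Algebra F L] {θ : L}
    (hθ : ∀ x : L, x ≠ 0 → ∃ k : ℕ, x = θ ^ (k + 1)) : Algebra.adjoin F {θ} = ⊤ := by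
  refine eq_top_iff.2 fun x _ => ?_
  rcases eq_or_ne x 0 with rfl | hx
  · exact Subalgebra.zero_mem _
  · obtain ⟨k, rfl⟩ := hθ x hx
    exact Subalgebra.pow_mem _ (Algebra.self_mem_adjoin_singleton F θ) _

theorem exists_basis_pow {F D L : Type*} [Field F] [Field D] [Field L] [Algebra F D] [Algebra D L]
    [Algebra F L] [IsScalarTower F D L] [FiniteDimensional F L] {θ : L}
    (hθ : Algebra.adjoin F {θ} = ⊤) {m : ℕ} (hm : finrank D L = m) :
    ∃ b : Basis (Fin m) D L, ∀ i, b i = θ ^ (i : ℕ) := by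
  have : FiniteDimensional D L := Module.Finite.of_restrictScalars_finite F D L
  have h1 : IntermediateField.adjoin D {θ} = ⊤ := by
    refine eq_top_iff.2 fun x _ => ?_
    have hx : x ∈ Algebra.adjoin F {θ} := by rw [hθ]; trivial
    induction hx using Algebra.adjoin_induction with
    | mem x hx => exact IntermediateField.subset_adjoin _ _ hx
    | algebraMap c =>
      rw [IsScalarTower.algebraMap_apply F D L]
      exact IntermediateField.algebraMap_mem _ _
    | add x y _ _ hx hy => exact add_mem (hx trivial) (hy trivial)
    | mul x y _ _ hx hy => exact mul_mem (hx trivial) (hy trivial)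
  have h2 : (minpoly D θ).natDegree = m := by
    rw [← hm]
    exact (Field.primitive_element_iff_minpoly_natDegree_eq D θ).1 h1
  have hli := linearIndependent_pow (K := D) θ
  rw [h2] at hli
  exact ⟨basisOfLinearIndependentOfCardEqFinrank' _ hli (by simp [hm]), fun i => by simp⟩

/-- Let `θ` generate an extension `L` of `F` with `[L : F] = dim V`. Among the linear maps on `V`
conjugate to multiplication by `θ`, those commuting with an extension `D` of the scalars amount to
an embedding `D → L` together with a `D`-linear isomorphism `L ≃ V`, up to rescaling. -/
theorem ncard_conjSet_commuting_mul_le {F V D L : Type*} [Field F] [Finite F] [AddCommGroup V]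
    [Module F V] [FiniteDimensional F V] [Field D] [Algebra F D] [FiniteDimensional F D]
    [Module D V] [IsScalarTower F D V] [Field L] [Algebra F L] [FiniteDimensional F L]
    (hL : finrank F L = finrank F V) {θ : L} (hθ : Algebra.adjoin F {θ} = ⊤) :
    {B ∈ conjSet V (mulEnd F θ) | ∀ (δ : D) v, B (δ • v) = δ • B v}.ncard *
      (Nat.card F ^ finrank F V - 1) ≤
      finrank F D * frameCard (Nat.card D) (finrank D V) (finrank D V) := by
  classical
  have : Finite V := Module.finite_of_finite F
  have : Finite D := Module.finite_of_finite F
  have : Finite L := Module.finite_of_finite F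
  have := finite_end F V
  have := finite_linearEquiv F L V
  have : Module.Finite D V := Module.Finite.of_restrictScalars_finite F D V
  have hmul : finrank F D * finrank D V = finrank F V := Module.finrank_mul_finrank F D V
  let Φ := {φ : L ≃ₗ[F] V // ∀ (δ : D) x, φ (θ * φ.symm (δ • φ x)) = δ • φ (θ * x)}
  have hV : Nat.card {v : V // v ≠ 0} = Nat.card F ^ finrank F V - 1 := by
    have h1 := Set.ncard_add_ncard_compl {(0 : V)}
    rw [Set.ncard_singleton, Module.natCard_eq_pow_finrank (K := F) (V := V)] at h1
    have h2 : Nat.card {v : V // v ≠ 0} = ({(0 : V)}ᶜ : Set V).ncard := rfl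
    omega
  have step1 : {B ∈ conjSet V (mulEnd F θ) | ∀ (δ : D) v, B (δ • v) = δ • B v}.ncard *
      (Nat.card F ^ finrank F V - 1) ≤ Nat.card Φ := by
    rw [← hV, ← Nat.card_coe_set_eq, ← Nat.card_prod]
    have hex : ∀ z : {B ∈ conjSet V (mulEnd F θ) | ∀ (δ : D) v, B (δ • v) = δ • B v} ×
        {v : V // v ≠ 0}, ∃ φ : L ≃ₗ[F] V, (∀ x, z.1.1 (φ x) = φ (θ * x)) ∧ φ 1 = z.2.1 := by
      rintro ⟨⟨B, ⟨φ, hφ⟩, hB⟩, ⟨v, hv⟩⟩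
      have hc : φ.symm v ≠ 0 := by simpa using hv
      refine ⟨(LinearEquiv.smulOfNeZero L L (φ.symm v) hc |>.restrictScalars F).trans φ, ?_, ?_⟩
      · intro x
        simp only [LinearEquiv.trans_apply]
        change B (φ (φ.symm v * x)) = φ (φ.symm v * (θ * x))
        rw [hφ]
        congr 1
        simp only [LinearMap.mulLeft_apply]
        ring
      · change φ (φ.symm v * 1) = v
        simp
    choose g hg1 hg2 using hex
    refine Nat.card_le_card_of_injective (fun z => (⟨g z, fun δ x => ?_⟩ : Φ)) ?_
    · rw [← hg1, LinearEquiv.apply_symm_apply, z.1.2.2, hg1]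
    · intro z z' hzz
      have h1 : g z = g z' := congrArg Subtype.val hzz
      refine Prod.ext (Subtype.ext (LinearMap.ext fun v => ?_)) (Subtype.ext ?_)
      · obtain ⟨x, rfl⟩ := (g z).surjective v
        rw [hg1]
        conv_rhs => rw [h1, hg1]
        rw [h1]
      · rw [← hg2, ← hg2, h1]
  refine step1.trans ?_
  -- every `φ : Φ` turns the `D`-structure of `V` into an embedding of `D` in `L`
  have hι : ∀ φ : Φ, ∃ ι : D →ₐ[F] L, ∀ (δ : D) (x : L), δ • φ.1 x = φ.1 (ι δ * x) := by
    rintro ⟨φ, hφ⟩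
    let u : D → L →ₗ[F] L := fun δ =>
      (φ.symm : V →ₗ[F] L) ∘ₗ Algebra.lsmul F F V δ ∘ₗ (φ : L →ₗ[F] V)
    have hu : ∀ δ x, u δ x = φ.symm (δ • φ x) := fun δ x => rfl
    have huθ : ∀ δ x, u δ (θ * x) = θ * u δ x := by
      intro δ x
      rw [hu, ← hφ, LinearEquiv.symm_apply_apply, hu]
    have humul : ∀ δ x y, u δ (x * y) = x * u δ y := by
      intro δ x
      have : x ∈ Algebra.adjoin F {θ} := by rw [hθ]; trivial
      induction this using Algebra.adjoin_induction with
      | mem x hx => rw [Set.mem_singleton_iff.1 hx]; exact huθ δ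
      | algebraMap c =>
        intro y
        rw [← Algebra.smul_def, map_smul, Algebra.smul_def]
      | add x y _ _ hx hy => intro z; rw [add_mul, map_add, hx, hy, add_mul]
      | mul x y _ _ hx hy => intro z; rw [mul_assoc, hx, hy, mul_assoc]
    have hu1 : ∀ δ x, u δ x = u δ 1 * x := fun δ x => by
      rw [mul_comm, ← humul, mul_one]
    refine ⟨{ toFun := fun δ => u δ 1
              map_one' := by simp [hu]
              map_mul' := fun δ δ' => by
                rw [← hu1, hu, hu, hu, LinearEquiv.apply_symm_apply, mul_smul]
              map_zero' := by simp [hu]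
              map_add' := fun δ δ' => by simp [hu, add_smul]
              commutes' := fun c => by
                rw [hu, algebraMap_smul, ← map_smul, LinearEquiv.symm_apply_apply,
                  Algebra.algebraMap_eq_smul_one] }, fun δ x => ?_⟩
    change _ = φ (u δ 1 * x)
    rw [← hu1, hu, LinearEquiv.apply_symm_apply]
  choose ι hι using hι
  have hli : ∀ φ : Φ, LinearIndependent D (fun i : Fin (finrank D V) => φ.1 (θ ^ (i : ℕ))) := by
    intro φ
    let := (ι φ).toRingHom.toAlgebra
    have : IsScalarTower F D L := IsScalarTower.of_algebraMap_eq fun c => ((ι φ).commutes c).symm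
    let φ' : L →ₗ[D] V :=
      { toFun := φ.1
        map_add' := map_add φ.1
        map_smul' := fun δ x => (hι φ δ x).symm }
    have hfr : finrank D L = finrank D V := by
      have h1 := Module.finrank_mul_finrank F D L
      rw [hL, ← hmul] at h1
      exact Nat.eq_of_mul_eq_mul_left Module.finrank_pos h1
    obtain ⟨b, hb⟩ := exists_basis_pow (D := D) hθ hfr
    have h2 := b.linearIndependent.map' φ' (LinearMap.ker_eq_bot.2 φ.1.injective)
    have e : (fun i : Fin (finrank D V) => φ.1 (θ ^ (i : ℕ))) = φ' ∘ b :=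
      funext fun i => by simp [φ', hb]
    rw [e]
    exact h2
  have hdvd : finrank F D ∣ finrank F L := by
    rw [hL, ← hmul]; exact dvd_mul_right _ _
  rw [← FiniteField.natCard_algHom_of_finrank_dvd hdvd, ← natCard_linearIndependent le_rfl,
    ← Nat.card_prod]
  refine Nat.card_le_card_of_injective (fun φ : Φ => (ι φ, ⟨_, hli φ⟩)) fun φ ψ h => ?_
  have h1 : ι φ = ι ψ := congrArg Prod.fst h
  have h2 : ∀ i : Fin (finrank D V), φ.1 (θ ^ (i : ℕ)) = ψ.1 (θ ^ (i : ℕ)) := fun i =>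
    congrFun (congrArg (fun z => z.2.1) h) i
  let := (ι φ).toRingHom.toAlgebra
  have : IsScalarTower F D L := IsScalarTower.of_algebraMap_eq fun c => ((ι φ).commutes c).symm
  have hfr : finrank D L = finrank D V := by
    have h1 := Module.finrank_mul_finrank F D L
    rw [hL, ← hmul] at h1
    exact Nat.eq_of_mul_eq_mul_left Module.finrank_pos h1
  obtain ⟨b, hb⟩ := exists_basis_pow (D := D) hθ hfr
  let φ' : L →ₗ[D] V :=
    { toFun := φ.1
      map_add' := map_add φ.1
      map_smul' := fun δ x => (hι φ δ x).symm }
  let ψ' : L →ₗ[D] V :=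
    { toFun := ψ.1
      map_add' := map_add ψ.1
      map_smul' := fun δ x => by
        have := (hι ψ δ x).symm
        rw [← h1] at this
        exact this }
  have heq : φ' = ψ' := b.ext fun i => by rw [hb]; exact h2 i
  exact Subtype.ext (LinearEquiv.ext fun x => LinearMap.congr_fun heq x)

/-- A subring meeting the conjugacy class of a generator of a field of order `|V|` is irreducible,
so that if it is proper it commutes with an extension of the scalars. -/
theorem exists_ncard_inter_conjSet_mul_le {F V L : Type*} [Field F] [Finite F] [AddCommGroup V]
    [Module F V] [FiniteDimensional F V] [Nontrivial V] [Field L] [Algebra F L]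
    [FiniteDimensional F L] (hL : finrank F L = finrank F V) {θ : L}
    (hθ : ∀ x : L, x ≠ 0 → ∃ k : ℕ, x = θ ^ (k + 1)) {P : NonUnitalSubring (Module.End F V)}
    (hP : P ≠ ⊤) (hne : ((P : Set (Module.End F V)) ∩ conjSet V (mulEnd F θ)).Nonempty) :
    ∃ r, 2 ≤ r ∧ r ∣ finrank F V ∧
      ((P : Set (Module.End F V)) ∩ conjSet V (mulEnd F θ)).ncard *
        (Nat.card F ^ finrank F V - 1) ≤
      r * frameCard (Nat.card F ^ r) (finrank F V / r) (finrank F V / r) := by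
  obtain ⟨B, hBP, φ, hφ⟩ := hne
  have hpow : ∀ k x, (B ^ k) (φ x) = φ (θ ^ k * x) := by
    intro k
    induction k with
    | zero => simp
    | succ k ih =>
      intro x
      rw [pow_succ, Module.End.mul_apply, hφ, ih, pow_succ, mul_assoc]
      rfl
  have hirr : ∀ U : Submodule F V, (∀ t ∈ P, ∀ u ∈ U, t u ∈ U) → U = ⊥ ∨ U = ⊤ := by
    intro U hU
    by_cases h : U = ⊥
    · exact Or.inl h
    right
    obtain ⟨u, hu, hu0⟩ := Submodule.exists_mem_ne_zero_of_ne_bot h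
    obtain ⟨x, rfl⟩ := φ.surjective u
    have hx : x ≠ 0 := by simpa using hu0
    refine eq_top_iff.2 fun v _ => ?_
    obtain ⟨y, rfl⟩ := φ.surjective v
    rcases eq_or_ne y 0 with rfl | hy
    · simp
    obtain ⟨k, hk⟩ := hθ (y / x) (div_ne_zero hy hx)
    have := hU _ (P.pow_succ_mem hBP k) _ hu
    rwa [hpow, ← hk, div_mul_cancel₀ _ hx] at this
  have hscal : ∀ c : F, c • (1 : Module.End F V) ∈ P := by
    intro c
    rcases eq_or_ne c 0 with rfl | hc
    · rw [zero_smul]; exact P.zero_mem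
    obtain ⟨k, hk⟩ := hθ (algebraMap F L c) (by simpa using hc)
    have : c • (1 : Module.End F V) = B ^ (k + 1) := by
      ext v
      obtain ⟨x, rfl⟩ := φ.surjective v
      rw [hpow, ← hk, ← Algebra.smul_def, map_smul]
      rfl
    rw [this]
    exact P.pow_succ_mem hBP k
  obtain ⟨D, hD, hr, hcomm⟩ := exists_field_of_irreducible hirr one_ne_zero hscal hP
  let : Field D := hD.toField
  have hmul : finrank F D * finrank D V = finrank F V := Module.finrank_mul_finrank F D V
  have := finite_end F V
  have : Finite V := Module.finite_of_finite F
  refine ⟨finrank F D, hr, ⟨_, hmul.symm⟩, ?_⟩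
  have h1 := ncard_conjSet_commuting_mul_le (D := D) hL (adjoin_eq_top_of_pow (F := F) hθ)
  rw [← hmul, Nat.mul_div_cancel_left _ (by omega), hmul,
    ← Module.natCard_eq_pow_finrank (K := F) (V := D)]
  refine le_trans (Nat.mul_le_mul_right _ (Set.ncard_le_ncard ?_ (Set.toFinite _))) h1
  rintro B ⟨hB, hBc⟩
  exact ⟨hBc, fun δ v => LinearMap.congr_fun (hcomm B hB δ.1 δ.2) v⟩

/-! ### A lower bound for the covering number of a matrix ring -/

theorem Set.ncard_le_sum_ncard_inter {α ι : Type*} [Finite α] {s : Finset ι} {f : ι → Set α}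
    {G : Set α} (h : ∀ x ∈ G, ∃ i ∈ s, x ∈ f i) : G.ncard ≤ ∑ i ∈ s, (f i ∩ G).ncard := by
  classical
  have hG : G ⊆ ⋃ i ∈ s, (f i ∩ G) := by
    intro x hx
    obtain ⟨i, hi, hxi⟩ := h x hx
    exact Set.mem_biUnion hi ⟨hxi, hx⟩
  refine (Set.ncard_le_ncard hG (Set.toFinite _)).trans ?_
  clear hG h
  induction s using Finset.induction_on with
  | empty => simp
  | insert a s ha ih =>
    rw [Finset.set_biUnion_insert, Finset.sum_insert ha]
    exact (Set.ncard_union_le _ _).trans (Nat.add_le_add_left ih _)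

/-- Every linear map generating a field of order `|V|` has to be covered, and a proper subring
contains few of them. -/
theorem lt_coveringNumber_end {F V : Type*} [Field F] [Finite F] [AddCommGroup V]
    [Module F V] [FiniteDimensional F V] (hn : 0 < finrank F V) {M : ℕ}
    (hM : ∀ r, 2 ≤ r → r ∣ finrank F V →
      M * (r * frameCard (Nat.card F ^ r) (finrank F V / r) (finrank F V / r)) <
        frameCard (Nat.card F) (finrank F V) (finrank F V)) :
    ((M + 1 : ℕ) : ℕ∞) ≤ coveringNumber (Module.End F V) := by
  refine le_iInf₂ fun C hC => ?_
  by_contra hlt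
  rw [not_le] at hlt
  have hfin : C.Finite := Set.finite_of_encard_le_coe hlt.le
  have hcard : C.ncard ≤ M := by
    rw [← hfin.cast_ncard_eq] at hlt
    have : C.ncard < M + 1 := by exact_mod_cast hlt
    omega
  have := Fintype.ofFinite F
  obtain ⟨p, hchar, k, hp, -⟩ := FiniteField.card' F
  have : Fact p.Prime := ⟨hp⟩
  have : Nontrivial V := Module.nontrivial_of_finrank_pos hn
  have : NeZero (finrank F V) := ⟨hn.ne'⟩
  let L := FiniteField.Extension F p (finrank F V)
  have : Finite L := Module.finite_of_finite F
  have hL : finrank F L = finrank F V := FiniteField.finrank_extension F p _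
  obtain ⟨θ, -, hθ⟩ := exists_pow_eq_of_finite L
  have := finite_end F V
  let G := conjSet V (mulEnd F θ)
  have h1 := frameCard_le_ncard_conjSet_mul (V := V) hL (mulEnd F θ) (one_ne_zero (α := L))
    (exists_eq_aeval_mulEnd (adjoin_eq_top_of_pow hθ))
  have h2 : G.ncard ≤ ∑ P ∈ hfin.toFinset, ((P : Set (Module.End F V)) ∩ G).ncard :=
    Set.ncard_le_sum_ncard_inter fun x _ => by
      obtain ⟨P, hP, hx⟩ := hC.2 x
      exact ⟨P, hfin.mem_toFinset.2 hP, hx⟩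
  set t := Nat.card F ^ finrank F V - 1
  set T := frameCard (Nat.card F) (finrank F V) (finrank F V)
  have hT : 0 < T := frameCard_pos (two_le_natCard F) le_rfl
  have h3 : ∀ P ∈ hfin.toFinset, M * (((P : Set (Module.End F V)) ∩ G).ncard * t) < T := by
    intro P hP
    rcases Set.eq_empty_or_nonempty ((P : Set (Module.End F V)) ∩ G) with h | h
    · rw [h]; simpa using hT
    · obtain ⟨r, hr, hrn, hle⟩ := exists_ncard_inter_conjSet_mul_le hL hθ
        (hC.1 P (hfin.mem_toFinset.1 hP)) h
      exact (Nat.mul_le_mul_left _ hle).trans_lt (hM r hr hrn)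
  have hne : hfin.toFinset.Nonempty := by
    rw [Finset.nonempty_iff_ne_empty]
    intro h
    rw [h, Finset.sum_empty] at h2
    have : G.ncard = 0 := by omega
    change T ≤ G.ncard * t at h1
    rw [this, zero_mul] at h1
    omega
  have h4 := Finset.sum_lt_sum_of_nonempty hne h3
  rw [← Finset.mul_sum, ← Finset.sum_mul, Finset.sum_const, smul_eq_mul,
    ← Set.ncard_eq_toFinset_card C hfin] at h4
  have h5 : M * (G.ncard * t) < M * T :=
    (Nat.mul_le_mul_left _ (Nat.mul_le_mul_right _ h2)).trans_lt
      (h4.trans_le (Nat.mul_le_mul_right _ hcard))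
  exact absurd (Nat.mul_le_mul_left M h1) (not_le.2 h5)

/-- The index of `GL_m(q ^ r)` in `GL_{rm}(q)` as a product. -/
theorem frameCard_mul_prod (q r m : ℕ) (hr : 0 < r) :
    frameCard (q ^ r) m m *
      ∏ i ∈ (Finset.range (r * m)).filter (fun i => ¬ r ∣ i), (q ^ (r * m) - q ^ i) =
    frameCard q (r * m) (r * m) := by
  rw [frameCard, frameCard, ← Finset.prod_filter_mul_prod_filter_not (Finset.range (r * m))
    (fun i => r ∣ i)]
  congr 1
  have : (Finset.range (r * m)).filter (fun i => r ∣ i) = (Finset.range m).image (r * ·) := by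
    ext i
    simp only [Finset.mem_filter, Finset.mem_range, Finset.mem_image]
    constructor
    · rintro ⟨h, j, rfl⟩
      exact ⟨j, Nat.lt_of_mul_lt_mul_left h, rfl⟩
    · rintro ⟨j, h, rfl⟩
      exact ⟨Nat.mul_lt_mul_of_pos_left h hr, j, rfl⟩
  rw [this, Finset.prod_image fun a _ b _ h => Nat.eq_of_mul_eq_mul_left hr h]
  simp_rw [← pow_mul]

theorem card_filter_not_dvd (r m : ℕ) (hr : 0 < r) :
    ((Finset.range (r * m)).filter (fun i => ¬ r ∣ i)).card = r * m - m := by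
  have h1 := Finset.card_filter_add_card_filter_not (s := Finset.range (r * m)) (fun i => r ∣ i)
  have : (Finset.range (r * m)).filter (fun i => r ∣ i) = (Finset.range m).image (r * ·) := by
    ext i
    simp only [Finset.mem_filter, Finset.mem_range, Finset.mem_image]
    constructor
    · rintro ⟨h, j, rfl⟩
      exact ⟨j, Nat.lt_of_mul_lt_mul_left h, rfl⟩
    · rintro ⟨j, h, rfl⟩
      exact ⟨Nat.mul_lt_mul_of_pos_left h hr, j, rfl⟩
  rw [this, Finset.card_image_of_injective _ fun a b h => Nat.eq_of_mul_eq_mul_left hr h,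
    Finset.card_range, Finset.card_range] at h1
  omega

theorem cardDistinctFactors_lt {d : ℕ} (hd : 0 < d) :
    ArithmeticFunction.cardDistinctFactors d < d := by
  rw [ArithmeticFunction.cardDistinctFactors_apply, ← List.card_toFinset]
  have : d.primeFactorsList.toFinset ⊆ Finset.Ioc 1 d := by
    intro p hp
    rw [List.mem_toFinset] at hp
    have h1 := Nat.prime_of_mem_primeFactorsList hp
    have h2 := Nat.le_of_dvd hd (Nat.dvd_of_mem_primeFactorsList hp)
    exact Finset.mem_Ioc.2 ⟨h1.one_lt, h2⟩
  have := Finset.card_le_card this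
  rw [Nat.card_Ioc] at this
  omega

/-- For `n ≥ 3` and `d < n - n / a`, where `a` is the least prime factor of `n`, the covering
number of `M_n(F)` exceeds `q ^ (n * d) + N + ω(d)` with `N` the number of `d`-dimensional
subspaces, unless `n = 3` and `q = 2`. -/
theorem add_one_le_coveringNumber_end {F V : Type*} [Field F] [Finite F] [AddCommGroup V]
    [Module F V] [FiniteDimensional F V] {n d : ℕ} (hV : finrank F V = n) (hn : 3 ≤ n)
    (hd0 : 0 < d) (hd : d < n - n / n.minFac) (h32 : ¬ (n = 3 ∧ Nat.card F = 2)) :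
    ((Nat.card F ^ (n * d) + subspaceCard F V d + ArithmeticFunction.cardDistinctFactors d + 1 :
      ℕ) : ℕ∞) ≤ coveringNumber (Module.End F V) := by
  have hq := two_le_natCard F
  have hdn : d ≤ finrank F V := by rw [hV]; have := Nat.sub_le n (n / n.minFac); omega
  have hω := cardDistinctFactors_lt hd0
  set w := ArithmeticFunction.cardDistinctFactors d
  have hN1 := subspaceCard_le_sub_one_pow F V hdn
  have hN2 := subspaceCard_le_four_mul_pow F V hdn
  set N := subspaceCard F V d
  refine lt_coveringNumber_end (by rw [hV]; omega) fun r hr hrn => ?_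
  rw [hV] at hrn hN1 hN2 ⊢
  set q := Nat.card F
  obtain ⟨m, rfl⟩ := hrn
  have hr0 : 0 < r := by omega
  rw [Nat.mul_div_cancel_left _ hr0, ← frameCard_mul_prod q r m hr0]
  have hm0 : 0 < m := Nat.pos_of_ne_zero fun h => by subst h; omega
  have hfpos : 0 < frameCard (q ^ r) m m :=
    frameCard_pos (hq.trans (Nat.le_self_pow hr0.ne' q)) le_rfl
  have h4 := pow_le_four_mul_prod hq (Finset.filter_subset (fun i => ¬ r ∣ i)
    (Finset.range (r * m)))
  rw [card_filter_not_dvd r m hr0] at h4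
  suffices hs : (q ^ (r * m * d) + N + w) * r <
      ∏ i ∈ (Finset.range (r * m)).filter (fun i => ¬ r ∣ i), (q ^ (r * m) - q ^ i) by
    calc _ = frameCard (q ^ r) m m * ((q ^ (r * m * d) + N + w) * r) := by ring
      _ < _ := Nat.mul_lt_mul_of_pos_left hs hfpos
  have hmin : (r * m).minFac ≤ r := Nat.minFac_le_of_dvd hr (dvd_mul_right r m)
  have hdiv : m ≤ r * m / (r * m).minFac := by
    calc m = r * m / r := (Nat.mul_div_cancel_left _ hr0).symm
      _ ≤ _ := Nat.div_le_div_left hmin (Nat.minFac_pos _)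
  have hdm : d + 1 ≤ r * m - m := by omega
  set Pr := ∏ i ∈ (Finset.range (r * m)).filter (fun i => ¬ r ∣ i), (q ^ (r * m) - q ^ i)
  set X := q ^ (r * m) with hX
  have hX8 : 2 ^ 3 ≤ X := (Nat.pow_le_pow_left hq 3).trans (Nat.pow_le_pow_right (by omega) hn)
  -- `N + ω(d) < X ^ d`
  have hNw : N + w < X ^ d := by
    obtain ⟨e, rfl⟩ : ∃ e, d = e + 1 := ⟨d - 1, by omega⟩
    have h1 : (X - 1) ^ e ≤ X ^ e := Nat.pow_le_pow_left (by omega) e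
    have h2 : (X - 1) ^ (e + 1) ≤ X ^ e * (X - 1) := by
      rw [pow_succ]; exact Nat.mul_le_mul_right _ h1
    have h3 : e < X ^ e := Nat.lt_pow_self (by omega)
    have h5 : X ^ e * (X - 1) + X ^ e = X ^ (e + 1) := by
      rw [pow_succ, ← Nat.mul_succ]; congr 1; omega
    omega
  have hpm : q ^ (r * m * d) = X ^ d := by rw [hX, pow_mul]
  have hpm2 : q ^ (r * m * (r * m - m)) = X ^ (r * m - m) := by rw [hX, pow_mul]
  rw [hpm2] at h4
  rw [hpm]
  have hXd : 0 < X ^ d := pow_pos (by omega) d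
  -- `8 = 2 * 4`: a factor `2` from `X ^ d + N + w < 2 * X ^ d`, and a factor `4` from `h4`
  have main : 8 * r * X ^ d ≤ X ^ (r * m - m) → (X ^ d + N + w) * r < Pr := by
    intro h
    have h5 : (X ^ d + N + w) * r < 2 * X ^ d * r := Nat.mul_lt_mul_of_pos_right (by omega) hr0
    have h6 : 4 * (2 * X ^ d * r) ≤ 4 * Pr := by
      calc 4 * (2 * X ^ d * r) = 8 * r * X ^ d := by ring
        _ ≤ _ := h.trans h4
    omega
  have main1 : 8 * r ≤ X → (X ^ d + N + w) * r < Pr := by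
    intro h
    refine main (le_trans ?_ (Nat.pow_le_pow_right (by omega) hdm))
    rw [pow_succ, mul_comm]
    exact Nat.mul_le_mul_left _ h
  have main2 : d + 2 ≤ r * m - m → 8 * r ≤ X ^ 2 → (X ^ d + N + w) * r < Pr := by
    intro h1 h
    refine main (le_trans ?_ (Nat.pow_le_pow_right (by omega) h1))
    rw [pow_add, mul_comm]
    exact Nat.mul_le_mul_left _ h
  have hrle : r ≤ r * m := Nat.le_mul_of_pos_right r hm0
  rcases Nat.lt_or_ge (r * m) 6 with h6 | h6
  · have h345 : r * m = 3 ∨ r * m = 4 ∨ r * m = 5 := by omega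
    rcases Nat.lt_or_ge q 3 with hq3 | hq3
    · have hq2 : q = 2 := by omega
      rcases h345 with h | h | h
      · exact absurd ⟨h, hq2⟩ h32
      · rw [h, hq2] at hX
        have h7 : (4 : ℕ).minFac = 2 := by norm_num
        rw [h, h7] at hd
        have hr4 : r = 2 ∨ r = 4 := by
          have : r ∣ 4 := ⟨m, h.symm⟩
          have : r ≤ 4 := by omega
          interval_cases r <;> omega
        rcases hr4 with rfl | rfl
        · exact main1 (by omega)
        · refine main2 (by omega) ?_
          rw [hX]; norm_num
      · have hr5 : r = 5 := ((Nat.dvd_prime (by norm_num)).1 ⟨m, h.symm⟩).resolve_left (by omega)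
        subst hr5
        obtain rfl : m = 1 := by omega
        rw [h, hq2] at hX
        rcases Nat.lt_or_ge d 3 with hd3 | hd3
        · refine main2 (by omega) ?_
          rw [hX]; norm_num
        · obtain rfl : d = 3 := by omega
          -- for `(n, q, d) = (5, 2, 3)` the factor `1 / 4` is too lossy, so `Pr` is computed:
          -- it is `(32 - 2) * (32 - 4) * (32 - 8) * (32 - 16)`
          have hPi : Pr = 322560 := by
            simp only [Pr, hq2]
            decide
          rw [hPi, hX]
          rw [hq2] at hN2
          norm_num at hN2 ⊢
          omega
    · refine main1 ?_
      have : 3 ^ (r * m) ≤ X := Nat.pow_le_pow_left hq3 _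
      rcases h345 with h | h | h <;> rw [h] at this <;> norm_num at this <;> omega
  · refine main1 ?_
    have h7 : 2 ^ (r * m) ≤ X := Nat.pow_le_pow_left hq _
    have h8 : ∀ k, 6 ≤ k → 8 * k ≤ 2 ^ k := by
      intro k hk
      induction k, hk using Nat.le_induction with
      | base => norm_num
      | succ k hk ih => rw [pow_succ]; omega
    have := h8 _ h6
    omega

/-! ### An upper bound for the covering number of a matrix ring -/

/-- The linear maps that preserve the subspace `U`. -/
def stabilizerSubring {F V : Type*} [Field F] [AddCommGroup V] [Module F V] (U : Submodule F V) :
    NonUnitalSubring (Module.End F V) where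
  carrier := {t | ∀ u ∈ U, t u ∈ U}
  mul_mem' := fun ha hb _ hu => ha _ (hb _ hu)
  add_mem' := fun ha hb _ hu => U.add_mem (ha _ hu) (hb _ hu)
  zero_mem' := fun _ _ => U.zero_mem
  neg_mem' := fun ha _ hu => U.neg_mem (ha _ hu)

theorem mem_stabilizerSubring {F V : Type*} [Field F] [AddCommGroup V] [Module F V]
    {U : Submodule F V} {t : Module.End F V} :
    t ∈ stabilizerSubring U ↔ ∀ u ∈ U, t u ∈ U := Iff.rfl

/-- A vector outside `U` can be moved to any other vector by a linear map that is zero on `U`. -/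
theorem exists_end_eq_of_notMem {F V : Type*} [Field F] [AddCommGroup V] [Module F V]
    {U : Submodule F V} {v : V} (hv : v ∉ U) (w : V) :
    ∃ t : Module.End F V, (∀ u ∈ U, t u = 0) ∧ t v = w := by
  obtain ⟨f, hf, hfU⟩ := U.exists_dual_map_eq_bot_of_notMem hv inferInstance
  have h0 : ∀ u ∈ U, f u = 0 := by
    intro u hu
    have : f u ∈ U.map f := ⟨u, hu, rfl⟩
    rwa [hfU, Submodule.mem_bot] at this
  refine ⟨LinearMap.toSpanSingleton F V ((f v)⁻¹ • w) ∘ₗ f, fun u hu => ?_, ?_⟩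
  · simp [h0 u hu]
  · simp [smul_smul, hf]

theorem stabilizerSubring_ne_top {F V : Type*} [Field F] [AddCommGroup V] [Module F V]
    {U : Submodule F V} (h0 : U ≠ ⊥) (h1 : U ≠ ⊤) : stabilizerSubring U ≠ ⊤ := by
  intro h
  obtain ⟨u, hu, hu0⟩ := Submodule.exists_mem_ne_zero_of_ne_bot h0
  obtain ⟨w, -, hw⟩ := SetLike.exists_of_lt (lt_top_iff_ne_top.2 h1)
  obtain ⟨t, -, ht⟩ := exists_end_eq_of_notMem (U := (⊥ : Submodule F V)) (v := u)
    (by simpa using hu0) w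
  have : t ∈ stabilizerSubring U := by rw [h]; trivial
  exact hw (ht ▸ this u hu)

/-- The linear maps commuting with `Y`. -/
def commutantSubring {F V : Type*} [Field F] [AddCommGroup V] [Module F V] (Y : Module.End F V) :
    NonUnitalSubring (Module.End F V) where
  carrier := {t | t * Y = Y * t}
  mul_mem' := fun {a b} (ha : a * Y = Y * a) (hb : b * Y = Y * b) => by
    change a * b * Y = Y * (a * b)
    rw [mul_assoc, hb, ← mul_assoc, ha, mul_assoc]
  add_mem' := fun {a b} (ha : a * Y = Y * a) (hb : b * Y = Y * b) => by
    change (a + b) * Y = Y * (a + b)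
    rw [add_mul, ha, hb, mul_add]
  zero_mem' := by
    change 0 * Y = Y * 0
    rw [zero_mul, mul_zero]
  neg_mem' := fun {a} (ha : a * Y = Y * a) => by
    change -a * Y = Y * -a
    rw [neg_mul, ha, mul_neg]

theorem mem_commutantSubring {F V : Type*} [Field F] [AddCommGroup V] [Module F V]
    {Y t : Module.End F V} : t ∈ commutantSubring Y ↔ t * Y = Y * t := Iff.rfl

theorem natCard_linearEquiv_le_frameCard (F M V : Type*) [Field F] [Finite F] [AddCommGroup V]
    [Module F V] [FiniteDimensional F V] [AddCommGroup M] [Module F M] [FiniteDimensional F M]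
    (h : finrank F M = finrank F V) :
    Nat.card (M ≃ₗ[F] V) ≤ frameCard (Nat.card F) (finrank F V) (finrank F V) := by
  have : Finite V := Module.finite_of_finite F
  rw [← natCard_linearIndependent (F := F) (V := V) le_rfl]
  let b := finBasisOfFinrankEq F M h
  refine Nat.card_le_card_of_injective
    (fun φ => ⟨fun i => φ (b i), b.linearIndependent.map' (φ : M →ₗ[F] V) φ.ker⟩)
    fun φ ψ hφψ => ?_
  refine LinearEquiv.toLinearMap_injective (b.ext fun i => ?_)
  exact congrFun (congrArg Subtype.val hφψ) i

/-- Multiplication by an element of an extension field on a vector space over the extension. -/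
abbrev smulEnd (F : Type*) {E : Type*} (M : Type*) [Field F] [Field E] [Algebra F E]
    [AddCommGroup M] [Module F M] [Module E M] [IsScalarTower F E M] (η : E) : Module.End F M :=
  Algebra.lsmul F F M η

/-- The size of the class of multiplications by a fixed generator `η` of an extension `E`, on `V`
turned into an `E`-space in all possible ways. -/
theorem frameCard_mul_ncard_conjSet_le {F V E : Type*} [Field F] [Finite F] [AddCommGroup V]
    [Module F V] [FiniteDimensional F V] [Field E] [Algebra F E] [FiniteDimensional F E]
    (η : E) {m : ℕ} (hm : finrank F E * m = finrank F V) :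
    frameCard (Nat.card E) m m * (conjSet V (smulEnd F (Fin m → E) η)).ncard ≤
      frameCard (Nat.card F) (finrank F V) (finrank F V) := by
  have : Finite V := Module.finite_of_finite F
  have : Finite E := Module.finite_of_finite F
  have := finite_end F V
  have hfr : finrank F (Fin m → E) = finrank F V := by
    rw [Module.finrank_pi_fintype, Finset.sum_const, Finset.card_univ, Fintype.card_fin, ← hm,
      smul_eq_mul, mul_comm]
  refine le_trans ?_ (natCard_linearEquiv_le_frameCard F (Fin m → E) V hfr)
  have h1 := frameCard_le_natCard_linearEquiv E (Fin m → E) (Fin m → E) rfl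
  rw [Module.finrank_fin_fun] at h1
  have := finite_linearEquiv F (Fin m → E) V
  have := finite_linearEquiv E (Fin m → E) (Fin m → E)
  refine (Nat.mul_le_mul_right _ h1).trans ?_
  rw [← Nat.card_coe_set_eq, ← Nat.card_prod]
  have hex : ∀ Y : conjSet V (smulEnd F (Fin m → E) η), ∃ φ : (Fin m → E) ≃ₗ[F] V,
    ∀ x, Y.1 (φ x) = φ (η • x) := fun Y => Y.2
  choose φ hφ using hex
  refine Nat.card_le_card_of_injective
    (fun z => (z.1.restrictScalars F).trans (φ z.2)) ?_
  rintro ⟨g, Y⟩ ⟨g', Y'⟩ h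
  have h2 : ∀ x, φ Y (g x) = φ Y' (g' x) := fun x => LinearEquiv.congr_fun h x
  have hY : Y = Y' := by
    refine Subtype.ext (LinearMap.ext fun v => ?_)
    obtain ⟨x, rfl⟩ := (g.toEquiv.trans (φ Y).toEquiv).surjective v
    change Y.1 (φ Y (g x)) = Y'.1 (φ Y (g x))
    rw [hφ, ← map_smul g, h2, map_smul, ← hφ, ← h2]
  subst hY
  refine Prod.ext (LinearEquiv.ext fun x => ?_) rfl
  exact (φ Y).injective (h2 x)

/-- Every linear map preserves a nonzero subspace of at most half the dimension, or generates a
field of order `|V|` and therefore commutes with every smaller extension `E` of the scalars. -/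
theorem mem_stabilizer_or_mem_commutant {F V E : Type*} [Field F] [Finite F] [AddCommGroup V]
    [Module F V] [FiniteDimensional F V] [Nontrivial V] [Field E] [Algebra F E]
    [FiniteDimensional F E] (η : E) {m : ℕ} (hm : finrank F E * m = finrank F V)
    (x : Module.End F V) :
    (∃ U : Submodule F V, 1 ≤ finrank F U ∧ finrank F U ≤ finrank F V / 2 ∧
      x ∈ stabilizerSubring U) ∨
    ∃ Y ∈ conjSet V (smulEnd F (Fin m → E) η), x ∈ commutantSubring Y := by
  have hint : IsIntegral F x := Algebra.IsIntegral.isIntegral x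
  by_cases hirr : Irreducible (minpoly F x)
  · have : Fact (Irreducible (minpoly F x)) := ⟨hirr⟩
    let A := AdjoinRoot (minpoly F x)
    let f : A →ₐ[F] Module.End F V :=
      Ideal.Quotient.liftₐ (Ideal.span {minpoly F x}) (Polynomial.aeval x) (by
        intro p hp
        obtain ⟨c, rfl⟩ := Ideal.mem_span_singleton'.1 hp
        rw [map_mul, minpoly.aeval, mul_zero])
    have hfx : f (AdjoinRoot.root _) = x := Polynomial.aeval_X x
    have : FiniteDimensional F A := (AdjoinRoot.powerBasis (minpoly.ne_zero hint)).finite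
    have : Finite A := Module.finite_of_finite F
    let : Module A V := Module.compHom V (f : A →+* Module.End F V)
    have hsmul : ∀ (a : A) (v : V), a • v = f a v := fun a v => rfl
    have : IsScalarTower F A V := ⟨fun c a v => by
      rw [hsmul, hsmul, map_smul]; rfl⟩
    have : Module.Finite A V := Module.Finite.of_restrictScalars_finite F A V
    have hmul : finrank F A * finrank A V = finrank F V := Module.finrank_mul_finrank F A V
    have hpos : 0 < finrank A V := Module.finrank_pos
    rcases Nat.lt_or_ge 1 (finrank A V) with h1 | h1
    · left
      obtain ⟨v, hv⟩ := exists_ne (0 : V)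
      have hU : finrank F (A ∙ v) = finrank F A := by
        rw [← Module.finrank_mul_finrank F A (A ∙ v), finrank_span_singleton hv, mul_one]
      refine ⟨(A ∙ v).restrictScalars F, ?_, ?_, fun u hu => ?_⟩
      · change 1 ≤ finrank F (A ∙ v)
        rw [hU]
        exact Module.finrank_pos
      · change finrank F (A ∙ v) ≤ _
        rw [hU, Nat.le_div_iff_mul_le (by norm_num), ← hmul]
        exact Nat.mul_le_mul_left _ h1
      · have hxu : x u = f (AdjoinRoot.root _) u := (LinearMap.congr_fun hfx u).symm
        rw [hxu]
        exact (A ∙ v).smul_mem _ hu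
    · right
      have hA : finrank F A = finrank F V := by rw [← hmul, show finrank A V = 1 by omega, mul_one]
      obtain ⟨ψ⟩ := FiniteField.nonempty_algHom_of_finrank_dvd (F := F) (K := E) (L := A)
        (by rw [hA, ← hm]; exact dvd_mul_right _ _)
      let g : E →ₐ[F] Module.End F V := f.comp ψ
      let : Module E V := Module.compHom V (g : E →+* Module.End F V)
      have hsmulE : ∀ (a : E) (v : V), a • v = g a v := fun a v => rfl
      have : IsScalarTower F E V := ⟨fun c a v => by
        rw [hsmulE, hsmulE, map_smul]; rfl⟩
      have : Module.Finite E V := Module.Finite.of_restrictScalars_finite F E V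
      have hmulE : finrank F E * finrank E V = finrank F V := Module.finrank_mul_finrank F E V
      have hmE : finrank E V = m := by
        rw [← hm] at hmulE
        exact Nat.eq_of_mul_eq_mul_left Module.finrank_pos hmulE
      let φ : (Fin m → E) ≃ₗ[E] V := LinearEquiv.ofFinrankEq _ _ (by
        rw [Module.finrank_fin_fun, hmE])
      refine ⟨g η, ⟨φ.restrictScalars F, fun y => ?_⟩, ?_⟩
      · exact (φ.map_smul η y).symm
      · have key : f (AdjoinRoot.root _) * f (ψ η) = f (ψ η) * f (AdjoinRoot.root _) := by
          rw [← map_mul, mul_comm, map_mul]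
        rw [hfx] at key
        exact key
  · left
    have hmonic := minpoly.monic hint
    have hne1 : minpoly F x ≠ 1 := minpoly.ne_one F x
    obtain ⟨a, b, hab⟩ : ∃ a b : Polynomial F, minpoly F x = a * b ∧ ¬ IsUnit a ∧ ¬ IsUnit b := by
      by_contra! h
      refine hirr ⟨fun hu => hne1 (hmonic.eq_one_of_isUnit hu), fun a b hab => ?_⟩
      by_contra! h'
      exact h'.2 (h a b hab h'.1)
    obtain ⟨hab, hau, hbu⟩ := hab
    have hab0 : a * b ≠ 0 := hab ▸ minpoly.ne_zero hint
    have ha0 : a ≠ 0 := left_ne_zero_of_mul hab0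
    have hb0 : b ≠ 0 := right_ne_zero_of_mul hab0
    have hdeg : (minpoly F x).natDegree = a.natDegree + b.natDegree := by
      rw [hab, Polynomial.natDegree_mul ha0 hb0]
    have hda : 0 < a.natDegree := Polynomial.natDegree_pos_iff_degree_pos.2
      (Polynomial.degree_pos_of_ne_zero_of_nonunit ha0 hau)
    have hdb : 0 < b.natDegree := Polynomial.natDegree_pos_iff_degree_pos.2
      (Polynomial.degree_pos_of_ne_zero_of_nonunit hb0 hbu)
    have hne : ∀ c : Polynomial F, c ≠ 0 → c.natDegree < (minpoly F x).natDegree →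
        Polynomial.aeval x c ≠ 0 := by
      intro c hc hlt h0
      have := Polynomial.natDegree_le_of_dvd (minpoly.dvd F x h0) hc
      omega
    set t := Polynomial.aeval x a with ht
    have hcomm : ∀ v, t (x v) = x (t v) := by
      intro v
      have h1 : x * t = t * x := by
        have := Polynomial.aeval_X (R := F) x
        conv_lhs => rw [← this, ht, ← map_mul, mul_comm, map_mul, this]
      exact (LinearMap.congr_fun h1 v).symm
    have hker : LinearMap.ker t ≠ ⊥ := by
      intro h
      refine hne b hb0 (by omega) (LinearMap.ext fun v => ?_)
      have h2 : t * Polynomial.aeval x b = 0 := by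
        rw [ht, ← map_mul, ← hab, minpoly.aeval]
      have h3 : Polynomial.aeval x b v ∈ LinearMap.ker t := by
        rw [LinearMap.mem_ker]
        exact LinearMap.congr_fun h2 v
      rwa [h, Submodule.mem_bot] at h3
    have hrange : LinearMap.range t ≠ ⊥ := by
      intro h
      exact hne a ha0 (by omega) (LinearMap.range_eq_bot.1 h)
    have hsum := LinearMap.finrank_range_add_finrank_ker t
    have h1 : 1 ≤ finrank F (LinearMap.ker t) := Submodule.one_le_finrank_iff.2 hker
    have h2 : 1 ≤ finrank F (LinearMap.range t) := Submodule.one_le_finrank_iff.2 hrange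
    rcases Nat.le_total (finrank F (LinearMap.ker t)) (finrank F (LinearMap.range t)) with h | h
    · refine ⟨LinearMap.ker t, h1, by omega, fun u hu => ?_⟩
      rw [LinearMap.mem_ker] at hu ⊢
      rw [hcomm, hu, map_zero]
    · refine ⟨LinearMap.range t, h2, by omega, ?_⟩
      rintro _ ⟨v, rfl⟩
      exact ⟨x v, hcomm v⟩

theorem commutantSubring_ne_top {F V : Type*} [Field F] [AddCommGroup V] [Module F V]
    {Y : Module.End F V} (hY : ∀ c : F, Y ≠ c • 1) : commutantSubring Y ≠ ⊤ := by
  intro h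
  obtain ⟨c, hc', hc⟩ := (Module.End.mem_subalgebraCenter_iff (R := F) (S := F) (f := Y)).1
    (Subalgebra.mem_center_iff.2 fun t => by
      have : t ∈ commutantSubring Y := by rw [h]; trivial
      exact this)
  exact hY c (LinearMap.ext fun v => by rw [hc]; rfl)

/-- The Frobenius conjugate of a linear map that generates an extension field has the same
commutant, so the commutants are at most half as many as the maps. -/
theorem two_mul_ncard_image_commutantSubring_le {F V E : Type*} [Field F] [Finite F]
    [AddCommGroup V] [Module F V] [FiniteDimensional F V] [Field E] [Algebra F E]
    [FiniteDimensional F E] {η : E} (hη : η ^ Nat.card F ≠ η) {m : ℕ} (hm0 : 0 < m) :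
    2 * (commutantSubring '' conjSet V (smulEnd F (Fin m → E) η)).ncard ≤
      (conjSet V (smulEnd F (Fin m → E) η)).ncard := by
  classical
  have := Fintype.ofFinite F
  have := finite_end F V
  have : Finite E := Module.finite_of_finite F
  set S := conjSet V (smulEnd F (Fin m → E) η) with hS
  set q := Nat.card F with hq
  have hpow : ∀ Y : Module.End F V, ∀ φ : (Fin m → E) ≃ₗ[F] V, (∀ x, Y (φ x) = φ (η • x)) →
      ∀ k x, (Y ^ k) (φ x) = φ (η ^ k • x) := by
    intro Y φ hφ k
    induction k with
    | zero => simp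
    | succ k ih =>
      intro x
      rw [pow_succ, Module.End.mul_apply, hφ, ih, smul_smul, pow_succ]
  have key : ∀ Y ∈ S, Y ^ q ∈ S ∧ Y ^ q ≠ Y ∧ commutantSubring (Y ^ q) = commutantSubring Y := by
    rintro Y ⟨φ, hφ⟩
    have hφ' : ∀ x, Y (φ x) = φ (η • x) := hφ
    refine ⟨?_, ?_, ?_⟩
    · let σ := FiniteField.frobeniusAlgEquivOfAlgebraic F E
      have hσ : ∀ x, σ x = x ^ q := fun x => by
        rw [hq, Nat.card_eq_fintype_card]; rfl
      refine ⟨(LinearEquiv.piCongrRight fun _ => σ.toLinearEquiv).trans φ, fun x => ?_⟩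
      simp only [LinearEquiv.trans_apply]
      rw [hpow Y φ hφ']
      congr 1
      funext i
      change η ^ q * σ (x i) = σ (η * x i)
      rw [map_mul, hσ η]
    · intro h
      have h1 := LinearMap.congr_fun h (φ (fun _ => 1))
      rw [hpow Y φ hφ', hφ'] at h1
      have h2 := congrFun (φ.injective h1) ⟨0, hm0⟩
      simp only [Pi.smul_apply, smul_eq_mul, mul_one] at h2
      exact hη h2
    · have hback : (Y ^ q) ^ (q ^ (finrank F E - 1)) = Y := by
        rw [← pow_mul, ← pow_succ', Nat.sub_add_cancel Module.finrank_pos, hq,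
          ← Module.natCard_eq_pow_finrank (K := F) (V := E)]
        refine LinearMap.ext fun v => ?_
        obtain ⟨x, rfl⟩ := φ.surjective v
        have := Fintype.ofFinite E
        rw [hpow Y φ hφ', hφ', Nat.card_eq_fintype_card, FiniteField.pow_card]
      ext t
      rw [mem_commutantSubring, mem_commutantSubring]
      constructor
      · intro h
        have := (show Commute t (Y ^ q) from h).pow_right (q ^ (finrank F E - 1))
        rwa [hback] at this
      · intro h
        exact (show Commute t Y from h).pow_right q
  have hfin : S.Finite := Set.toFinite _
  have h := Finset.mul_card_image_le_card (f := commutantSubring) hfin.toFinset 2 (by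
    intro b hb
    obtain ⟨Y, hY, rfl⟩ := Finset.mem_image.1 hb
    rw [Set.Finite.mem_toFinset] at hY
    obtain ⟨h1, h2, h3⟩ := key Y hY
    refine Finset.one_lt_card.2 ⟨Y ^ q, ?_, Y, ?_, h2⟩
    · simpa using ⟨h1, h3⟩
    · simpa using hY)
  rw [Set.ncard_eq_toFinset_card _ hfin]
  convert h using 2
  rw [← Set.ncard_coe_finset, Finset.coe_image, Set.Finite.coe_toFinset]

theorem two_mul_sum_subspaceCard_le (F V : Type*) [Field F] [Finite F] [AddCommGroup V]
    [Module F V] [FiniteDimensional F V] {h : ℕ} (h2 : 2 ≤ h) (hh : h ≤ finrank F V) :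
    2 * ∑ k ∈ Finset.Icc 1 h, subspaceCard F V k ≤ (Nat.card F ^ finrank F V) ^ h := by
  have hX : 4 ≤ Nat.card F ^ finrank F V :=
    (Nat.pow_le_pow_left (two_le_natCard F) 2).trans
      (Nat.pow_le_pow_right (by have := two_le_natCard F; omega) (h2.trans hh))
  induction h, h2 using Nat.le_induction with
  | base =>
    rw [show Finset.Icc 1 2 = {1, 2} from rfl, Finset.sum_pair (by norm_num)]
    have h1 := subspaceCard_le_sub_one_pow F V (k := 1) (by omega)
    have h2 := three_mul_subspaceCard_le F V le_rfl hh
    obtain ⟨Y, hY⟩ : ∃ Y, Nat.card F ^ finrank F V = Y + 1 :=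
      ⟨_, (Nat.sub_add_cancel (by omega)).symm⟩
    rw [hY, Nat.add_sub_cancel] at h1 h2
    rw [hY] at hX ⊢
    nlinarith
  | succ k hk ih =>
    rw [← Finset.insert_Icc_right_eq_Icc_add_one (by omega), Finset.sum_insert (by simp)]
    have h1 := ih (by omega)
    have h2 := three_mul_subspaceCard_le F V (by omega) hh
    obtain ⟨Y, hY⟩ : ∃ Y, Nat.card F ^ finrank F V = Y + 1 :=
      ⟨_, (Nat.sub_add_cancel (by omega)).symm⟩
    rw [hY, Nat.add_sub_cancel] at h2
    rw [hY] at hX h1 ⊢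
    have h3 : Y ^ (k + 1) ≤ (Y + 1) ^ k * Y := by
      rw [pow_succ]; exact Nat.mul_le_mul_right _ (Nat.pow_le_pow_left (by omega) _)
    have h4 : (Y + 1) ^ k * 3 ≤ (Y + 1) ^ k * Y := Nat.mul_le_mul_left _ (by omega)
    rw [pow_succ, mul_add, mul_add]
    omega

theorem coveringNumber_end_le {F V : Type*} [Field F] [Finite F] [AddCommGroup V]
    [Module F V] [FiniteDimensional F V] (hn : 2 ≤ finrank F V) :
    coveringNumber (Module.End F V) ≤
      (((Nat.card F ^ finrank F V) ^ (finrank F V - finrank F V / (finrank F V).minFac) : ℕ) :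
        ℕ∞) := by
  classical
  set n := finrank F V with hnV
  set a := n.minFac with ha
  set q := Nat.card F with hq
  have hq2 : 2 ≤ q := two_le_natCard F
  have hap : a.Prime := Nat.minFac_prime (by omega)
  have : NeZero a := ⟨hap.ne_zero⟩
  obtain ⟨m, hm⟩ : a ∣ n := Nat.minFac_dvd n
  have hm0 : 0 < m := Nat.pos_of_ne_zero fun h => by rw [h] at hm; omega
  have hna : n / a = m := by rw [hm, Nat.mul_div_cancel_left _ hap.pos]
  have hnm : m * 2 ≤ n := by rw [hm, mul_comm]; exact Nat.mul_le_mul_right _ hap.two_le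
  rw [hna]
  have : Nontrivial V := Module.nontrivial_of_finrank_pos (R := F) (by omega)
  have : Finite V := Module.finite_of_finite F
  have := finite_end F V
  obtain ⟨p, hp⟩ := CharP.exists F
  have : Fact p.Prime := ⟨CharP.char_is_prime F p⟩
  let E := FiniteField.Extension F p a
  have hE : finrank F E = a := FiniteField.finrank_extension F p a
  have hEcard : Nat.card E = q ^ a := FiniteField.natCard_extension F p a
  obtain ⟨η, hη⟩ : ∃ η : E, η ^ q ≠ η := by
    by_contra! h
    have h1 := card_le_of_forall_pow_eq (by omega) h
    rw [hEcard] at h1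
    have := Nat.pow_lt_pow_right (show 1 < q by omega) hap.one_lt
    rw [pow_one] at this
    omega
  set S := conjSet V (smulEnd F (Fin m → E) η) with hS
  have h𝒴 := two_mul_ncard_image_commutantSubring_le (V := V) hη hm0
  rw [← hS] at h𝒴
  have hScard : S.ncard ≤ ∏ i ∈ (Finset.range (a * m)).filter (fun i => ¬ a ∣ i),
      (q ^ (a * m) - q ^ i) := by
    have h1 := frameCard_mul_ncard_conjSet_le (V := V) η (m := m) (by rw [hE, ← hm])
    rw [hEcard, ← hnV, hm, ← frameCard_mul_prod q a m hap.pos] at h1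
    exact Nat.le_of_mul_le_mul_left h1
      (frameCard_pos (le_trans hq2 (Nat.le_self_pow hap.ne_zero q)) le_rfl)
  let 𝒰 : Set (NonUnitalSubring (Module.End F V)) :=
    stabilizerSubring '' {U | finrank F U ∈ Finset.Icc 1 (n / 2)}
  have hcover : IsRingCover (𝒰 ∪ commutantSubring '' S) := by
    refine ⟨?_, fun x => ?_⟩
    · rintro _ (⟨U, hU, rfl⟩ | ⟨Y, ⟨φ, hφ⟩, rfl⟩)
      · have hU : 1 ≤ finrank F U ∧ finrank F U ≤ n / 2 := Finset.mem_Icc.1 hU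
        refine stabilizerSubring_ne_top (fun h => ?_) (fun h => ?_)
        · rw [h, finrank_bot] at hU; omega
        · rw [h, finrank_top] at hU; omega
      · refine commutantSubring_ne_top fun c hc => hη ?_
        have h1 := hφ fun _ => 1
        rw [hc, LinearMap.smul_apply, Module.End.one_apply, ← map_smul] at h1
        have h2 := congrFun (φ.injective h1) ⟨0, hm0⟩
        change c • (1 : E) = η * 1 at h2
        rw [mul_one] at h2
        rw [← h2, smul_pow, one_pow, hq]
        have := Fintype.ofFinite F
        rw [Nat.card_eq_fintype_card, FiniteField.pow_card]
    · rcases mem_stabilizer_or_mem_commutant η (m := m) (by rw [hE, ← hm]) x with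
        ⟨U, h1, h2, h3⟩ | ⟨Y, hY, h3⟩
      · exact ⟨_, Or.inl ⟨U, Finset.mem_Icc.2 ⟨h1, h2⟩, rfl⟩, h3⟩
      · exact ⟨_, Or.inr ⟨Y, hY, rfl⟩, h3⟩
  have : Finite (Submodule F V) := inferInstance
  have h𝒰 : 𝒰.ncard ≤ ∑ k ∈ Finset.Icc 1 (n / 2), subspaceCard F V k := by
    refine (Set.ncard_image_le (Set.toFinite _)).trans ?_
    have := Set.ncard_le_sum_ncard_inter (s := Finset.Icc 1 (n / 2))
      (f := fun k => {U : Submodule F V | finrank F U = k})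
      (G := {U : Submodule F V | finrank F U ∈ Finset.Icc 1 (n / 2)}) fun U hU => ⟨_, hU, rfl⟩
    refine this.trans (Finset.sum_le_sum fun k _ => ?_)
    exact Set.ncard_le_ncard Set.inter_subset_left (Set.toFinite _)
  have hfin : Set.Finite (𝒰 ∪ commutantSubring '' S) :=
    ((Set.toFinite _).image _).union ((Set.toFinite _).image _)
  refine (coveringNumber_le_of_isRingCover hcover).trans ?_
  rw [← hfin.cast_ncard_eq, Nat.cast_le]
  refine (Set.ncard_union_le _ _).trans ?_
  have hpos : 0 < q ^ n := by positivity
  -- the class of multiplications never exceeds `|V| ^ (n - n / a)`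
  have hScard' : S.ncard ≤ (q ^ n) ^ (n - m) := by
    refine hScard.trans ?_
    have h1 := Finset.prod_le_pow_card ((Finset.range (a * m)).filter (fun i => ¬ a ∣ i))
      (fun i => q ^ (a * m) - q ^ i) (q ^ n) fun i _ => by rw [← hm]; exact Nat.sub_le _ _
    rw [card_filter_not_dvd _ _ hap.pos] at h1
    rw [← hm] at h1 ⊢
    exact h1
  rcases Nat.lt_or_ge 3 n with h4 | h3
  · have h1 := two_mul_sum_subspaceCard_le F V (h := n / 2) (by omega) (by omega)
    have h2 : (q ^ n) ^ (n / 2) ≤ (q ^ n) ^ (n - m) := Nat.pow_le_pow_right hpos (by omega)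
    rw [← hnV, ← hq] at h1
    omega
  · have hN := subspaceCard_le_sub_one_pow F V (k := 1) (by omega)
    rw [← hnV, ← hq, pow_one] at hN
    have hhalf : n / 2 = 1 := by omega
    have hm1 : m = 1 := by omega
    rw [hhalf, Finset.Icc_self, Finset.sum_singleton] at h𝒰
    rcases Nat.lt_or_ge 2 n with h3' | h2'
    · have hn3 : n = 3 := by omega
      rw [hn3, hm1] at hScard' ⊢
      rw [hn3] at hN
      have : 8 ≤ q ^ 3 := Nat.pow_le_pow_left hq2 3
      obtain ⟨Y, hY⟩ : ∃ Y, q ^ 3 = Y + 1 := ⟨_, (Nat.sub_add_cancel (by omega)).symm⟩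
      rw [hY] at hN hScard' this ⊢
      norm_num at hN hScard' ⊢
      nlinarith
    · have hn2 : n = 2 := by omega
      have ha2 : a = 2 := by rw [ha, hn2]; rfl
      have h1 := subspaceCard_mul_frameCard F V (k := 1) (by omega)
      rw [← hnV, ← hq, hn2, frameCard, frameCard, Finset.prod_range_one, Finset.prod_range_one,
        pow_one, pow_zero] at h1
      rw [ha2, hm1, show (Finset.range (2 * 1)).filter (fun i => ¬ 2 ∣ i) = {1} by decide,
        Finset.prod_singleton] at hScard
      rw [hn2, hm1]
      obtain ⟨Y, hY⟩ : ∃ Y, q = Y + 1 := ⟨_, (Nat.sub_add_cancel (by omega)).symm⟩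
      have h5 : subspaceCard F V 1 = Y + 2 := by
        rw [hY] at h1
        refine Nat.eq_of_mul_eq_mul_right (show 0 < Y by omega) ?_
        rw [Nat.add_sub_cancel] at h1
        rw [h1]
        refine Nat.sub_eq_of_eq_add ?_
        ring
      have h6 : q ^ (2 * 1) - q ^ 1 = Y * (Y + 1) := by
        rw [hY]
        refine Nat.sub_eq_of_eq_add ?_
        ring
      rw [h6] at hScard
      rw [h5] at h𝒰
      rw [hY, show 2 - 1 = 1 from rfl, pow_one]
      nlinarith

/-! ### Linear maps with two invariant subspaces -/

theorem exists_linearEquiv_map_eq {F V : Type*} [Field F] [AddCommGroup V] [Module F V]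
    [FiniteDimensional F V] {U U' : Submodule F V}
    (h : finrank F U = finrank F U') : ∃ g : V ≃ₗ[F] V, ∀ v, g v ∈ U' ↔ v ∈ U := by
  obtain ⟨C, hC⟩ := U.exists_isCompl
  obtain ⟨C', hC'⟩ := U'.exists_isCompl
  have h1 := Submodule.finrank_add_eq_of_isCompl hC
  have h2 := Submodule.finrank_add_eq_of_isCompl hC'
  let e₁ := LinearEquiv.ofFinrankEq U U' h
  let e₂ : C ≃ₗ[F] C' := LinearEquiv.ofFinrankEq C C' (by omega)
  let g := ((U.prodEquivOfIsCompl C hC).symm.trans (e₁.prodCongr e₂)).trans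
    (U'.prodEquivOfIsCompl C' hC')
  have hg : ∀ x : U × C, g (x.1 + x.2) = e₁ x.1 + e₂ x.2 := by
    intro x
    have : (x.1 : V) + x.2 = U.prodEquivOfIsCompl C hC x := by simp
    rw [this]
    simp [g]
  have hsub : ∀ v ∈ U, g v ∈ U' := by
    intro v hv
    have := hg (⟨v, hv⟩, 0)
    simp only [ZeroMemClass.coe_zero, add_zero, map_zero] at this
    rw [this]
    exact (e₁ _).2
  have hmap : U.map (g : V →ₗ[F] V) = U' := by
    refine Submodule.eq_of_le_of_finrank_eq ?_ (by rw [LinearEquiv.finrank_map_eq, h])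
    rintro _ ⟨v, hv, rfl⟩
    exact hsub v hv
  refine ⟨g, fun v => ⟨fun hv => ?_, hsub v⟩⟩
  rw [← hmap] at hv
  obtain ⟨u, hu, huv⟩ := hv
  exact g.injective huv ▸ hu

section PairClass

variable {F L₁ L₂ V : Type*} [Field F] [Finite F] [Field L₁] [Algebra F L₁]
  [FiniteDimensional F L₁] [Field L₂] [Algebra F L₂] [FiniteDimensional F L₂] [AddCommGroup V]
  [Module F V]

theorem finrank_dvd_of_forall_pow_eq {k : ℕ} (h : ∀ x : L₂, x ^ Nat.card F ^ k = x) :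
    finrank F L₂ ∣ k := by
  have := Fintype.ofFinite F
  have : Finite L₂ := Module.finite_of_finite F
  rw [← FiniteField.orderOf_frobeniusAlgHom F L₂]
  refine orderOf_dvd_of_pow_eq_one (AlgHom.ext fun x => ?_)
  rw [AlgHom.coe_pow, FiniteField.coe_frobeniusAlgHom, pow_iterate, ← Nat.card_eq_fintype_card]
  exact h x

/-- The power `(b, γ) ^ |L₁| - (b, γ)` is a nonzero element of `0 × L₂`, and its products with the
powers of `(b, γ)` fill `0 × L₂`. -/
theorem zero_prod_mem {S : NonUnitalSubring (L₁ × L₂)} {b : L₁} {γ : L₂}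
    (hγ : ∀ x : L₂, x ≠ 0 → ∃ k : ℕ, x = γ ^ (k + 1)) (hdvd : ¬ finrank F L₂ ∣ finrank F L₁)
    (h : (b, γ) ∈ S) (c : L₂) : ((0 : L₁), c) ∈ S := by
  have : Finite L₁ := Module.finite_of_finite F
  have := Fintype.ofFinite L₁
  have hcard : Nat.card L₁ = Nat.card F ^ finrank F L₁ := Module.natCard_eq_pow_finrank
  have hcard0 : Nat.card L₁ - 1 + 1 = Nat.card L₁ := Nat.sub_add_cancel Nat.card_pos
  set β := γ ^ Nat.card L₁ - γ with hβ
  have hβ0 : β ≠ 0 := by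
    intro h0
    refine hdvd (finrank_dvd_of_forall_pow_eq fun x => ?_)
    rw [← hcard]
    rcases eq_or_ne x 0 with rfl | hx
    · exact zero_pow Nat.card_pos.ne'
    · obtain ⟨k, rfl⟩ := hγ x hx
      rw [← pow_mul, mul_comm, pow_mul, sub_eq_zero.1 h0]
  have h1 : ((0 : L₁), β) ∈ S := by
    have h2 := S.sub_mem (S.pow_succ_mem h (Nat.card L₁ - 1)) h
    rw [hcard0] at h2
    have h3 : (b, γ) ^ Nat.card L₁ - (b, γ) = ((0 : L₁), β) := by
      ext
      · simp [Nat.card_eq_fintype_card, FiniteField.pow_card]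
      · simp [hβ]
    rwa [h3] at h2
  rcases eq_or_ne c 0 with rfl | hc
  · exact S.zero_mem
  · obtain ⟨k, hk⟩ := hγ (c / β) (div_ne_zero hc hβ0)
    have h2 := S.mul_mem h1 (S.pow_succ_mem h k)
    rwa [Prod.pow_mk, Prod.mk_mul_mk, zero_mul, ← hk, mul_div_cancel₀ _ hβ0] at h2

theorem adjoin_pair_eq_top {b : L₁} {γ : L₂} (hb : Algebra.adjoin F {b} = ⊤)
    (hγ : ∀ x : L₂, x ≠ 0 → ∃ k : ℕ, x = γ ^ (k + 1)) (hdvd : ¬ finrank F L₂ ∣ finrank F L₁) :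
    Algebra.adjoin F {(b, γ)} = ⊤ := by
  set S := Algebra.adjoin F {(b, γ)} with hS
  have hbγ : (b, γ) ∈ S := Algebra.self_mem_adjoin_singleton F _
  have h2 : ∀ c : L₂, ((0 : L₁), c) ∈ S :=
    zero_prod_mem (S := S.toSubring.toNonUnitalSubring) hγ hdvd hbγ
  have h10 : ((1 : L₁), (0 : L₂)) ∈ S := by
    have := S.sub_mem S.one_mem (h2 1)
    rwa [show (1 : L₁ × L₂) - (0, 1) = (1, 0) by ext <;> simp] at this
  have h1 : ∀ c : L₁, (c, (0 : L₂)) ∈ S := by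
    intro c
    have hc : c ∈ Algebra.adjoin F {b} := by rw [hb]; trivial
    induction hc using Algebra.adjoin_induction with
    | mem x hx =>
      rw [Set.mem_singleton_iff] at hx
      have := S.sub_mem hbγ (h2 γ)
      simpa [hx] using this
    | algebraMap r =>
      have := S.smul_mem h10 r
      simpa [Algebra.algebraMap_eq_smul_one] using this
    | add x y _ _ hx hy => simpa using S.add_mem hx hy
    | mul x y _ _ hx hy => simpa using S.mul_mem hx hy
  refine eq_top_iff.2 fun x _ => ?_
  simpa using S.add_mem (h1 x.1) (h2 x.2)

theorem eq_of_stable_prod {b : L₁} {γ : L₂} (hb : Algebra.adjoin F {b} = ⊤)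
    (hγ : ∀ x : L₂, x ≠ 0 → ∃ k : ℕ, x = γ ^ (k + 1)) (hdvd : ¬ finrank F L₂ ∣ finrank F L₁)
    {U : Submodule F (L₁ × L₂)} (hU : ∀ u ∈ U, (b, γ) * u ∈ U) :
    U = ⊥ ∨ U = ⊤ ∨ U = LinearMap.range (LinearMap.inl F L₁ L₂) ∨
      U = LinearMap.range (LinearMap.inr F L₁ L₂) := by
  have hmul : ∀ x, ∀ u ∈ U, x * u ∈ U := by
    intro x
    have hx : x ∈ Algebra.adjoin F {(b, γ)} := by
      rw [adjoin_pair_eq_top hb hγ hdvd]; trivial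
    induction hx using Algebra.adjoin_induction with
    | mem x hx => rw [Set.mem_singleton_iff] at hx; rwa [hx]
    | algebraMap r =>
      intro u hu
      rw [← Algebra.smul_def]
      exact U.smul_mem r hu
    | add x y _ _ hx hy =>
      intro u hu
      rw [add_mul]
      exact U.add_mem (hx u hu) (hy u hu)
    | mul x y _ _ hx hy =>
      intro u hu
      rw [mul_assoc]
      exact hx _ (hy u hu)
  have h1 : (∀ u ∈ U, u.1 = 0) ∨ ∀ c, (c, (0 : L₂)) ∈ U := by
    by_contra! h
    obtain ⟨⟨u, hu, hu0⟩, c, hc⟩ := h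
    have := hmul (c / u.1, 0) u hu
    rw [show (c / u.1, (0 : L₂)) * u = (c, 0) by ext <;> simp [hu0]] at this
    exact hc this
  have h2 : (∀ u ∈ U, u.2 = 0) ∨ ∀ c, ((0 : L₁), c) ∈ U := by
    by_contra! h
    obtain ⟨⟨u, hu, hu0⟩, c, hc⟩ := h
    have := hmul (0, c / u.2) u hu
    rw [show ((0 : L₁), c / u.2) * u = (0, c) by ext <;> simp [hu0]] at this
    exact hc this
  rcases h1 with h1 | h1 <;> rcases h2 with h2 | h2
  · exact Or.inl (eq_bot_iff.2 fun u hu => Prod.ext (h1 u hu) (h2 u hu))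
  · refine Or.inr (Or.inr (Or.inr
      (le_antisymm (fun u hu => ⟨u.2, Prod.ext (h1 u hu).symm rfl⟩) ?_)))
    rintro _ ⟨c, rfl⟩
    exact h2 c
  · refine Or.inr (Or.inr (Or.inl
      (le_antisymm (fun u hu => ⟨u.1, Prod.ext rfl (h2 u hu).symm⟩) ?_)))
    rintro _ ⟨c, rfl⟩
    exact h1 c
  · refine Or.inr (Or.inl (eq_top_iff.2 fun u _ => ?_))
    simpa using U.add_mem (h1 u.1) (h2 u.2)

/-- A linear map acting as `b` on `L₁` and as `γ` on `L₂` has only two proper nonzero invariant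
subspaces. -/
theorem eq_of_stable_conjSet_pair {b : L₁} {γ : L₂} (hb : Algebra.adjoin F {b} = ⊤)
    (hγ : ∀ x : L₂, x ≠ 0 → ∃ k : ℕ, x = γ ^ (k + 1)) (hdvd : ¬ finrank F L₂ ∣ finrank F L₁)
    {A : Module.End F V} (hA : A ∈ conjSet V (mulEnd F (b, γ))) :
    ∃ U₁ U₂ : Submodule F V, finrank F U₁ = finrank F L₁ ∧ finrank F U₂ = finrank F L₂ ∧
      ∀ U : Submodule F V, (∀ u ∈ U, A u ∈ U) → U = ⊥ ∨ U = ⊤ ∨ U = U₁ ∨ U = U₂ := by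
  obtain ⟨φ, hφ⟩ := hA
  refine ⟨(LinearMap.range (LinearMap.inl F L₁ L₂)).map (φ : L₁ × L₂ →ₗ[F] V),
    (LinearMap.range (LinearMap.inr F L₁ L₂)).map (φ : L₁ × L₂ →ₗ[F] V), ?_, ?_, fun U hU => ?_⟩
  · rw [LinearEquiv.finrank_map_eq, LinearMap.finrank_range_of_inj LinearMap.inl_injective]
  · rw [LinearEquiv.finrank_map_eq, LinearMap.finrank_range_of_inj LinearMap.inr_injective]
  · have hmap : (U.comap (φ : L₁ × L₂ →ₗ[F] V)).map (φ : L₁ × L₂ →ₗ[F] V) = U :=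
      Submodule.map_comap_eq_of_surjective φ.surjective U
    have h := eq_of_stable_prod (F := F) hb hγ hdvd (U := U.comap (φ : L₁ × L₂ →ₗ[F] V))
      fun u hu => by
        have := hU _ hu
        change φ _ ∈ U
        exact (hφ u) ▸ this
    rcases h with h | h | h | h
    · left; rw [← hmap, h, Submodule.map_bot]
    · right; left
      rw [← hmap, h, Submodule.map_top, LinearMap.range_eq_top]
      exact φ.surjective
    · right; right; left; rw [← hmap, h]
    · right; right; right; rw [← hmap, h]

/-- Each map of the class has only one invariant subspace of the given dimension, and the
invertible maps permute these subspaces transitively. -/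
theorem ncard_conjSet_pair_stabilizer_mul_le [FiniteDimensional F V] {b : L₁} {γ : L₂}
    (hb : Algebra.adjoin F {b} = ⊤)
    (hγ : ∀ x : L₂, x ≠ 0 → ∃ k : ℕ, x = γ ^ (k + 1)) (hdvd : ¬ finrank F L₂ ∣ finrank F L₁)
    (hV : finrank F L₁ + finrank F L₂ = finrank F V) {U : Submodule F V}
    (hU : finrank F U = finrank F L₁ ∨ finrank F U = finrank F L₂) :
    subspaceCard F V (finrank F L₁) *
      {A ∈ conjSet V (mulEnd F (b, γ)) | ∀ u ∈ U, A u ∈ U}.ncard ≤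
      (conjSet V (mulEnd F (b, γ))).ncard := by
  have hne : finrank F L₁ ≠ finrank F L₂ := fun h => hdvd h.symm.dvd
  have hL₁ : 0 < finrank F L₁ := Module.finrank_pos
  have hL₂ : 0 < finrank F L₂ := Module.finrank_pos
  have hk : subspaceCard F V (finrank F L₁) = subspaceCard F V (finrank F U) := by
    rcases hU with h | h
    · rw [h]
    · rw [h, ← subspaceCard_symm F V (show finrank F L₂ ≤ finrank F V by omega), ← hV,
        Nat.add_sub_cancel]
  have := finite_end F V
  rw [hk, ← Nat.card_coe_set_eq, ← Nat.card_coe_set_eq, subspaceCard, ← Nat.card_prod]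
  choose g hg using fun U' : {U' : Submodule F V // finrank F U' = finrank F U} =>
    exists_linearEquiv_map_eq U'.2.symm
  have hstab : ∀ U' : {U' : Submodule F V // finrank F U' = finrank F U},
      ∀ A : Module.End F V, (∀ u ∈ U, A u ∈ U) →
      ∀ u ∈ U'.1, (g U').conjAlgEquiv F A u ∈ U'.1 := by
    intro U' A hA u hu
    obtain ⟨v, rfl⟩ := (g U').surjective u
    have h1 : (g U').conjAlgEquiv F A (g U' v) = g U' (A v) := by
      simp [LinearEquiv.conjAlgEquiv_apply]
    rw [h1, hg]
    exact hA v ((hg U' v).1 hu)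
  refine Nat.card_le_card_of_injective
    (fun z => ⟨(g z.1).conjAlgEquiv F z.2.1, ?_⟩) ?_
  · obtain ⟨φ, hφ⟩ := z.2.2.1
    refine ⟨φ.trans (g z.1), fun x => ?_⟩
    simp [LinearEquiv.conjAlgEquiv_apply, hφ]
  · rintro ⟨U', A, hA, hAU⟩ ⟨U'', A', hA', hAU'⟩ h
    have h1 : (g U').conjAlgEquiv F A = (g U'').conjAlgEquiv F A' := congrArg Subtype.val h
    have hconj : (g U').conjAlgEquiv F A ∈ conjSet V (mulEnd F (b, γ)) := by
      obtain ⟨φ, hφ⟩ := hA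
      refine ⟨φ.trans (g U'), fun x => ?_⟩
      simp [LinearEquiv.conjAlgEquiv_apply, hφ]
    obtain ⟨U₁, U₂, hU₁, hU₂, hall⟩ := eq_of_stable_conjSet_pair hb hγ hdvd hconj
    have hUU : U' = U'' := by
      have h3 := hall U' (hstab U' A hAU)
      have h4 := hall U'' (h1 ▸ hstab U'' A' hAU')
      have h5 := U'.2
      have h6 := U''.2
      refine Subtype.ext ?_
      have hfr : ∀ U'' : Submodule F V, finrank F U'' = finrank F U →
          U'' = ⊥ ∨ U'' = ⊤ ∨ U'' = U₁ ∨ U'' = U₂ →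
          (finrank F U = finrank F L₁ ∧ U'' = U₁) ∨ (finrank F U = finrank F L₂ ∧ U'' = U₂) := by
        rintro W hW (rfl | rfl | rfl | rfl)
        · rw [finrank_bot] at hW; omega
        · rw [finrank_top] at hW; omega
        · exact Or.inl ⟨hW ▸ hU₁, rfl⟩
        · exact Or.inr ⟨hW ▸ hU₂, rfl⟩
      rcases hfr _ h5 h3 with ⟨h, h'⟩ | ⟨h, h'⟩ <;> rcases hfr _ h6 h4 with ⟨k, k'⟩ | ⟨k, k'⟩
      · rw [h', k']
      · omega
      · omega
      · rw [h', k']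
    subst hUU
    have h2 : A = A' := ((g U').conjAlgEquiv F).injective h1
    subst h2
    rfl

/-- A proper subring that meets the class preserves one of the two kinds of subspaces, or it is
small, since it consists of maps that are linear over a larger field. -/
theorem stable_or_ncard_le [FiniteDimensional F V] {b : L₁} {γ : L₂}
    (hb : Algebra.adjoin F {b} = ⊤)
    (hγ : ∀ x : L₂, x ≠ 0 → ∃ k : ℕ, x = γ ^ (k + 1)) (hdvd : ¬ finrank F L₂ ∣ finrank F L₁)
    (hV : finrank F L₁ + finrank F L₂ = finrank F V) {P : NonUnitalSubring (Module.End F V)}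
    (hP : P ≠ ⊤) {A : Module.End F V} (hAP : A ∈ P) (hA : A ∈ conjSet V (mulEnd F (b, γ))) :
    (∃ U : Submodule F V, (finrank F U = finrank F L₁ ∨ finrank F U = finrank F L₂) ∧
      ∀ t ∈ P, ∀ u ∈ U, t u ∈ U) ∨
    ∃ r, 2 ≤ r ∧ r ∣ finrank F L₁ ∧ r ∣ finrank F V ∧
      (P : Set (Module.End F V)).ncard ≤ Nat.card F ^ (finrank F V * (finrank F V / r)) := by
  by_cases hirr : ∀ U : Submodule F V, (∀ t ∈ P, ∀ u ∈ U, t u ∈ U) → U = ⊥ ∨ U = ⊤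
  swap
  · left
    push Not at hirr
    obtain ⟨U, hU, h0, h1⟩ := hirr
    obtain ⟨U₁, U₂, hU₁, hU₂, hall⟩ := eq_of_stable_conjSet_pair hb hγ hdvd hA
    rcases hall U (hU A hAP) with h | h | h | h
    · exact absurd h h0
    · exact absurd h h1
    · exact ⟨U, Or.inl (h ▸ hU₁), hU⟩
    · exact ⟨U, Or.inr (h ▸ hU₂), hU⟩
  right
  obtain ⟨φ, hφ⟩ := hA
  let ρ : (L₁ × L₂) →ₐ[F] Module.End F V :=
    (φ.conjAlgEquiv F : Module.End F (L₁ × L₂) →ₐ[F] Module.End F V).comp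
      (Algebra.lmul F (L₁ × L₂))
  have hρ : ∀ x y, ρ x (φ y) = φ (x * y) := by
    intro x y
    simp [ρ, LinearEquiv.conjAlgEquiv_apply]
  have hρA : ρ (b, γ) = A := by
    refine LinearMap.ext fun v => ?_
    obtain ⟨y, rfl⟩ := φ.surjective v
    rw [hρ, hφ]
    rfl
  have hmem : ∀ c : L₂, ρ (0, c) ∈ P := by
    intro c
    have := zero_prod_mem (F := F) (S := P.comap (ρ : L₁ × L₂ →ₙ+* Module.End F V)) hγ hdvd
      (by rw [NonUnitalSubring.mem_comap]; change ρ (b, γ) ∈ P; rwa [hρA]) c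
    exact this
  have hL₁ : 0 < finrank F L₁ := Module.finrank_pos
  have hL₂ : 0 < finrank F L₂ := Module.finrank_pos
  have : Nontrivial V := Module.nontrivial_of_finrank_pos (R := F) (by omega)
  have hz0 : ρ ((0 : L₁), (1 : L₂)) ≠ 0 := by
    intro h
    have h1 := hρ (0, 1) (0, 1)
    rw [h, LinearMap.zero_apply] at h1
    have h2 := φ.map_eq_zero_iff.1 h1.symm
    simp at h2
  have hz : ∀ c : F, c • ρ ((0 : L₁), (1 : L₂)) ∈ P := by
    intro c
    rw [← map_smul]
    simpa using hmem (c • 1)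
  obtain ⟨D, hD, hr, hcomm⟩ := exists_field_of_irreducible hirr hz0 hz hP
  let : Field D := hD.toField
  have hmul : finrank F D * finrank D V = finrank F V := Module.finrank_mul_finrank F D V
  have := finite_end F V
  have : Finite V := Module.finite_of_finite F
  have : Finite D := Module.finite_of_finite F
  have : Module.Finite D V := Module.Finite.of_restrictScalars_finite F D V
  have hrV : finrank F D ∣ finrank F V := ⟨_, hmul.symm⟩
  -- the image of `0 × L₂` is the range of an idempotent of `P`, so `D` acts on it
  let W : Submodule D V :=
    { carrier := {v | ρ (0, 1) v = v}
      add_mem' := fun {u v} hu hv => by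
        change ρ (0, 1) (u + v) = u + v
        rw [map_add, show ρ (0, 1) u = u from hu, show ρ (0, 1) v = v from hv]
      zero_mem' := map_zero _
      smul_mem' := fun δ v hv => by
        have h1 := LinearMap.congr_fun (hcomm _ (hmem 1) δ.1 δ.2) v
        change ρ (0, 1) (δ.1 v) = δ.1 (ρ (0, 1) v) at h1
        change ρ (0, 1) (δ.1 v) = δ.1 v
        rw [h1, show ρ (0, 1) v = v from hv] }
  have hW : finrank F W = finrank F L₂ := by
    have h1 : W.restrictScalars F =
        (LinearMap.range (LinearMap.inr F L₁ L₂)).map (φ : L₁ × L₂ →ₗ[F] V) := by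
      ext v
      obtain ⟨y, rfl⟩ := φ.surjective v
      change ρ (0, 1) (φ y) = φ y ↔ _
      rw [hρ, φ.injective.eq_iff]
      constructor
      · intro h
        exact ⟨y, ⟨y.2, Prod.ext (by rw [← h]; simp) rfl⟩, rfl⟩
      · rintro ⟨_, ⟨c, rfl⟩, hc⟩
        rw [← φ.injective hc]
        simp
    change finrank F (W.restrictScalars F) = _
    rw [h1, LinearEquiv.finrank_map_eq, LinearMap.finrank_range_of_inj LinearMap.inr_injective]
  have hrL₂ : finrank F D ∣ finrank F L₂ := by
    rw [← hW, ← Module.finrank_mul_finrank F D W]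
    exact dvd_mul_right _ _
  refine ⟨finrank F D, hr, ?_, hrV, ?_⟩
  · rw [← hV] at hrV
    exact (Nat.dvd_add_left hrL₂).1 hrV
  · have : Finite (Module.End D V) :=
      Finite.of_injective (fun f => (f : V → V)) DFunLike.coe_injective
    have h1 : (P : Set (Module.End F V)).ncard ≤ Nat.card (Module.End D V) := by
      rw [← Nat.card_coe_set_eq]
      refine Nat.card_le_card_of_injective (fun t =>
        ({ toFun := t.1
           map_add' := map_add t.1
           map_smul' := fun δ v => LinearMap.congr_fun (hcomm t.1 t.2 δ.1 δ.2) v } :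
          Module.End D V)) fun t t' h => ?_
      exact Subtype.ext (LinearMap.ext fun v => LinearMap.congr_fun h v)
    refine h1.trans (le_of_eq ?_)
    rw [Module.natCard_eq_pow_finrank (K := D), Module.finrank_linearMap,
      Module.natCard_eq_pow_finrank (K := F) (V := D), ← pow_mul, ← hmul,
      Nat.mul_div_cancel_left _ (by omega), mul_assoc]

theorem frameCard_le_ncard_conjSet_pair_mul [FiniteDimensional F V] {b : L₁} {γ : L₂}
    (hb : Algebra.adjoin F {b} = ⊤)
    (hγ : ∀ x : L₂, x ≠ 0 → ∃ k : ℕ, x = γ ^ (k + 1)) (hdvd : ¬ finrank F L₂ ∣ finrank F L₁)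
    (hV : finrank F L₁ + finrank F L₂ = finrank F V) :
    frameCard (Nat.card F) (finrank F V) (finrank F V) ≤
      (conjSet V (mulEnd F (b, γ))).ncard * Nat.card F ^ finrank F V := by
  refine (frameCard_le_ncard_conjSet_mul ((Module.finrank_prod).trans hV) (mulEnd F (b, γ))
    one_ne_zero (exists_eq_aeval_mulEnd (adjoin_pair_eq_top hb hγ hdvd))).trans ?_
  exact Nat.mul_le_mul_left _ (Nat.sub_le _ _)

end PairClass

theorem eight_le_or_eq_six {n k r : ℕ} (hr : 2 ≤ r) (hrk : r ∣ k) (hrn : r ∣ n) (hk0 : 0 < k)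
    (hk : k < n - n / n.minFac) : 8 ≤ n ∨ n = 6 ∧ k = 2 ∧ r = 2 := by
  by_contra! h
  have hn : n ≤ 7 := by omega
  have hrk' := Nat.le_of_dvd hk0 hrk
  have hkn : k < n := hk.trans_le (Nat.sub_le _ _)
  have h2 : n.minFac = 2 ∨ ¬ 2 ∣ n := by
    by_cases h : 2 ∣ n
    · exact Or.inl ((Nat.minFac_eq_two_iff n).2 h)
    · exact Or.inr h
  rcases h2 with h2 | h2
  · rw [h2] at hk
    interval_cases n <;> interval_cases k <;> interval_cases r <;> simp_all
  · interval_cases n <;> interval_cases k <;> interval_cases r <;> simp_all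

/-- A subring of linear maps over a larger field is too small to compete with the stabilizer of a
subspace. -/
theorem subspaceCard_mul_pow_le {F V : Type*} [Field F] [Finite F] [AddCommGroup V] [Module F V]
    [FiniteDimensional F V] {k r : ℕ} (hr : 2 ≤ r) (hrk : r ∣ k) (hrn : r ∣ finrank F V)
    (hk0 : 0 < k) (hk : k < finrank F V - finrank F V / (finrank F V).minFac) :
    subspaceCard F V k * Nat.card F ^ (finrank F V * (finrank F V / r)) *
        Nat.card F ^ finrank F V ≤ frameCard (Nat.card F) (finrank F V) (finrank F V) ∧
      (8 ≤ finrank F V → 2 * (subspaceCard F V k *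
        Nat.card F ^ (finrank F V * (finrank F V / r)) * Nat.card F ^ finrank F V) ≤
          frameCard (Nat.card F) (finrank F V) (finrank F V)) := by
  have hq : 2 ≤ Nat.card F := two_le_natCard F
  have hkn : k < finrank F V := hk.trans_le (Nat.sub_le _ _)
  have h1 := subspaceCard_le_four_mul_pow F V hkn.le
  have h2 := pow_le_four_mul_frameCard hq (le_refl (finrank F V))
  have h68 := eight_le_or_eq_six hr hrk hrn hk0 hk
  set n := finrank F V
  set q := Nat.card F
  set N := subspaceCard F V k
  have h3 : N * q ^ (n * (n / r)) * q ^ n ≤ 4 * q ^ (k * (n - k) + n * (n / r) + n) := by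
    rw [pow_add, pow_add, ← mul_assoc, ← mul_assoc]
    gcongr
  have h4 : 8 ≤ n → 32 * q ^ (k * (n - k) + n * (n / r) + n) ≤ q ^ (n * n) := by
    intro h8
    have h5 : 32 ≤ q ^ 5 := Nat.pow_le_pow_left hq 5
    refine (Nat.mul_le_mul_right _ h5).trans ?_
    rw [← pow_add]
    refine Nat.pow_le_pow_right (by omega) ?_
    obtain ⟨j, hj⟩ := Nat.exists_eq_add_of_le hkn.le
    have ht : n / r * 2 ≤ n := (Nat.mul_le_mul_left _ hr).trans (Nat.div_mul_le_self n r)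
    have hnk : n - k = j := by omega
    rw [hnk]
    have h6 : 4 * (k * j) ≤ n * n := by
      rw [hj]
      nlinarith [sq_nonneg ((k : ℤ) - j), four_mul_le_sq_add k j]
    nlinarith
  rcases h68 with h8 | ⟨h6, rfl, rfl⟩
  · have := h4 h8
    exact ⟨by omega, fun _ => by omega⟩
  · refine ⟨?_, fun h8 => by omega⟩
    have h5 : 16 ≤ q ^ 4 := Nat.pow_le_pow_left hq 4
    have h7 : 16 * q ^ (2 * (n - 2) + n * (n / 2) + n) ≤ q ^ (n * n) := by
      refine (Nat.mul_le_mul_right _ h5).trans ?_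
      rw [← pow_add, h6]
    omega

/-- The properties, relevant for counting, of the class of linear maps on `V` that act irreducibly
on two complementary subspaces, the first of dimension `e`, and generate a large field on the
second. -/
structure IsTwoBlockClass (F : Type*) {V : Type*} [Field F] [AddCommGroup V] [Module F V] (e : ℕ)
    (X : Set (Module.End F V)) : Prop where
  pos : 0 < e
  lt : e < finrank F V
  frameCard_le : frameCard (Nat.card F) (finrank F V) (finrank F V) ≤
    X.ncard * Nat.card F ^ finrank F V
  finrank_eq : ∀ A ∈ X, ∀ U : Submodule F V, (∀ u ∈ U, A u ∈ U) →
    finrank F U = 0 ∨ finrank F U = finrank F V ∨ finrank F U = e ∨ finrank F U = finrank F V - e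
  subspaceCard_mul_le : ∀ U : Submodule F V, (finrank F U = e ∨ finrank F U = finrank F V - e) →
    subspaceCard F V e * {A ∈ X | ∀ u ∈ U, A u ∈ U}.ncard ≤ X.ncard
  stable_or_ncard_le : ∀ P : NonUnitalSubring (Module.End F V), P ≠ ⊤ → ∀ A ∈ P, A ∈ X →
    (∃ U : Submodule F V, (finrank F U = e ∨ finrank F U = finrank F V - e) ∧
      ∀ t ∈ P, ∀ u ∈ U, t u ∈ U) ∨
    ∃ r, 2 ≤ r ∧ r ∣ e ∧ r ∣ finrank F V ∧
      (P : Set (Module.End F V)).ncard ≤ Nat.card F ^ (finrank F V * (finrank F V / r))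

theorem isTwoBlockClass_conjSet_pair {F L₁ L₂ V : Type*} [Field F] [Finite F] [Field L₁]
    [Algebra F L₁] [FiniteDimensional F L₁] [Field L₂] [Algebra F L₂] [FiniteDimensional F L₂]
    [AddCommGroup V] [Module F V] [FiniteDimensional F V] {b : L₁} {γ : L₂}
    (hb : Algebra.adjoin F {b} = ⊤) (hγ : ∀ x : L₂, x ≠ 0 → ∃ k : ℕ, x = γ ^ (k + 1))
    (hdvd : ¬ finrank F L₂ ∣ finrank F L₁)
    (hV : finrank F L₁ + finrank F L₂ = finrank F V) :
    IsTwoBlockClass F (finrank F L₁) (conjSet V (mulEnd F (b, γ))) := by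
  have h1 : 0 < finrank F L₁ := Module.finrank_pos
  have h2 : 0 < finrank F L₂ := Module.finrank_pos
  have h3 : finrank F V - finrank F L₁ = finrank F L₂ := by omega
  refine ⟨h1, by omega, frameCard_le_ncard_conjSet_pair_mul hb hγ hdvd hV, ?_, ?_, ?_⟩
  · intro A hA U hU
    obtain ⟨U₁, U₂, hU₁, hU₂, hall⟩ := eq_of_stable_conjSet_pair hb hγ hdvd hA
    rw [h3]
    rcases hall U hU with rfl | rfl | rfl | rfl
    · simp
    · simp
    · simp [hU₁]
    · simp [hU₂]
  · intro U hU
    rw [h3] at hU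
    exact ncard_conjSet_pair_stabilizer_mul_le hb hγ hdvd hV hU
  · intro P hP A hAP hA
    rw [h3]
    exact stable_or_ncard_le hb hγ hdvd hV hP hAP hA

theorem IsTwoBlockClass.ncard_pos {F V : Type*} [Field F] [Finite F] [AddCommGroup V]
    [Module F V] {e : ℕ} {X : Set (Module.End F V)} (h : IsTwoBlockClass F e X) : 0 < X.ncard := by
  refine Nat.pos_of_ne_zero fun h0 => ?_
  have := h.frameCard_le
  rw [h0, zero_mul] at this
  have := frameCard_pos (two_le_natCard F) (le_refl (finrank F V))
  omega

namespace IsTwoBlockClass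

variable {F V : Type*} [Field F] [Finite F] [AddCommGroup V] [Module F V] [FiniteDimensional F V]
  {e : ℕ} {X : Set (Module.End F V)}

/-- The bound on the part of the class inside a proper subring, with the invariant subspace kept
as extra information. -/
theorem stable_or_two_mul_ncard_inter_le (h : IsTwoBlockClass F e X)
    (he : e < finrank F V - finrank F V / (finrank F V).minFac)
    {P : NonUnitalSubring (Module.End F V)} (hP : P ≠ ⊤)
    (hne : ((P : Set (Module.End F V)) ∩ X).Nonempty) :
    ((∃ U : Submodule F V, (finrank F U = e ∨ finrank F U = finrank F V - e) ∧
      ∀ t ∈ P, ∀ u ∈ U, t u ∈ U) ∧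
      subspaceCard F V e * ((P : Set (Module.End F V)) ∩ X).ncard ≤ X.ncard) ∨
    ((∃ r, 2 ≤ r ∧ r ∣ e ∧ r ∣ finrank F V) ∧
      subspaceCard F V e * ((P : Set (Module.End F V)) ∩ X).ncard ≤ X.ncard ∧
      (8 ≤ finrank F V →
        2 * (subspaceCard F V e * ((P : Set (Module.End F V)) ∩ X).ncard) ≤ X.ncard)) := by
  have := finite_end F V
  obtain ⟨A, hAP, hA⟩ := hne
  rcases h.stable_or_ncard_le P hP A hAP hA with ⟨U, hU, hst⟩ | ⟨r, hr, hre, hrn, hcard⟩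
  · left
    refine ⟨⟨U, hU, hst⟩, le_trans (Nat.mul_le_mul_left _ ?_) (h.subspaceCard_mul_le U hU)⟩
    exact Set.ncard_le_ncard (fun A hA => ⟨hA.2, hst A hA.1⟩) (Set.toFinite _)
  · right
    refine ⟨⟨r, hr, hre, hrn⟩, ?_⟩
    have hq : 0 < Nat.card F ^ finrank F V :=
      pow_pos (Nat.lt_of_lt_of_le (by norm_num) (two_le_natCard F)) _
    have h1 : ((P : Set (Module.End F V)) ∩ X).ncard ≤
        Nat.card F ^ (finrank F V * (finrank F V / r)) :=
      (Set.ncard_le_ncard Set.inter_subset_left (Set.toFinite _)).trans hcard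
    obtain ⟨h2, h3⟩ := subspaceCard_mul_pow_le hr hre hrn h.pos he
    have h4 : subspaceCard F V e * ((P : Set (Module.End F V)) ∩ X).ncard *
        Nat.card F ^ finrank F V ≤ subspaceCard F V e *
        Nat.card F ^ (finrank F V * (finrank F V / r)) * Nat.card F ^ finrank F V := by
      gcongr
    have h5 := h.frameCard_le
    refine ⟨Nat.le_of_mul_le_mul_right (h4.trans (h2.trans h5)) hq, fun h8 => ?_⟩
    refine Nat.le_of_mul_le_mul_right (c := Nat.card F ^ finrank F V) ?_ hq
    rw [mul_assoc]
    exact (Nat.mul_le_mul_left _ h4).trans ((h3 h8).trans h5)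

theorem mul_ncard_inter_le (h : IsTwoBlockClass F e X)
    (he : e < finrank F V - finrank F V / (finrank F V).minFac)
    {P : NonUnitalSubring (Module.End F V)} (hP : P ≠ ⊤) :
    subspaceCard F V e * ((P : Set (Module.End F V)) ∩ X).ncard ≤ X.ncard := by
  rcases Set.eq_empty_or_nonempty ((P : Set (Module.End F V)) ∩ X) with h0 | h0
  · rw [h0, Set.ncard_empty, mul_zero]
    exact Nat.zero_le _
  · rcases h.stable_or_two_mul_ncard_inter_le he hP h0 with h1 | h1
    exacts [h1.2, h1.2.1]

/-- Proper subrings covering the class are at least as many as the subspaces of dimension `e`. -/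
theorem subspaceCard_le_card (h : IsTwoBlockClass F e X)
    (he : e < finrank F V - finrank F V / (finrank F V).minFac)
    {T : Finset (NonUnitalSubring (Module.End F V))} (hT : ∀ P ∈ T, P ≠ ⊤)
    (hcov : ∀ A ∈ X, ∃ P ∈ T, A ∈ P) : subspaceCard F V e ≤ T.card := by
  have := finite_end F V
  refine Nat.le_of_mul_le_mul_right (c := X.ncard) ?_ h.ncard_pos
  have h1 := Set.ncard_le_sum_ncard_inter (f := fun P : NonUnitalSubring (Module.End F V) =>
    (P : Set (Module.End F V))) hcov
  calc subspaceCard F V e * X.ncard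
      ≤ subspaceCard F V e * ∑ P ∈ T, ((P : Set (Module.End F V)) ∩ X).ncard :=
        Nat.mul_le_mul_left _ h1
    _ = ∑ P ∈ T, subspaceCard F V e * ((P : Set (Module.End F V)) ∩ X).ncard := Finset.mul_sum ..
    _ ≤ ∑ _P ∈ T, X.ncard := Finset.sum_le_sum fun P hP => h.mul_ncard_inter_le he (hT P hP)
    _ = T.card * X.ncard := by rw [Finset.sum_const, smul_eq_mul]

/-- Hardly any proper subring meets two classes: a common invariant subspace is excluded by the
dimensions, and a subring without invariant subspace takes less than half of each class. -/
theorem subspaceCard_add_subspaceCard_le_card {d : ℕ} {Y : Set (Module.End F V)}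
    (h : IsTwoBlockClass F e X) (h' : IsTwoBlockClass F d Y) (hed : e ∣ d) (hlt : e < d)
    (hd : d < finrank F V - finrank F V / (finrank F V).minFac)
    {T : Finset (NonUnitalSubring (Module.End F V))} (hT : ∀ P ∈ T, P ≠ ⊤)
    (hcov : ∀ A ∈ X, ∃ P ∈ T, A ∈ P) (hcov' : ∀ A ∈ Y, ∃ P ∈ T, A ∈ P) :
    subspaceCard F V d + subspaceCard F V e ≤ T.card := by
  have := finite_end F V
  have hX := h.ncard_pos
  have hY := h'.ncard_pos
  have he := hlt.trans hd
  have h0 := h.pos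
  have h1 := Set.ncard_le_sum_ncard_inter (f := fun P : NonUnitalSubring (Module.End F V) =>
    (P : Set (Module.End F V))) hcov
  have h2 := Set.ncard_le_sum_ncard_inter (f := fun P : NonUnitalSubring (Module.End F V) =>
    (P : Set (Module.End F V))) hcov'
  -- the subspaces of dimension `d` are not invariant under the maps of `X`, and vice versa
  have hsum : finrank F V ≠ d + e := by
    intro hsum
    have hen : e ∣ finrank F V := by rw [hsum]; exact dvd_add hed dvd_rfl
    obtain ⟨c, hc⟩ := hen
    have hc2 : 2 ≤ c := by
      by_contra hc1
      have : c = 0 ∨ c = 1 := by omega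
      rcases this with rfl | rfl <;> omega
    have h3 : (finrank F V).minFac ≤ c := Nat.minFac_le_of_dvd hc2 ⟨e, by rw [hc, mul_comm]⟩
    have h4 : finrank F V / c ≤ finrank F V / (finrank F V).minFac :=
      Nat.div_le_div_left h3 (Nat.minFac_pos _)
    have h5 : finrank F V / c = e := by
      rw [hc, Nat.mul_div_cancel _ (by omega)]
    omega
  have key : ∀ P ∈ T,
      (subspaceCard F V d * ((P : Set (Module.End F V)) ∩ Y).ncard) * X.ncard +
        (subspaceCard F V e * ((P : Set (Module.End F V)) ∩ X).ncard) * Y.ncard ≤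
      X.ncard * Y.ncard := by
    intro P hP
    have hlen : ∀ U : Submodule F V, finrank F U ≤ finrank F V := fun U => U.finrank_le
    have hdlt := h'.lt
    rcases Set.eq_empty_or_nonempty ((P : Set (Module.End F V)) ∩ X) with hPX | hPX
    · rw [hPX, Set.ncard_empty, mul_zero, zero_mul, add_zero, mul_comm X.ncard]
      exact Nat.mul_le_mul_right _ (h'.mul_ncard_inter_le hd (hT P hP))
    rcases Set.eq_empty_or_nonempty ((P : Set (Module.End F V)) ∩ Y) with hPY | hPY
    · rw [hPY, Set.ncard_empty, mul_zero, zero_mul, zero_add]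
      exact Nat.mul_le_mul_right _ (h.mul_ncard_inter_le he (hT P hP))
    obtain ⟨A, hAP, hAX⟩ := hPX
    obtain ⟨B, hBP, hBY⟩ := hPY
    rcases h.stable_or_two_mul_ncard_inter_le he (hT P hP) ⟨A, hAP, hAX⟩ with
      ⟨⟨U, hU, hst⟩, -⟩ | ⟨⟨r, hr⟩, -, h3⟩
    · have := h'.finrank_eq B hBY U (hst B hBP)
      omega
    rcases h'.stable_or_two_mul_ncard_inter_le hd (hT P hP) ⟨B, hBP, hBY⟩ with
      ⟨⟨U, hU, hst⟩, -⟩ | ⟨-, -, h4⟩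
    · have := h.finrank_eq A hAX U (hst A hAP)
      omega
    have h8 : 8 ≤ finrank F V := by
      rcases eight_le_or_eq_six hr.1 hr.2.1 hr.2.2 h.pos he with h8 | ⟨h6, h2', -⟩
      · exact h8
      · rw [h6] at hd
        have : Nat.minFac 6 = 2 := by norm_num
        rw [this] at hd
        omega
    have h5 := Nat.mul_le_mul_right Y.ncard (h3 h8)
    have h6 := Nat.mul_le_mul_right X.ncard (h4 h8)
    rw [mul_assoc] at h5 h6
    rw [mul_comm Y.ncard] at h6
    omega
  refine Nat.le_of_mul_le_mul_right (c := X.ncard * Y.ncard) ?_ (Nat.mul_pos hX hY)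
  have h3 := Finset.sum_le_sum key
  rw [Finset.sum_add_distrib, ← Finset.sum_mul, ← Finset.sum_mul, ← Finset.mul_sum,
    ← Finset.mul_sum, Finset.sum_const, smul_eq_mul] at h3
  refine le_trans ?_ h3
  rw [add_mul]
  refine add_le_add ?_ ?_
  · rw [mul_comm X.ncard, ← mul_assoc]
    exact Nat.mul_le_mul_right _ (Nat.mul_le_mul_left _ h2)
  · rw [← mul_assoc]
    exact Nat.mul_le_mul_right _ (Nat.mul_le_mul_left _ h1)

end IsTwoBlockClass

/-! ### Elements of the second field with prescribed degrees -/

theorem dvd_of_pow_sub_one_dvd {p a b : ℕ} (hp : 2 ≤ p) (h : p ^ a - 1 ∣ p ^ b - 1) : a ∣ b := by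
  have h1 := Nat.pow_sub_one_gcd_pow_sub_one p a b
  rw [Nat.gcd_eq_left h] at h1
  have h2 : ∀ k, 1 ≤ p ^ k := fun k => Nat.one_le_pow _ _ (by omega)
  have h3 : p ^ a = p ^ a.gcd b := by
    have := h2 a
    have := h2 (a.gcd b)
    omega
  rw [Nat.pow_right_injective hp h3]
  exact Nat.gcd_dvd_right a b

theorem pow_pow_eq_of_dvd {M : Type*} [Monoid M] {x : M} {p m k : ℕ} (h : x ^ p ^ m = x)
    (hmk : m ∣ k) : x ^ p ^ k = x := by
  obtain ⟨c, rfl⟩ := hmk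
  induction c with
  | zero => simp
  | succ c ih => rw [Nat.mul_succ, pow_add, pow_mul, ih, h]

theorem Subfield.pow_pow_mul_eq {K : Type*} [Field K] [Finite K] {F₁ F₂ : Subfield K}
    (hK : F₁ ⊔ F₂ = ⊤) {p s t : ℕ} [Fact p.Prime] [CharP K p] (h₁ : Nat.card F₁ = p ^ s)
    (h₂ : Nat.card F₂ = p ^ t) (x : K) : x ^ p ^ (s * t) = x := by
  have hle : ∀ F : Subfield K, (∀ x ∈ F, x ^ p ^ (s * t) = x) →
      F ≤ (iterateFrobenius K p (s * t)).eqLocusField (RingHom.id K) := by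
    intro F hF x hx
    change iterateFrobenius K p (s * t) x = x
    rw [iterateFrobenius_def, hF x hx]
  have h : (⊤ : Subfield K) ≤ (iterateFrobenius K p (s * t)).eqLocusField (RingHom.id K) := by
    rw [← hK]
    refine sup_le (hle _ fun x hx => ?_) (hle _ fun x hx => ?_)
    · rw [Subfield.mem_iff_pow_card_eq, h₁] at hx
      exact pow_pow_eq_of_dvd hx (dvd_mul_right _ _)
    · rw [Subfield.mem_iff_pow_card_eq, h₂] at hx
      exact pow_pow_eq_of_dvd hx (dvd_mul_left _ _)
  exact h (Subfield.mem_top x)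

/-- For every prime divisor `ℓ` of `d`, an element of `F₂` that lies in the intermediate field of
index `ℓ` over `F₁`; two such elements for different primes generate `F₂`. The element for `ℓ` is a
multiplicative generator of the subfield of index `ℓ` of `F₂`. -/
theorem exists_partial_generators {K : Type*} [Field K] [Finite K] {F₁ F₂ : Subfield K}
    (hK : F₁ ⊔ F₂ = ⊤) {d : ℕ} (hd : Nat.card K = Nat.card F₁ ^ d) :
    ∃ g : ℕ → F₂, (∀ ℓ, ℓ.Prime → ℓ ∣ d → g ℓ ^ Nat.card F₁ ^ (d / ℓ) = g ℓ) ∧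
      ∀ ℓ ℓ', ℓ.Prime → ℓ'.Prime → ℓ ∣ d → ℓ' ∣ d → ℓ ≠ ℓ' → ∀ Q : NonUnitalSubring F₂,
        g ℓ ∈ Q → g ℓ' ∈ Q → Q = ⊤ := by
  obtain ⟨p, hchar⟩ := CharP.exists K
  have hp : Fact p.Prime := ⟨CharP.char_is_prime K p⟩
  have hp2 : 2 ≤ p := hp.out.two_le
  have hcard : ∀ F : Subfield K, ∃ s, 0 < s ∧ Nat.card F = p ^ s := by
    intro F
    have := Fintype.ofFinite F
    have : CharP F p := inferInstance
    obtain ⟨s, -, hs⟩ := FiniteField.card F p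
    exact ⟨s, s.pos, by rw [Nat.card_eq_fintype_card, hs]⟩
  obtain ⟨s, hs0, hs⟩ := hcard F₁
  obtain ⟨t, ht0, ht⟩ := hcard F₂
  have hKcard : Nat.card K = p ^ (s * d) := by rw [hd, hs, pow_mul]
  obtain ⟨δ, hδ0, -, hδ⟩ := exists_generator_of_finite K
  obtain ⟨γ, hγ0, hγ, hγord⟩ := exists_generator_of_finite F₂
  have hsub : ∀ {E : Type _} [Field E] (x : E), x ≠ 0 → ∀ k, x ^ p ^ k = x →
      x ^ (p ^ k - 1) = 1 := by
    intro E _ x hx k h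
    refine mul_left_cancel₀ hx ?_
    rw [mul_one, ← pow_succ', Nat.sub_add_cancel (Nat.one_le_pow _ _ (by omega)), h]
  have hdt : d ∣ t := by
    have h1 := hδ _ (hsub δ hδ0 _ (Subfield.pow_pow_mul_eq hK hs ht δ))
    rw [hKcard] at h1
    exact Nat.dvd_of_mul_dvd_mul_left hs0 (dvd_of_pow_sub_one_dvd hp2 h1)
  have htsd : t ∣ s * d := by
    have h1 : γ ^ p ^ (s * d) = γ := by
      have := Fintype.ofFinite K
      refine Subtype.ext ?_
      rw [SubmonoidClass.coe_pow, ← hKcard, Nat.card_eq_fintype_card, FiniteField.pow_card]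
    have h2 := hγord _ (hsub γ hγ0 _ h1)
    rw [ht] at h2
    exact dvd_of_pow_sub_one_dvd hp2 h2
  have hγt : γ ^ p ^ t = γ := by
    have := Fintype.ofFinite F₂
    rw [← ht, Nat.card_eq_fintype_card, FiniteField.pow_card]
  have hd0 : 0 < d := Nat.pos_of_dvd_of_pos hdt ht0
  have hexp : ∀ ℓ, ℓ ∣ d → (p ^ t - 1) / (p ^ (t / ℓ) - 1) * (p ^ (t / ℓ) - 1) = p ^ t - 1 := by
    intro ℓ hℓ
    refine Nat.div_mul_cancel ?_
    obtain ⟨m, hm⟩ := hℓ.trans hdt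
    have hℓ0 : 0 < ℓ := Nat.pos_of_dvd_of_pos hℓ hd0
    rw [hm, Nat.mul_div_cancel_left _ hℓ0, mul_comm, pow_mul]
    simpa using Nat.sub_dvd_pow_sub_pow (p ^ m) 1 ℓ
  have hgpow : ∀ ℓ, ℓ ∣ d → (γ ^ ((p ^ t - 1) / (p ^ (t / ℓ) - 1))) ^ p ^ (t / ℓ) =
      γ ^ ((p ^ t - 1) / (p ^ (t / ℓ) - 1)) := by
    intro ℓ hℓ
    have h1 : (γ ^ ((p ^ t - 1) / (p ^ (t / ℓ) - 1))) ^ (p ^ (t / ℓ) - 1) = 1 := by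
      rw [← pow_mul, hexp ℓ hℓ, hsub γ hγ0 t hγt]
    rw [← Nat.sub_add_cancel (Nat.one_le_pow (t / ℓ) p (by omega)), pow_succ,
      Nat.sub_add_cancel (Nat.one_le_pow (t / ℓ) p (by omega)), h1, one_mul]
  refine ⟨fun ℓ => γ ^ ((p ^ t - 1) / (p ^ (t / ℓ) - 1)), fun ℓ hℓ hℓd => ?_,
    fun ℓ ℓ' hℓ hℓ' hℓd hℓd' hne Q hQ hQ' => ?_⟩
  · rw [hs, ← pow_mul p s]
    refine pow_pow_eq_of_dvd (hgpow ℓ hℓd) ?_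
    refine Nat.dvd_of_mul_dvd_mul_left hℓ.pos ?_
    rw [Nat.mul_div_cancel' (hℓd.trans hdt), mul_left_comm, Nat.mul_div_cancel' hℓd]
    exact htsd
  · have h1 : (1 : F₂) ∈ Q := by
      have hm : 0 < t / ℓ := Nat.div_pos (Nat.le_of_dvd ht0 (hℓd.trans hdt)) hℓ.pos
      have h2 := Q.pow_succ_mem hQ (p ^ (t / ℓ) - 2)
      have h3 : 2 ≤ p ^ (t / ℓ) := hp2.trans (Nat.le_self_pow hm.ne' p)
      rwa [show p ^ (t / ℓ) - 2 + 1 = p ^ (t / ℓ) - 1 by omega, ← pow_mul, hexp ℓ hℓd,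
        hsub γ hγ0 t hγt] at h2
    have hpow : ∀ x ∈ Q, ∀ k : ℕ, x ^ k ∈ Q := by
      intro x hx k
      rcases k with _ | k
      · rwa [pow_zero]
      · exact Q.pow_succ_mem hx k
    let G : Subfield F₂ :=
      { carrier := Q
        mul_mem' := Q.mul_mem
        one_mem' := h1
        add_mem' := Q.add_mem
        zero_mem' := Q.zero_mem
        neg_mem' := Q.neg_mem
        inv_mem' := fun x hx => by
          rcases eq_or_ne x 0 with rfl | hx0
          · rw [inv_zero]; exact Q.zero_mem
          have : x⁻¹ = x ^ (Nat.card F₂ - 2) := by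
            have := Fintype.ofFinite F₂
            have h2 := FiniteField.pow_card_sub_one_eq_one x hx0
            have h3 : 2 ≤ Fintype.card F₂ := Fintype.one_lt_card
            rw [Nat.card_eq_fintype_card]
            refine inv_eq_of_mul_eq_one_right ?_
            rw [← pow_succ', ← h2]
            congr 1
            omega
          rw [this]
          exact hpow x hx _ }
    obtain ⟨k, hk0, hk⟩ : ∃ k, 0 < k ∧ Nat.card G = p ^ k := by
      have := Fintype.ofFinite G
      have : CharP F₂ p := inferInstance
      have : CharP G p := inferInstance
      obtain ⟨s, -, hs⟩ := FiniteField.card G p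
      exact ⟨s, s.pos, by rw [Nat.card_eq_fintype_card, hs]⟩
    have hmem : ∀ ℓ, ℓ ∣ d → γ ^ ((p ^ t - 1) / (p ^ (t / ℓ) - 1)) ∈ Q → t ∣ ℓ * k := by
      intro ℓ hℓd hQ
      have h2 := (Subfield.mem_iff_pow_card_eq G _).1 hQ
      rw [hk] at h2
      have h3 := hsub _ (pow_ne_zero _ hγ0) k h2
      rw [← pow_mul] at h3
      have h4 : (p ^ t - 1) / (p ^ (t / ℓ) - 1) * (p ^ (t / ℓ) - 1) ∣
          (p ^ t - 1) / (p ^ (t / ℓ) - 1) * (p ^ k - 1) := by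
        rw [hexp ℓ hℓd, ← ht]
        simpa only [ht] using hγord _ h3
      have h5 : 0 < (p ^ t - 1) / (p ^ (t / ℓ) - 1) := by
        refine Nat.pos_of_ne_zero fun h0 => ?_
        have h6 := hexp ℓ hℓd
        rw [h0, zero_mul] at h6
        have := hp2.trans (Nat.le_self_pow ht0.ne' p)
        omega
      have h6 := Nat.mul_dvd_mul_left ℓ
        (dvd_of_pow_sub_one_dvd hp2 (Nat.dvd_of_mul_dvd_mul_left h5 h4))
      rwa [Nat.mul_div_cancel' (hℓd.trans hdt)] at h6
    have htk : t ∣ k := by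
      have h2 := Nat.dvd_gcd (hmem ℓ hℓd hQ) (hmem ℓ' hℓd' hQ')
      rwa [Nat.gcd_mul_right, (Nat.coprime_primes hℓ hℓ').2 hne, one_mul] at h2
    have hγG : γ ∈ G := by
      rw [Subfield.mem_iff_pow_card_eq, hk]
      exact pow_pow_eq_of_dvd hγt htk
    exact isRingGenerator_of_pow hγ Q hγG

section

open IntermediateField

theorem adjoin_eq_top_of_generator {K : Type*} [Field K] {F₁ F₂ : Subfield K} (hK : F₁ ⊔ F₂ = ⊤)
    {γ : F₂} (hγ : IsRingGenerator γ) :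
    F₁⟮(γ : K)⟯ = ⊤ := by
  have h1 : F₁ ≤ F₁⟮(γ : K)⟯.toSubfield := fun x hx => F₁⟮(γ : K)⟯.algebraMap_mem ⟨x, hx⟩
  have h2 : F₂ ≤ F₁⟮(γ : K)⟯.toSubfield := by
    intro x hx
    have h3 := hγ (F₁⟮(γ : K)⟯.toSubfield.toSubring.toNonUnitalSubring.comap
      (F₂.subtype : F₂ →ₙ+* K)) (IntermediateField.mem_adjoin_simple_self F₁ (γ : K))
    have h4 : (⟨x, hx⟩ : F₂) ∈ (⊤ : NonUnitalSubring F₂) := trivial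
    rw [← h3] at h4
    exact h4
  refine eq_top_iff.2 fun x _ => ?_
  have h3 : (⊤ : Subfield K) ≤ F₁⟮(γ : K)⟯.toSubfield := hK ▸ sup_le h1 h2
  exact h3 (Subfield.mem_top x)

variable {K : Type*} [Field K] [Finite K] {F₁ F₂ : Subfield K}

theorem finrank_eq_of_natCard_eq {d : ℕ} (hd : Nat.card K = Nat.card F₁ ^ d) :
    finrank F₁ K = d := by
  rw [Module.natCard_eq_pow_finrank (K := F₁) (V := K)] at hd
  exact Nat.pow_right_injective (two_le_natCard F₁) hd

theorem finrank_adjoin_lt {d ℓ : ℕ} (hd : Nat.card K = Nat.card F₁ ^ d) (hℓ : ℓ.Prime)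
    (hℓd : ℓ ∣ d) (hd0 : 0 < d) {b : K} (hb : b ^ Nat.card F₁ ^ (d / ℓ) = b) :
    finrank F₁ F₁⟮b⟯ < d := by
  have := Fintype.ofFinite F₁
  have hfr := finrank_eq_of_natCard_eq hd
  refine lt_of_le_of_ne ?_ fun h => ?_
  · rw [← hfr]
    exact Submodule.finrank_le (F₁⟮b⟯.toSubalgebra.toSubmodule)
  · have htop : F₁⟮b⟯ = ⊤ := by
      refine IntermediateField.eq_of_le_of_finrank_eq le_top ?_
      rw [h, IntermediateField.finrank_top', hfr]
    have hpow : ∀ x : K, x ^ Nat.card F₁ ^ (d / ℓ) = x := by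
      intro x
      let f := FiniteField.frobeniusAlgHom F₁ K ^ (d / ℓ)
      have hf : ∀ x, f x = x ^ Nat.card F₁ ^ (d / ℓ) := by
        intro x
        change (FiniteField.frobeniusAlgHom F₁ K ^ (d / ℓ)) x = _
        rw [AlgHom.coe_pow, FiniteField.coe_frobeniusAlgHom, pow_iterate,
          ← Nat.card_eq_fintype_card]
      have hx : x ∈ F₁⟮b⟯ := by rw [htop]; trivial
      induction hx using IntermediateField.adjoin_induction with
      | mem x hx => rw [Set.mem_singleton_iff] at hx; rw [hx, hb]
      | algebraMap r => rw [← hf, AlgHom.commutes]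
      | add x y _ _ hx hy => rw [← hf, map_add, hf, hf, hx, hy]
      | inv x _ hx => rw [inv_pow, hx]
      | mul x y _ _ hx hy => rw [mul_pow, hx, hy]
    have h1 := finrank_dvd_of_forall_pow_eq (F := F₁) (L₂ := K) hpow
    rw [hfr] at h1
    have := Nat.le_of_dvd (Nat.div_pos (Nat.le_of_dvd hd0 hℓd) hℓ.pos) h1
    have := Nat.div_lt_self hd0 hℓ.one_lt
    omega

/-- The class of linear maps that act like `b` on a quotient isomorphic to `F₁(b)` and like a
generator of a field on the kernel. -/
theorem exists_isTwoBlockClass {V : Type*} [AddCommGroup V] [Module F₁ V]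
    [FiniteDimensional F₁ V] {d : ℕ} (hd : Nat.card K = Nat.card F₁ ^ d)
    (hdn : d < finrank F₁ V - finrank F₁ V / (finrank F₁ V).minFac) (b : K) :
    ∃ X : Set (Module.End F₁ V), IsTwoBlockClass F₁ (finrank F₁ F₁⟮b⟯) X ∧
      ∀ A ∈ X, ∃ ρ : V →ₗ[F₁] K, ρ ≠ 0 ∧ ∀ v, ρ (A v) = b * ρ v := by
  set e := finrank F₁ F₁⟮b⟯ with he
  set n := finrank F₁ V
  have hed : e ≤ d := by
    rw [← finrank_eq_of_natCard_eq hd]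
    exact Submodule.finrank_le (F₁⟮b⟯.toSubalgebra.toSubmodule)
  have he0 : 0 < e := Module.finrank_pos
  have hdn' : d < n := hdn.trans_le (Nat.sub_le _ _)
  obtain ⟨p, hchar⟩ := CharP.exists F₁
  have : Fact p.Prime := ⟨CharP.char_is_prime F₁ p⟩
  have : NeZero (n - e) := ⟨by omega⟩
  let L := FiniteField.Extension F₁ p (n - e)
  have hL : finrank F₁ L = n - e := FiniteField.finrank_extension F₁ p (n - e)
  obtain ⟨γ, -, hγ⟩ := exists_pow_eq_of_finite L
  have hint : IsIntegral F₁ b := Algebra.IsIntegral.isIntegral b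
  have hb : Algebra.adjoin F₁ {AdjoinSimple.gen F₁ b} = ⊤ := by
    rw [← adjoin.powerBasis_gen hint]
    exact PowerBasis.adjoin_gen_eq_top _
  have hdvd : ¬ finrank F₁ L ∣ finrank F₁ F₁⟮b⟯ := by
    rw [hL, ← he]
    rintro ⟨c, hc⟩
    -- otherwise `n` is a multiple of `n - e`, and `n - e ≤ n / n.minFac`
    have hc0 : 0 < c := Nat.pos_of_ne_zero fun h => by rw [h] at hc; omega
    have hn : n = (n - e) * (c + 1) := by rw [mul_add, ← hc]; omega
    have h3 : n.minFac ≤ c + 1 := Nat.minFac_le_of_dvd (by omega) (Dvd.intro_left _ hn.symm)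
    have h4 : n / (c + 1) ≤ n / n.minFac := Nat.div_le_div_left h3 (Nat.minFac_pos _)
    have h5 : n / (c + 1) = n - e := Nat.div_eq_of_eq_mul_left (by omega) hn
    omega
  refine ⟨conjSet V (mulEnd F₁ (AdjoinSimple.gen F₁ b, γ)),
    isTwoBlockClass_conjSet_pair hb hγ hdvd (by rw [hL, ← he]; change e + (n - e) = n; omega), ?_⟩
  rintro A ⟨φ, hφ⟩
  refine ⟨(F₁⟮b⟯.val.toLinearMap ∘ₗ LinearMap.fst F₁ F₁⟮b⟯ L) ∘ₗ φ.symm, fun h => ?_, fun v => ?_⟩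
  · have := LinearMap.congr_fun h (φ (1, 0))
    simp at this
  · obtain ⟨x, rfl⟩ := φ.surjective v
    rw [hφ]
    simp

end

/-! ### Covers that contain all complements -/

namespace AffineMatrixRing

open IntermediateField

variable {K : Type*} [Field K] {n : ℕ} {F₁ F₂ : Subfield K}

/-- If `A` acts like `b` on a nonzero quotient of `F₁ ^ n` inside `K`, then `b - A` is not
surjective on `K ^ n`. -/
theorem exists_forall_notMem_complement {A : Matrix (Fin n) (Fin n) F₁} {b : F₂}
    {ρ : (Fin n → F₁) →ₗ[F₁] K} (hρ : ρ ≠ 0) (h : ∀ v, ρ (A.mulVec v) = (b : K) * ρ v) :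
    ∃ w, ∀ v, mk A w b ∉ complement F₁ F₂ v := by
  classical
  let x : Fin n → K := fun i => ρ (Pi.single i 1)
  have hρx : ∀ v, ρ v = ∑ i, (v i : K) * x i := by
    intro v
    conv_lhs => rw [pi_eq_sum_univ' v, map_sum]
    refine Finset.sum_congr rfl fun i _ => ?_
    rw [map_smul, Subfield.smul_def, smul_eq_mul]
  have hxA : ∀ j, ∑ i, x i * (A i j : K) = (b : K) * x j := by
    intro j
    rw [← h, hρx]
    refine Finset.sum_congr rfl fun i _ => ?_
    rw [Matrix.mulVec_single_one, mul_comm]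
    rfl
  obtain ⟨i, hi⟩ : ∃ i, x i ≠ 0 := by
    by_contra! h0
    exact hρ (LinearMap.ext fun v => by simp [hρx, h0])
  refine ⟨Pi.single i 1, fun v hv => ?_⟩
  rw [mem_complement, toW_mk, toB_mk, toA_mk] at hv
  have h1 : ∑ j, x j * (Pi.single i 1 : Fin n → K) j = x i := by
    simp [Pi.single_apply]
  have h2 : ∑ j, x j * ((b : K) • v - act A v) j = 0 := by
    simp only [Pi.sub_apply, Pi.smul_apply, smul_eq_mul, mul_sub, Finset.sum_sub_distrib, act_apply,
      Finset.mul_sum]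
    rw [Finset.sum_comm, sub_eq_zero]
    refine Finset.sum_congr rfl fun j _ => ?_
    simp_rw [← mul_assoc]
    rw [← Finset.sum_mul, hxA, mul_comm (x j)]
  rw [hv, h2] at h1
  exact hi h1.symm

/-- The projection of a subring to the linear maps on `F₁ ^ n`. -/
def mapEnd (T : NonUnitalSubring (affineMatrixRing n F₁ F₂)) :
    NonUnitalSubring (Module.End F₁ (Fin n → F₁)) :=
  (mapA T).map ((Matrix.toLinAlgEquiv' : Matrix (Fin n) (Fin n) F₁ ≃ₐ[F₁] _) :
    Matrix (Fin n) (Fin n) F₁ →ₙ+* _)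

theorem mem_mapEnd {T : NonUnitalSubring (affineMatrixRing n F₁ F₂)}
    {r : affineMatrixRing n F₁ F₂} (hr : r ∈ T) : Matrix.toLinAlgEquiv' (toA r) ∈ mapEnd T :=
  ⟨toA r, ⟨r, hr, rfl⟩, rfl⟩

theorem mapEnd_ne_top {T : NonUnitalSubring (affineMatrixRing n F₁ F₂)} (h : mapA T ≠ ⊤) :
    mapEnd T ≠ ⊤ := by
  intro h1
  refine h (eq_top_iff.2 fun A _ => ?_)
  have h2 : Matrix.toLinAlgEquiv' A ∈ mapEnd T := by rw [h1]; trivial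
  obtain ⟨B, hB, hBA⟩ := h2
  exact Matrix.toLinAlgEquiv'.injective hBA ▸ hB

theorem finite_nonUnitalSubring [Finite K] : Finite (NonUnitalSubring (affineMatrixRing n F₁ F₂)) :=
  Finite.of_injective (fun T => (T : Set (affineMatrixRing n F₁ F₂))) SetLike.coe_injective

/-- A cover containing all complements must, in addition, cover the pairs `(A, b)` for which `b - A`
is not surjective. For generators `b` of `F₂` this takes subrings with a proper projection to the
matrices. For elements `b` of smaller degrees it takes either more of these, or, for every prime
divisor of `d`, one more subring, with a proper projection to `F₂`. -/
theorem le_encard_of_complement_mem [Finite K] (hK : F₁ ⊔ F₂ = ⊤) (hn : 2 ≤ n) {d : ℕ}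
    (hd : Nat.card K = Nat.card F₁ ^ d) (hd0 : 0 < d) (hdn : d < n - n / n.minFac)
    {C : Set (NonUnitalSubring (affineMatrixRing n F₁ F₂))} (hC : IsRingCover C)
    (hS : ∀ v, complement F₁ F₂ v ∈ C) :
    ((Nat.card K ^ n + subspaceCard F₁ (Fin n → F₁) d +
      ArithmeticFunction.cardDistinctFactors d : ℕ) : ℕ∞) ≤ C.encard := by
  classical
  have := finite_nonUnitalSubring (n := n) (F₁ := F₁) (F₂ := F₂)
  have hV : finrank F₁ (Fin n → F₁) = n := Module.finrank_fin_fun F₁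
  have hrange : Set.range (complement (n := n) F₁ F₂) ⊆ C := by
    rintro _ ⟨v, rfl⟩
    exact hS v
  have hfin : (C \ Set.range (complement (n := n) F₁ F₂)).Finite := Set.toFinite _
  obtain ⟨C', hC'⟩ : ∃ C' : Finset (NonUnitalSubring (affineMatrixRing n F₁ F₂)),
      (C' : Set _) = C \ Set.range (complement (n := n) F₁ F₂) := ⟨hfin.toFinset, by simp⟩
  have hmem : ∀ T ∈ C', T ∈ C ∧ ∀ v, T ≠ complement F₁ F₂ v := by
    intro T hT
    have : T ∈ (C' : Set _) := hT
    rw [hC'] at this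
    exact ⟨this.1, fun v hv => this.2 ⟨v, hv.symm⟩⟩
  rw [← Set.encard_sdiff_add_encard_of_subset hrange, encard_range_complement, ← hC',
    Set.encard_coe_eq_coe_finsetCard, ← Nat.cast_add, Nat.cast_le]
  suffices hsuff : subspaceCard F₁ (Fin n → F₁) d + ArithmeticFunction.cardDistinctFactors d ≤
      C'.card by omega
  have hproj : ∀ T ∈ C', ¬ ProjectsOnto T := by
    intro T hT hp
    obtain ⟨hTC, hTv⟩ := hmem T hT
    rcases eq_top_or_eq_complement hK hp with h | ⟨v, h⟩
    exacts [hC.1 T hTC h, hTv v h]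
  -- every pair `(A, b)` with `b - A` not surjective is hit by `C'`
  have hhit : ∀ (A : Module.End F₁ (Fin n → F₁)) (b : F₂),
      (∃ ρ : (Fin n → F₁) →ₗ[F₁] K, ρ ≠ 0 ∧ ∀ v, ρ (A v) = (b : K) * ρ v) →
      ∃ T ∈ C', A ∈ mapEnd T ∧ ∃ r ∈ T, toB r = b := by
    rintro A b ⟨ρ, hρ, h⟩
    obtain ⟨w, hw⟩ := exists_forall_notMem_complement (A := Matrix.toLinAlgEquiv'.symm A) (b := b)
      hρ fun v => by
        rw [← Matrix.toLinAlgEquiv'_apply, AlgEquiv.apply_symm_apply, h]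
    obtain ⟨T, hT, hTw⟩ := hC.2 (mk (Matrix.toLinAlgEquiv'.symm A) w b)
    refine ⟨T, ?_, ?_, _, hTw, toB_mk _ _ _⟩
    · rw [← Finset.mem_coe, hC']
      refine ⟨hT, ?_⟩
      rintro ⟨v, rfl⟩
      exact hw v hTw
    · have := mem_mapEnd hTw
      rwa [toA_mk, AlgEquiv.apply_symm_apply] at this
  obtain ⟨g, hg1, hg2⟩ := exists_partial_generators hK hd
  obtain ⟨γ, -, hγ⟩ := exists_pow_eq_of_finite F₂
  set S₁ := C'.filter fun T => ∀ b, ∃ r ∈ T, toB r = b with hS₁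
  set S₂ := C'.filter fun T => ¬ ∀ b, ∃ r ∈ T, toB r = b with hS₂
  have hsum : S₁.card + S₂.card = C'.card := Finset.card_filter_add_card_filter_not _
  have hS₁top : ∀ P ∈ S₁.image mapEnd, P ≠ ⊤ := by
    intro P hP
    obtain ⟨T, hT, rfl⟩ := Finset.mem_image.1 hP
    obtain ⟨hTC, hTb⟩ := Finset.mem_filter.1 hT
    refine mapEnd_ne_top fun h => hproj T hTC (projectsOnto_of_surjective hn (fun A => ?_) hTb)
    have : A ∈ mapA T := by rw [h]; trivial
    exact this
  obtain ⟨X, hX, hXρ⟩ := exists_isTwoBlockClass (V := Fin n → F₁) hd (by rwa [hV]) (γ : K)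
  have hXd : finrank F₁ F₁⟮(γ : K)⟯ = d := by
    rw [adjoin_eq_top_of_generator hK (isRingGenerator_of_pow hγ), IntermediateField.finrank_top',
      finrank_eq_of_natCard_eq hd]
  rw [hXd] at hX
  have hXcov : ∀ A ∈ X, ∃ P ∈ S₁.image mapEnd, A ∈ P := by
    intro A hA
    obtain ⟨T, hT, hAT, hTb⟩ := hhit A γ (hXρ A hA)
    exact ⟨mapEnd T, Finset.mem_image_of_mem _
      (Finset.mem_filter.2 ⟨hT, surjective_toB_of_generator hγ hTb⟩), hAT⟩
  by_cases hcase : ∀ ℓ ∈ d.primeFactors, ∃ T ∈ S₂, ∃ r ∈ T, toB r = g ℓ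
  · have h1 := hX.subspaceCard_le_card (by rwa [hV]) hS₁top hXcov
    have h2 : d.primeFactors.card ≤ S₂.card := by
      choose! f hf hfg using hcase
      refine Finset.card_le_card_of_injOn f (fun ℓ hℓ => hf ℓ hℓ) fun ℓ hℓ ℓ' hℓ' h => ?_
      by_contra hne
      refine (Finset.mem_filter.1 (hf ℓ hℓ)).2 fun b => ?_
      have h3 := hg2 ℓ ℓ' (Nat.prime_of_mem_primeFactors hℓ) (Nat.prime_of_mem_primeFactors hℓ')
        (Nat.dvd_of_mem_primeFactors hℓ) (Nat.dvd_of_mem_primeFactors hℓ') hne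
        ((f ℓ).map (toB : affineMatrixRing n F₁ F₂ →+* F₂)) (hfg ℓ hℓ)
        (by rw [h]; exact hfg ℓ' hℓ')
      have h4 : b ∈ (f ℓ).map (toB : affineMatrixRing n F₁ F₂ →+* F₂) := by rw [h3]; trivial
      exact h4
    have h3 := Finset.card_image_le (s := S₁) (f := mapEnd)
    have h4 : ArithmeticFunction.cardDistinctFactors d = d.primeFactors.card := rfl
    omega
  · push Not at hcase
    obtain ⟨ℓ, hℓ, hno⟩ := hcase
    have hℓp := Nat.prime_of_mem_primeFactors hℓ
    have hℓd := Nat.dvd_of_mem_primeFactors hℓ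
    obtain ⟨Y, hY, hYρ⟩ := exists_isTwoBlockClass (V := Fin n → F₁) hd (by rwa [hV]) (g ℓ : K)
    have hlt : finrank F₁ F₁⟮(g ℓ : K)⟯ < d := finrank_adjoin_lt hd hℓp hℓd hd0 (by
      have := congrArg (Subtype.val : F₂ → K) (hg1 ℓ hℓp hℓd)
      rwa [SubmonoidClass.coe_pow] at this)
    have hdvd : finrank F₁ F₁⟮(g ℓ : K)⟯ ∣ d := by
      rw [← finrank_eq_of_natCard_eq hd, ← Module.finrank_mul_finrank F₁ F₁⟮(g ℓ : K)⟯ K]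
      exact dvd_mul_right _ _
    have hYcov : ∀ A ∈ Y, ∃ P ∈ S₁.image mapEnd, A ∈ P := by
      intro A hA
      obtain ⟨T, hT, hAT, r, hr, hrb⟩ := hhit A (g ℓ) (hYρ A hA)
      refine ⟨mapEnd T, Finset.mem_image_of_mem _ (Finset.mem_filter.2 ⟨hT, ?_⟩), hAT⟩
      by_contra hTb
      exact hno T (Finset.mem_filter.2 ⟨hT, hTb⟩) r hr hrb
    have h1 := hY.subspaceCard_add_subspaceCard_le_card hX hdvd hlt (by rwa [hV]) hS₁top hYcov
      hXcov
    have h2 := Finset.card_image_le (s := S₁) (f := mapEnd)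
    have h3 := cardDistinctFactors_lt hd0
    set e := finrank F₁ F₁⟮(g ℓ : K)⟯
    have he0 : 0 < e := hY.pos
    have hdn' : d < n := hdn.trans_le (Nat.sub_le _ _)
    have h4 : d < subspaceCard F₁ (Fin n → F₁) e := by
      have h5 := pow_le_subspaceCard F₁ (Fin n → F₁) (k := e) (by rw [hV]; omega)
      rw [hV] at h5
      refine lt_of_lt_of_le ?_ h5
      have h6 : d ≤ e * (n - e) := by
        obtain ⟨j, hj⟩ : ∃ j, n = e + (j + 1) := ⟨n - e - 1, by omega⟩
        rw [hj, Nat.add_sub_cancel_left]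
        nlinarith
      exact (Nat.lt_two_pow_self).trans_le ((Nat.pow_le_pow_right (by norm_num) h6).trans
        (Nat.pow_le_pow_left (two_le_natCard F₁) _))
    omega

end AffineMatrixRing

/-! ### A cover of the ring of block matrices -/

namespace AffineMatrixRing

open IntermediateField

variable {K : Type*} [Field K] {n : ℕ} {F₁ F₂ : Subfield K}

/-- The block matrices whose lower right entry is fixed by `f`. -/
def fixedSubring (n : ℕ) (F₁ F₂ : Subfield K) (f : K →+* K) :
    NonUnitalSubring (affineMatrixRing n F₁ F₂) where
  carrier := {r | f (toB r : K) = toB r}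
  mul_mem' := fun {r s} (hr : f (toB r : K) = toB r) (hs : f (toB s : K) = toB s) => by
    change f (toB (r * s) : K) = toB (r * s)
    rw [map_mul, Subfield.coe_mul, map_mul, hr, hs]
  add_mem' := fun {r s} (hr : f (toB r : K) = toB r) (hs : f (toB s : K) = toB s) => by
    change f (toB (r + s) : K) = toB (r + s)
    rw [map_add, Subfield.coe_add, map_add, hr, hs]
  zero_mem' := by
    change f (toB (0 : affineMatrixRing n F₁ F₂) : K) = toB (0 : affineMatrixRing n F₁ F₂)
    simp
  neg_mem' := fun {r} (hr : f (toB r : K) = toB r) => by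
    change f (toB (-r) : K) = toB (-r)
    rw [map_neg, Subfield.coe_neg, map_neg, hr]

theorem mem_fixedSubring {f : K →+* K} {r : affineMatrixRing n F₁ F₂} :
    r ∈ fixedSubring n F₁ F₂ f ↔ f (toB r : K) = toB r := Iff.rfl

/-- The block matrices whose upper left block preserves `U`. -/
def stabilizer (F₂ : Subfield K) (U : Submodule F₁ (Fin n → F₁)) :
    NonUnitalSubring (affineMatrixRing n F₁ F₂) :=
  (stabilizerSubring U).comap
    ((((Matrix.toLinAlgEquiv' : Matrix (Fin n) (Fin n) F₁ ≃ₐ[F₁] _) :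
      Matrix (Fin n) (Fin n) F₁ →+* Module.End F₁ (Fin n → F₁)).comp toA :
        affineMatrixRing n F₁ F₂ →+* Module.End F₁ (Fin n → F₁)) : affineMatrixRing n F₁ F₂ →ₙ+* _)

theorem mem_stabilizer {U : Submodule F₁ (Fin n → F₁)} {r : affineMatrixRing n F₁ F₂} :
    r ∈ stabilizer F₂ U ↔ ∀ u ∈ U, (toA r).mulVec u ∈ U := Iff.rfl

theorem mk_mem_stabilizer {U : Submodule F₁ (Fin n → F₁)} {t : Module.End F₁ (Fin n → F₁)}
    {w : Fin n → K} {b : F₂} :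
    mk (Matrix.toLinAlgEquiv'.symm t) w b ∈ stabilizer F₂ U ↔ t ∈ stabilizerSubring U := by
  rw [mem_stabilizer, toA_mk, mem_stabilizerSubring]
  simp_rw [← Matrix.toLinAlgEquiv'_apply, AlgEquiv.apply_symm_apply]

theorem not_projectsOnto_stabilizer {U : Submodule F₁ (Fin n → F₁)} (h0 : U ≠ ⊥) (h1 : U ≠ ⊤) :
    ¬ ProjectsOnto (stabilizer F₂ U) := by
  intro h
  refine stabilizerSubring_ne_top h0 h1 (eq_top_iff.2 fun t _ => ?_)
  obtain ⟨w, hw⟩ := h (Matrix.toLinAlgEquiv'.symm t) 0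
  exact mk_mem_stabilizer.1 hw

theorem stabilizer_injOn (k : ℕ) (hk : k < n) :
    Set.InjOn (stabilizer (n := n) (F₁ := F₁) F₂) {U | finrank F₁ U = k} := by
  intro U hU U' hU' h
  refine (Submodule.eq_of_le_of_finrank_eq (fun u hu => ?_) (hU'.trans hU.symm)).symm
  by_contra hu'
  have hU1 : U' ≠ ⊤ := by
    rintro rfl
    rw [Set.mem_ofPred_eq, finrank_top, Module.finrank_fin_fun] at hU'
    omega
  obtain ⟨w, -, hw⟩ := SetLike.exists_of_lt (lt_top_iff_ne_top.2 hU1)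
  obtain ⟨t, ht0, htu⟩ := exists_end_eq_of_notMem hu' w
  have h1 : mk (Matrix.toLinAlgEquiv'.symm t) (0 : Fin n → K) (0 : F₂) ∈ stabilizer F₂ U :=
    mk_mem_stabilizer.2 fun v hv => by rw [ht0 v hv]; exact U.zero_mem
  rw [h, mk_mem_stabilizer] at h1
  exact hw (htu ▸ h1 u hu)

variable [Finite K]

/-- The automorphism `x ↦ x ^ (|F| ^ k)` of `K`. -/
noncomputable def frobeniusPow (F : Subfield K) (k : ℕ) : K →+* K :=
  letI := Fintype.ofFinite F
  ((FiniteField.frobeniusAlgHom F K ^ k : K →ₐ[F] K) : K →+* K)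

theorem frobeniusPow_apply (F : Subfield K) (k : ℕ) (x : K) :
    frobeniusPow F k x = x ^ Nat.card F ^ k := by
  let := Fintype.ofFinite F
  change (FiniteField.frobeniusAlgHom F K ^ k : K →ₐ[F] K) x = _
  rw [AlgHom.coe_pow, FiniteField.coe_frobeniusAlgHom, pow_iterate, ← Nat.card_eq_fintype_card]

/-- An element outside the maximal intermediate fields generates `K`. -/
theorem adjoin_eq_top_of_forall_ne {d : ℕ} (hd : Nat.card K = Nat.card F₁ ^ d) (hd0 : 0 < d)
    {b : K} (hb : ∀ ℓ ∈ d.primeFactors, frobeniusPow F₁ (d / ℓ) b ≠ b) : F₁⟮b⟯ = ⊤ := by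
  have hfr := finrank_eq_of_natCard_eq hd
  have hmul := Module.finrank_mul_finrank F₁ F₁⟮b⟯ K
  rw [hfr] at hmul
  by_contra hne
  have hlt : finrank F₁⟮b⟯ K ≠ 1 := by
    intro h1
    refine hne (IntermediateField.eq_of_le_of_finrank_eq le_top ?_)
    rw [IntermediateField.finrank_top', hfr, ← hmul, h1, mul_one]
  obtain ⟨ℓ, hℓ, c, hc⟩ := Nat.exists_prime_and_dvd hlt
  refine hb ℓ (Nat.mem_primeFactors.2 ⟨hℓ, ⟨finrank F₁ F₁⟮b⟯ * c, ?_⟩, hd0.ne'⟩) ?_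
  · rw [← hmul, hc, mul_left_comm]
  · rw [frobeniusPow_apply]
    have h1 : (⟨b, mem_adjoin_simple_self F₁ b⟩ : F₁⟮b⟯) ^ Nat.card F₁ ^ finrank F₁ F₁⟮b⟯ =
        ⟨b, mem_adjoin_simple_self F₁ b⟩ := by
      have := Fintype.ofFinite F₁⟮b⟯
      rw [← Module.natCard_eq_pow_finrank (K := F₁), Nat.card_eq_fintype_card,
        FiniteField.pow_card]
    have h2 : b ^ Nat.card F₁ ^ finrank F₁ F₁⟮b⟯ = b := congrArg Subtype.val h1
    refine pow_pow_eq_of_dvd h2 ⟨c, ?_⟩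
    rw [← hmul, hc, mul_left_comm, Nat.mul_div_cancel_left _ hℓ.pos]

/-- If `b` generates `K` over `F₁` and `b - A` is not surjective on `K ^ n`, then a functional that
vanishes on its image maps `F₁ ^ n` onto `K`, and its kernel is an invariant subspace of `A` of
codimension `d`. -/
theorem exists_mem_complement_or_mem_stabilizer {d : ℕ} (hd : Nat.card K = Nat.card F₁ ^ d)
    (r : affineMatrixRing n F₁ F₂) (hb : F₁⟮(toB r : K)⟯ = ⊤) :
    (∃ v, r ∈ complement F₁ F₂ v) ∨
      ∃ U : Submodule F₁ (Fin n → F₁), finrank F₁ U + d = n ∧ r ∈ stabilizer F₂ U := by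
  classical
  set A := toA r with hA
  set b : K := ((toB r : F₂) : K) with hbdef
  let f : (Fin n → K) →ₗ[K] (Fin n → K) :=
    b • LinearMap.id - Matrix.mulVecLin (A.map (fun x : F₁ => (x : K)))
  have hf : ∀ v, f v = b • v - act A v := fun v => rfl
  by_cases hsurj : Function.Surjective f
  · obtain ⟨v, hv⟩ := hsurj (toW r)
    exact Or.inl ⟨v, by rw [mem_complement, ← hv, hf]⟩
  right
  have hrange : LinearMap.range f ≠ ⊤ := fun h => hsurj (LinearMap.range_eq_top.1 h)
  obtain ⟨y, -, hy⟩ := SetLike.exists_of_lt (lt_top_iff_ne_top.2 hrange)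
  obtain ⟨ξ, hξy, hξ⟩ := (LinearMap.range f).exists_dual_map_eq_bot_of_notMem hy inferInstance
  have hξf : ∀ v, ξ (f v) = 0 := by
    intro v
    have : ξ (f v) ∈ (LinearMap.range f).map ξ := ⟨f v, ⟨v, rfl⟩, rfl⟩
    rwa [hξ, Submodule.mem_bot] at this
  let ι : (Fin n → F₁) →ₗ[F₁] (Fin n → K) :=
    { toFun := fun v i => (v i : K)
      map_add' := fun v w => by ext; simp
      map_smul' := fun c v => by ext; simp [Subfield.smul_def] }
  have hι : ∀ v, ι (A.mulVec v) = act A (ι v) := by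
    intro v
    ext i
    simp [ι, act_apply, Matrix.mulVec, dotProduct]
  let ρ : (Fin n → F₁) →ₗ[F₁] K := (ξ.restrictScalars F₁) ∘ₗ ι
  have hρ : ∀ v, ρ (A.mulVec v) = b * ρ v := by
    intro v
    have h1 := hξf (ι v)
    rw [hf, map_sub, map_smul, sub_eq_zero, smul_eq_mul] at h1
    change ξ (ι _) = b * ξ (ι v)
    rw [hι, h1]
  have hρ0 : ∃ v, ρ v ≠ 0 := by
    by_contra! h
    refine hξy ?_
    have h1 : ξ = 0 := by
      refine LinearMap.pi_ext' fun i => LinearMap.ext_ring ?_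
      have h2 := h (Pi.single i 1)
      change ξ (ι (Pi.single i 1)) = 0 at h2
      have h3 : ι (Pi.single i 1) = Pi.single i 1 := by
        ext j
        change ((Pi.single i (1 : F₁) : Fin n → F₁) j : K) = _
        by_cases hij : j = i
        · subst hij; simp
        · simp [hij]
      rw [h3] at h2
      simpa using h2
    rw [h1, LinearMap.zero_apply]
  have hstab : ∀ c : K, ∀ z ∈ LinearMap.range ρ, c * z ∈ LinearMap.range ρ := by
    intro c
    have hc : c ∈ F₁⟮b⟯ := by rw [hb]; trivial
    rw [← IntermediateField.mem_toSubalgebra,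
      IntermediateField.adjoin_simple_toSubalgebra_of_isAlgebraic
        (Algebra.IsAlgebraic.isAlgebraic b)]
      at hc
    induction hc using Algebra.adjoin_induction with
    | mem x hx =>
      rw [Set.mem_singleton_iff] at hx
      rintro _ ⟨v, rfl⟩
      exact ⟨A.mulVec v, by rw [hρ, hx]⟩
    | algebraMap a =>
      intro z hz
      rw [← Algebra.smul_def]
      exact Submodule.smul_mem _ a hz
    | add x y _ _ hx hy =>
      intro z hz
      rw [add_mul]
      exact Submodule.add_mem _ (hx z hz) (hy z hz)
    | mul x y _ _ hx hy =>
      intro z hz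
      rw [mul_assoc]
      exact hx _ (hy z hz)
  have hρtop : LinearMap.range ρ = ⊤ := by
    obtain ⟨v, hv⟩ := hρ0
    refine eq_top_iff.2 fun z _ => ?_
    have := hstab (z / ρ v) (ρ v) ⟨v, rfl⟩
    rwa [div_mul_cancel₀ _ hv] at this
  refine ⟨LinearMap.ker ρ, ?_, fun u hu => ?_⟩
  · have h1 := LinearMap.finrank_range_add_finrank_ker ρ
    rw [hρtop, finrank_top, finrank_eq_of_natCard_eq hd, Module.finrank_fin_fun] at h1
    omega
  · rw [LinearMap.mem_ker] at hu ⊢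
    change ρ (A.mulVec u) = 0
    rw [hρ, hu, mul_zero]

/-- The complements, the stabilizers of subspaces of codimension `d`, and the subrings with lower
right entry in a maximal intermediate field form a cover. -/
theorem exists_isRingCover (hK : F₁ ⊔ F₂ = ⊤) {d : ℕ}
    (hd : Nat.card K = Nat.card F₁ ^ d) (hd0 : 0 < d) (hdn : d < n) :
    ∃ C : Set (NonUnitalSubring (affineMatrixRing n F₁ F₂)), IsRingCover C ∧
      C.encard = ((Nat.card K ^ n + subspaceCard F₁ (Fin n → F₁) d +
        ArithmeticFunction.cardDistinctFactors d : ℕ) : ℕ∞) := by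
  classical
  have hV : finrank F₁ (Fin n → F₁) = n := Module.finrank_fin_fun F₁
  obtain ⟨g, hg1, hg2⟩ := exists_partial_generators hK hd
  obtain ⟨γ, -, hγ⟩ := exists_pow_eq_of_finite F₂
  have hfixed : ∀ ℓ ∈ d.primeFactors, ∃ b : F₂, ∀ (A : Matrix (Fin n) (Fin n) F₁) w,
      mk A w b ∉ fixedSubring n F₁ F₂ (frobeniusPow F₁ (d / ℓ)) := by
    intro ℓ hℓ
    refine ⟨γ, fun A w h => ?_⟩
    rw [mem_fixedSubring, toB_mk, frobeniusPow_apply] at h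
    have h1 := finrank_adjoin_lt hd (Nat.prime_of_mem_primeFactors hℓ)
      (Nat.dvd_of_mem_primeFactors hℓ) hd0 h
    rw [adjoin_eq_top_of_generator hK (isRingGenerator_of_pow hγ), IntermediateField.finrank_top',
      finrank_eq_of_natCard_eq hd] at h1
    exact lt_irrefl _ h1
  have hUne : ∀ U : Submodule F₁ (Fin n → F₁), finrank F₁ U = n - d → U ≠ ⊥ ∧ U ≠ ⊤ := by
    intro U hU
    constructor
    · rintro rfl
      rw [finrank_bot] at hU
      omega
    · rintro rfl
      rw [finrank_top, hV] at hU
      omega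
  let C₁ := Set.range (complement (n := n) F₁ F₂)
  let C₂ := stabilizer F₂ '' {U : Submodule F₁ (Fin n → F₁) | finrank F₁ U = n - d}
  let C₃ := (fun ℓ => fixedSubring n F₁ F₂ (frobeniusPow F₁ (d / ℓ))) '' (d.primeFactors : Set ℕ)
  have h12 : Disjoint C₁ C₂ := by
    rw [Set.disjoint_left]
    rintro _ ⟨v, rfl⟩ ⟨U, hU, hUv⟩
    exact not_projectsOnto_stabilizer (hUne U hU).1 (hUne U hU).2 (hUv ▸ projectsOnto_complement v)
  have h123 : Disjoint (C₁ ∪ C₂) C₃ := by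
    rw [Set.disjoint_left]
    rintro T hT ⟨ℓ, hℓ, rfl⟩
    obtain ⟨b, hb⟩ := hfixed ℓ hℓ
    rcases hT with ⟨v, hv⟩ | ⟨U, hU, hUv⟩
    · obtain ⟨w, hw⟩ := projectsOnto_complement v (0 : Matrix (Fin n) (Fin n) F₁) b
      rw [hv] at hw
      exact hb _ _ hw
    · have h1 : mk (0 : Matrix (Fin n) (Fin n) F₁) (0 : Fin n → K) b ∈ stabilizer F₂ U := by
        rw [mem_stabilizer, toA_mk]
        intro u _
        rw [Matrix.zero_mulVec]
        exact U.zero_mem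
      rw [hUv] at h1
      exact hb _ _ h1
  refine ⟨C₁ ∪ C₂ ∪ C₃, ⟨?_, fun r => ?_⟩, ?_⟩
  · rintro T ((⟨v, rfl⟩ | ⟨U, hU, rfl⟩) | ⟨ℓ, hℓ, rfl⟩)
    · exact complement_ne_top (by omega) v
    · intro h
      refine not_projectsOnto_stabilizer (F₂ := F₂) (hUne U hU).1 (hUne U hU).2 fun A b => ⟨0, ?_⟩
      rw [h]
      trivial
    · intro h
      obtain ⟨b, hb⟩ := hfixed ℓ hℓ
      refine hb 0 0 ?_
      change _ ∈ (fun ℓ => fixedSubring n F₁ F₂ (frobeniusPow F₁ (d / ℓ))) ℓ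
      rw [h]
      trivial
  · by_cases hr : ∃ ℓ ∈ d.primeFactors, frobeniusPow F₁ (d / ℓ) (toB r : K) = toB r
    · obtain ⟨ℓ, hℓ, h⟩ := hr
      exact ⟨_, Or.inr ⟨ℓ, hℓ, rfl⟩, h⟩
    push Not at hr
    rcases exists_mem_complement_or_mem_stabilizer hd r (adjoin_eq_top_of_forall_ne hd hd0 hr) with
      ⟨v, hv⟩ | ⟨U, hU, hrU⟩
    · exact ⟨_, Or.inl (Or.inl ⟨v, rfl⟩), hv⟩
    · exact ⟨_, Or.inl (Or.inr ⟨U, by rw [Set.mem_ofPred_eq]; omega, rfl⟩), hrU⟩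
  · have hfinSub : Finite (Submodule F₁ (Fin n → F₁)) := inferInstance
    have hC₂ : C₂.encard = (subspaceCard F₁ (Fin n → F₁) d : ℕ∞) := by
      rw [(stabilizer_injOn (n - d) (by omega)).encard_image,
        ← Set.Finite.cast_ncard_eq (Set.toFinite _), ← Nat.card_coe_set_eq,
        ← subspaceCard_symm F₁ (Fin n → F₁) (k := d) (by omega), hV]
      rfl
    have hinj : Set.InjOn (fun ℓ => fixedSubring n F₁ F₂ (frobeniusPow F₁ (d / ℓ)))
        (d.primeFactors : Set ℕ) := by
      intro ℓ hℓ ℓ' hℓ' h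
      by_contra hne
      have hℓp := Nat.prime_of_mem_primeFactors hℓ
      have hℓp' := Nat.prime_of_mem_primeFactors hℓ'
      have hℓd := Nat.dvd_of_mem_primeFactors hℓ
      have hℓd' := Nat.dvd_of_mem_primeFactors hℓ'
      have hmem : ∀ ℓ, ℓ.Prime → ℓ ∣ d → mk (0 : Matrix (Fin n) (Fin n) F₁) (0 : Fin n → K) (g ℓ) ∈
          fixedSubring n F₁ F₂ (frobeniusPow F₁ (d / ℓ)) := by
        intro ℓ hℓ hℓd
        rw [mem_fixedSubring, toB_mk, frobeniusPow_apply, ← SubmonoidClass.coe_pow, hg1 ℓ hℓ hℓd]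
      have h1 := hmem ℓ' hℓp' hℓd'
      have h2 : fixedSubring n F₁ F₂ (frobeniusPow F₁ (d / ℓ)) =
        fixedSubring n F₁ F₂ (frobeniusPow F₁ (d / ℓ')) := h
      rw [← h2] at h1
      have htop := hg2 ℓ ℓ' hℓp hℓp' hℓd hℓd' hne
        ((fixedSubring n F₁ F₂ (frobeniusPow F₁ (d / ℓ))).map
          (toB : affineMatrixRing n F₁ F₂ →+* F₂))
        ⟨_, hmem ℓ hℓp hℓd, toB_mk _ _ _⟩ ⟨_, h1, toB_mk _ _ _⟩
      obtain ⟨b, hb⟩ := hfixed ℓ hℓ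
      have hbmem : b ∈ (fixedSubring n F₁ F₂ (frobeniusPow F₁ (d / ℓ))).map
          (toB : affineMatrixRing n F₁ F₂ →+* F₂) := by rw [htop]; trivial
      obtain ⟨r, hr, hrb⟩ := hbmem
      change toB r = b at hrb
      refine hb 0 0 ?_
      rw [mem_fixedSubring, toB_mk, ← hrb]
      exact hr
    have hC₃ : C₃.encard = (ArithmeticFunction.cardDistinctFactors d : ℕ∞) := by
      rw [hinj.encard_image, Set.encard_coe_eq_coe_finsetCard]
      rfl
    rw [Set.encard_union_eq h123, Set.encard_union_eq h12, hC₂, hC₃, encard_range_complement]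
    push_cast
    rfl

end AffineMatrixRing

/-! ### Covering numbers of the ring of block matrices -/

namespace AffineMatrixRing

variable {K : Type*} [Field K] [Finite K] {n : ℕ} {F₁ F₂ : Subfield K}

theorem coveringNumber_matrix_eq_end {F : Type*} [Field F] :
    coveringNumber (Matrix (Fin n) (Fin n) F) = coveringNumber (Module.End F (Fin n → F)) :=
  coveringNumber_eq_of_ringEquiv
    (Matrix.toLinAlgEquiv' : Matrix (Fin n) (Fin n) F ≃ₐ[F] _).toRingEquiv

/-- When `K` is large over `F₁`, a cover of the matrix ring is cheaper than the complements. -/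
theorem coveringNumber_eq_matrix (hK : F₁ ⊔ F₂ = ⊤) (hn : 2 ≤ n) {d : ℕ}
    (hd : Nat.card K = Nat.card F₁ ^ d) (hdn : n - n / n.minFac ≤ d) :
    coveringNumber (affineMatrixRing n F₁ F₂) = coveringNumber (Matrix (Fin n) (Fin n) F₁) := by
  refine le_antisymm coveringNumber_le_matrix (le_iInf₂ fun C hC => ?_)
  by_cases hS : ∀ v, complement F₁ F₂ v ∈ C
  · have h1 : (Set.range (complement (n := n) F₁ F₂)).encard ≤ C.encard :=
      Set.encard_le_encard (by rintro _ ⟨v, rfl⟩; exact hS v)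
    rw [encard_range_complement] at h1
    refine le_trans ?_ h1
    have hV : finrank F₁ (Fin n → F₁) = n := Module.finrank_fin_fun F₁
    have h2 := coveringNumber_end_le (F := F₁) (V := Fin n → F₁) (by rwa [hV])
    rw [coveringNumber_matrix_eq_end]
    refine h2.trans (Nat.cast_le.2 ?_)
    rw [hV, hd, ← pow_mul, ← pow_mul, mul_comm d]
    exact Nat.pow_le_pow_right (Nat.lt_of_lt_of_le (by norm_num) (two_le_natCard F₁))
      (Nat.mul_le_mul_left _ hdn)
  · push Not at hS
    obtain ⟨v, hv⟩ := hS
    exact coveringNumber_matrix_le_of_notMem hK hn hC hv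

theorem not_isSigmaElementary (hK : F₁ ⊔ F₂ = ⊤) (hn : 2 ≤ n) {d : ℕ}
    (hd : Nat.card K = Nat.card F₁ ^ d) (hdn : n - n / n.minFac ≤ d) :
    ¬ IsSigmaElementary (affineMatrixRing n F₁ F₂) := fun h => by
  have h1 := coveringNumber_lt_matrix_of_isSigmaElementary h
  rw [coveringNumber_eq_matrix hK hn hd hdn] at h1
  exact lt_irrefl _ h1

/-- A cover either contains all complements or is as large as a cover of the matrix ring. -/
theorem min_le_coveringNumber (hK : F₁ ⊔ F₂ = ⊤) (hn : 2 ≤ n) {d : ℕ}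
    (hd : Nat.card K = Nat.card F₁ ^ d) (hd0 : 0 < d) (hdn : d < n - n / n.minFac) :
    min ((Nat.card K ^ n + subspaceCard F₁ (Fin n → F₁) d +
      ArithmeticFunction.cardDistinctFactors d : ℕ) : ℕ∞)
      (coveringNumber (Matrix (Fin n) (Fin n) F₁)) ≤
      coveringNumber (affineMatrixRing n F₁ F₂) := by
  refine le_iInf₂ fun C hC => ?_
  by_cases hS : ∀ v, complement F₁ F₂ v ∈ C
  · exact (min_le_left _ _).trans (le_encard_of_complement_mem hK hn hd hd0 hdn hC hS)
  · push Not at hS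
    obtain ⟨v, hv⟩ := hS
    exact (min_le_right _ _).trans (coveringNumber_matrix_le_of_notMem hK hn hC hv)

theorem lt_coveringNumber_matrix (hn : 3 ≤ n) {d : ℕ}
    (hd : Nat.card K = Nat.card F₁ ^ d) (hd0 : 0 < d) (hdn : d < n - n / n.minFac)
    (h32 : ¬ (n = 3 ∧ Nat.card F₁ = 2)) :
    ((Nat.card K ^ n + subspaceCard F₁ (Fin n → F₁) d +
      ArithmeticFunction.cardDistinctFactors d : ℕ) : ℕ∞) <
      coveringNumber (Matrix (Fin n) (Fin n) F₁) := by
  have hV : finrank F₁ (Fin n → F₁) = n := Module.finrank_fin_fun F₁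
  rw [coveringNumber_matrix_eq_end]
  refine lt_of_lt_of_le ?_ (add_one_le_coveringNumber_end hV hn hd0 hdn h32)
  rw [hd, ← pow_mul, mul_comm d]
  exact Nat.cast_lt.2 (Nat.lt_succ_self _)

end AffineMatrixRing

open AffineMatrixRing

theorem corollary3 {K : Type*} [Field K] [Finite K] (F₁ F₂ : Subfield K) (hK : F₁ ⊔ F₂ = ⊤)
    (n q₁ q₂ q d : ℕ) (hq₁ : Nat.card F₁ = q₁) (hq₂ : Nat.card F₂ = q₂) (hq : Nat.card K = q)
    (hd : q = q₁ ^ d) :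
    -- the main range: `n ≥ 3` and `d < n - n / a`, with `a` the smallest prime divisor of `n`
    (3 ≤ n → d < n - n / n.minFac →
      (∃ C : Set (NonUnitalSubring (affineMatrixRing n F₁ F₂)), IsRingCover C ∧
        C.encard =
          ((q ^ n + qBinomial n d q₁ + ArithmeticFunction.cardDistinctFactors d : ℕ) : ℕ∞)) ∧
      (IsSigmaElementary (affineMatrixRing n F₁ F₂) →
        coveringNumber (affineMatrixRing n F₁ F₂) =
          ((q ^ n + qBinomial n d q₁ + ArithmeticFunction.cardDistinctFactors d : ℕ) : ℕ∞)) ∧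
      coveringNumber (affineMatrixRing n F₁ F₂) ≤ coveringNumber (Matrix (Fin n) (Fin n) F₁) ∧
      (coveringNumber (affineMatrixRing n F₁ F₂) = coveringNumber (Matrix (Fin n) (Fin n) F₁) →
        n = 3 ∧ q₁ = 2) ∧
      (¬ (n = 3 ∧ q₁ = 2) → IsSigmaElementary (affineMatrixRing n F₁ F₂))) ∧
    -- the complementary range for `n ≥ 2`, which contains all of `n = 2`
    (2 ≤ n → n - n / n.minFac ≤ d →
      ¬ IsSigmaElementary (affineMatrixRing n F₁ F₂) ∧
      coveringNumber (affineMatrixRing n F₁ F₂) = coveringNumber (Matrix (Fin n) (Fin n) F₁)) ∧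
    (n = 2 → ¬ IsSigmaElementary (affineMatrixRing n F₁ F₂)) ∧
    -- the case `n = 1`
    (n = 1 →
      (IsSigmaElementary (affineMatrixRing n F₁ F₂) ↔
        ¬ (q₁ = 2 ∧ q₂ = 2) ∧ ¬ (q₁ = 4 ∧ q₂ = 4)) ∧
      (q₁ = 2 ∧ q₂ = 2 → coveringNumber (affineMatrixRing n F₁ F₂) = 3) ∧
      (q₁ = 4 ∧ q₂ = 4 → coveringNumber (affineMatrixRing n F₁ F₂) = 4) ∧
      (¬ (q₁ = 2 ∧ q₂ = 2) → ¬ (q₁ = 4 ∧ q₂ = 4) →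
        coveringNumber (affineMatrixRing n F₁ F₂) = ((q + 1 : ℕ) : ℕ∞))) := by
  have hd' : Nat.card K = Nat.card F₁ ^ d := by rw [hq, hq₁, hd]
  have hd0 : 0 < d := by
    refine Nat.pos_of_ne_zero fun h => ?_
    have := two_le_natCard K
    rw [hd', h, pow_zero] at this
    omega
  have hV : Module.finrank F₁ (Fin n → F₁) = n := Module.finrank_fin_fun F₁
  refine ⟨fun hn hdn => ?_, fun hn hdn => ?_, fun hn => ?_, fun hn => ?_⟩
  · have hdn' : d < n := hdn.trans_le (Nat.sub_le _ _)
    have hN : subspaceCard F₁ (Fin n → F₁) d = qBinomial n d q₁ := by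
      rw [subspaceCard_eq_qBinomial F₁ (Fin n → F₁) (by omega), hV, hq₁]
    obtain ⟨C, hC, hCcard⟩ := exists_isRingCover (n := n) hK hd' hd0 hdn'
    have hmin := min_le_coveringNumber hK (by omega) hd' hd0 hdn
    have hle := coveringNumber_le_of_isRingCover hC
    have hlt := lt_coveringNumber_matrix hn hd' hd0 hdn
    rw [hN, hq] at hCcard hmin hlt
    rw [hCcard] at hle
    rw [hq₁] at hlt
    refine ⟨⟨C, hC, hCcard⟩, fun h => ?_, coveringNumber_le_matrix, fun h => ?_, fun h32 I hI => ?_⟩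
    · have h1 := coveringNumber_lt_matrix_of_isSigmaElementary h
      refine le_antisymm hle ?_
      rcases min_le_iff.1 hmin with h2 | h2
      · exact h2
      · exact absurd h1 (not_lt.2 h2)
    · by_contra h32
      exact absurd (hle.trans_lt (hlt h32)) (not_lt.2 h.ge)
    · exact (hle.trans_lt (hlt h32)).trans_le (coveringNumber_matrix_le_quotient hK (by omega) hI)
  · exact ⟨not_isSigmaElementary hK hn hd' hdn, coveringNumber_eq_matrix hK hn hd' hdn⟩
  · subst hn
    refine not_isSigmaElementary hK le_rfl hd' ?_
    rw [Nat.minFac_two]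
    omega
  · subst hn
    have h := coveringNumber_one hK
    rw [hq₁, hq₂, hq] at h
    exact h
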